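/- Let $N\ge 1$ be an integer, $m>N/2$ real, and $q_\star=\frac{N+2}{N+1}$. Let $H^1_m(\mathbb R^N)$ be the space of real functions $v\in H^1(\mathbb R^N)$ with $$\|v\|_m=\bigl(|v|_m^2+|\nabla v|_m^2\bigr)^{1/2}<\infty,\qquad |f|_m=\Bigl(\int_{\mathbb R^N}(1+|\xi|^{2m})\,|f(\xi)|^2\,d\xi\Bigr)^{1/2}.$$ Let $\mathcal L v=\Delta v+\frac12\,\xi\cdot\nabla v+\frac N2 v$, and let $(e^{\tau\mathcal L})_{\tau\ge0}$ be the semigroup it generates: $e^{0\mathcal L}=\mathrm{id}$ and, for $\tau>0$, $$(e^{\tau\mathcal L}w)(\xi)=\frac{1}{(4\pi a(\tau))^{N/2}}\int_{\mathbb R^N}\exp\Bigl(-\frac{|\xi-e^{-\tau/2}\eta|^2}{4a(\tau)}\Bigr)w(\eta)\,d\eta,\qquad a(\tau)=1-e^{-\tau}.$$ Fix $\chi\in C^\infty([0,\infty))$ with $0\le\chi\le1$, $\chi(r)=1$ for $r\le1$ and $\chi(r)=0$ for $r\ge4$. For $\varrho\in(0,1)$ put $F_\varrho(v)=\chi(\|v\|_m^2/\varrho^2)\,|\nabla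 v|^{q_\star}$, $v\in H^1_m(\mathbb R^N)$. Then $e^{\mathcal L}$ is a bounded linear operator on $H^1_m(\mathbb R^N)$, and there is a constant $C>0$, independent of $\varrho$ (it may depend on $N$, $m$ and $\chi$), such that for every $\varrho\in(0,1)$ the following holds. For every $v_0\in H^1_m(\mathbb R^N)$ the problem $\partial_\tau v=\mathcal L v-F_\varrho(v)$, $v(0)=v_0$, has a unique global mild solution $v\in C([0,\infty);H^1_m(\mathbb R^N))$, that is, a unique such $v$ with $$v(\tau)=e^{\tau\mathcal L}v_0-\int_0^\tau e^{(\tau-s)\mathcal L}F_\varrho(v(s))\,ds\quad\text{in }H^1_m(\mathbb R^N),\qquad \tau\ge0;$$ and, with $\varphi_\tau(v_0)=v(\tau)$, the map $\mathcal R=\varphi_1-e^{\mathcal L}$ belongs to $C^1(H^1_m(\mathbb R^N);H^1_m(\mathbb R^N))$, satisfies $\mathcal R(0)=0$ and $D\mathcal R(0)=0$, and is globally Lipschitz continuous with $$\|\mathcal R(v)-\mathcal R(w)\|_m\le C\,\varrho^{\,q_\star-1}\,\|v-w\|_m\qquad\text{for all }v,w\in H^1_m(\mathbb R^N).$$ 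-/

import Mathlib

open MeasureTheory Set
open scoped ContDiff NNReal ENNReal

noncomputable section

namespace ViscousHJ

/-- Euclidean space `ℝ^N`. -/
abbrev E (N : ℕ) : Type := EuclideanSpace ℝ (Fin N)

/-- The critical exponent `q⋆ = (N+2)/(N+1)`. -/
def qStar (N : ℕ) : ℝ := ((N : ℝ) + 2) / ((N : ℝ) + 1)

/-- The measure `(1 + |ξ|^{2m}) dξ`, so that `L²_m(ℝ^N)` is `Lp ℝ 2 (weightMeasure N m)`. -/
def weightMeasure (N : ℕ) (m : ℝ) : Measure (E N) :=
  (volume : Measure (E N)).withDensity (fun ξ => ENNReal.ofReal (1 + ‖ξ‖ ^ (2 * m)))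

/-- `g` is the weak gradient of `v` on `ℝ^N`: for every test function `ψ ∈ C_c^∞(ℝ^N)` and every
direction `e`, `∫ v ∂_e ψ = - ∫ (g · e) ψ`. -/
def IsWeakGradient {N : ℕ} (v : E N → ℝ) (g : E N → E N) : Prop :=
  ∀ ψ : E N → ℝ, ContDiff ℝ ∞ ψ → HasCompactSupport ψ → ∀ e : E N,
    ∫ ξ, v ξ * fderiv ℝ ψ ξ e = - ∫ ξ, inner ℝ (g ξ) e * ψ ξ

theorem volume_le_weightMeasure (N : ℕ) (m : ℝ) :
    (volume : Measure (E N)) ≤ weightMeasure N m := by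
  have h : (volume : Measure (E N)).withDensity (fun _ => (1 : ℝ≥0∞)) ≤ weightMeasure N m := by
    refine withDensity_mono (Filter.Eventually.of_forall fun ξ => ?_)
    simp only [ENNReal.one_le_ofReal]
    have : 0 ≤ ‖ξ‖ ^ (2 * m) := Real.rpow_nonneg (norm_nonneg _) _
    linarith
  simpa [withDensity_const] using h

theorem ae_volume_of_ae_weight {N : ℕ} {m : ℝ} {p : E N → Prop}
    (h : ∀ᵐ ξ ∂(weightMeasure N m), p ξ) : ∀ᵐ ξ, p ξ :=
  (Measure.absolutelyContinuous_of_le (volume_le_weightMeasure N m)).ae_le h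

theorem integrable_mul_fderiv {N : ℕ} {m : ℝ} (v : Lp ℝ 2 (weightMeasure N m))
    {ψ : E N → ℝ} (hψ : ContDiff ℝ ∞ ψ) (hc : HasCompactSupport ψ) (e : E N) :
    Integrable (fun ξ => v ξ * fderiv ℝ ψ ξ e) (volume : Measure (E N)) := by
  have h1 : MemLp v 2 (volume : Measure (E N)) :=
    (Lp.memLp v).mono_measure (volume_le_weightMeasure N m)
  have hcont : Continuous (fun ξ => fderiv ℝ ψ ξ e) :=
    (hψ.continuous_fderiv (by simp)).clm_apply continuous_const
  have h2 : MemLp (fun ξ => fderiv ℝ ψ ξ e) 2 (volume : Measure (E N)) :=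
    hcont.memLp_of_hasCompactSupport (hc.fderiv_apply (𝕜 := ℝ) e)
  exact h1.integrable_mul h2

theorem integrable_inner_mul {N : ℕ} {m : ℝ} (g : Lp (E N) 2 (weightMeasure N m))
    {ψ : E N → ℝ} (hψ : ContDiff ℝ ∞ ψ) (hc : HasCompactSupport ψ) (e : E N) :
    Integrable (fun ξ => inner ℝ (g ξ) e * ψ ξ) (volume : Measure (E N)) := by
  have h1 : MemLp (fun ξ => inner ℝ (g ξ) e) 2 (volume : Measure (E N)) :=
    ((Lp.memLp g).mono_measure (volume_le_weightMeasure N m)).inner_const e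
  have h2 : MemLp ψ 2 (volume : Measure (E N)) := hψ.continuous.memLp_of_hasCompactSupport hc
  exact h1.integrable_mul h2

/-- The weighted Sobolev space `H¹_m(ℝ^N)` of real functions: an element is the pair `(v, ∇v)`
with `v` and its weak gradient `∇v` in the weighted space `L²_m`. The weak gradient is determined
by `v`. The norm is the one of the `ℓ²`-product, `‖v‖_m = (|v|_m² + |∇v|_m²)^{1/2}`. -/
def H1m (N : ℕ) (m : ℝ) :
    Submodule ℝ (WithLp 2 (Lp ℝ 2 (weightMeasure N m) × Lp (E N) 2 (weightMeasure N m))) where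
  carrier := {u | IsWeakGradient (fun ξ => u.fst ξ) (fun ξ => u.snd ξ)}
  zero_mem' := by
    intro ψ _ _ e
    have h1 := ae_volume_of_ae_weight (Lp.coeFn_zero ℝ 2 (weightMeasure N m))
    have h2 := ae_volume_of_ae_weight (Lp.coeFn_zero (E N) 2 (weightMeasure N m))
    have i1 := integral_congr_ae (g := fun _ => (0 : ℝ)) (h1.mono fun ξ h => by
      show (0 : Lp ℝ 2 (weightMeasure N m)) ξ * fderiv ℝ ψ ξ e = 0
      rw [h, Pi.zero_apply, zero_mul])
    have i2 := integral_congr_ae (g := fun _ => (0 : ℝ)) (h2.mono fun ξ h => by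
      show inner ℝ ((0 : Lp (E N) 2 (weightMeasure N m)) ξ) e * ψ ξ = 0
      rw [h, Pi.zero_apply, inner_zero_left, zero_mul])
    simp only [WithLp.zero_fst, WithLp.zero_snd]
    rw [i1, i2, integral_zero, neg_zero]
  add_mem' := by
    intro u w hu hw ψ hψ hc e
    have h1 := ae_volume_of_ae_weight (Lp.coeFn_add u.fst w.fst)
    have h2 := ae_volume_of_ae_weight (Lp.coeFn_add u.snd w.snd)
    have i1 := integral_congr_ae
      (g := fun ξ => u.fst ξ * fderiv ℝ ψ ξ e + w.fst ξ * fderiv ℝ ψ ξ e) (h1.mono fun ξ h => by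
        show (u.fst + w.fst) ξ * fderiv ℝ ψ ξ e = _
        rw [h, Pi.add_apply, add_mul])
    have i2 := integral_congr_ae
      (g := fun ξ => inner ℝ (u.snd ξ) e * ψ ξ + inner ℝ (w.snd ξ) e * ψ ξ) (h2.mono fun ξ h => by
        show inner ℝ ((u.snd + w.snd) ξ) e * ψ ξ = _
        rw [h, Pi.add_apply, inner_add_left, add_mul])
    simp only [WithLp.add_fst, WithLp.add_snd]
    rw [i1, i2, integral_add (integrable_mul_fderiv _ hψ hc e) (integrable_mul_fderiv _ hψ hc e),
      integral_add (integrable_inner_mul _ hψ hc e) (integrable_inner_mul _ hψ hc e),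
      hu ψ hψ hc e, hw ψ hψ hc e, neg_add]
  smul_mem' := by
    intro c u hu ψ hψ hc e
    have h1 := ae_volume_of_ae_weight (Lp.coeFn_smul c u.fst)
    have h2 := ae_volume_of_ae_weight (Lp.coeFn_smul c u.snd)
    have i1 := integral_congr_ae
      (g := fun ξ => c * (u.fst ξ * fderiv ℝ ψ ξ e)) (h1.mono fun ξ h => by
        show (c • u.fst) ξ * fderiv ℝ ψ ξ e = _
        rw [h, Pi.smul_apply, smul_eq_mul, mul_assoc])
    have i2 := integral_congr_ae
      (g := fun ξ => c * (inner ℝ (u.snd ξ) e * ψ ξ)) (h2.mono fun ξ h => by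
        show inner ℝ ((c • u.snd) ξ) e * ψ ξ = _
        rw [h, Pi.smul_apply, real_inner_smul_left, mul_assoc])
    simp only [WithLp.smul_fst, WithLp.smul_snd]
    rw [i1, i2, integral_const_mul, integral_const_mul, hu ψ hψ hc e, mul_neg]

/-- The function underlying an element of `H¹_m` (a representative of its a.e. class). -/
def fn {N : ℕ} {m : ℝ} (u : H1m N m) : E N → ℝ := fun ξ => u.1.fst ξ

/-- The weak gradient of an element of `H¹_m` (a representative of its a.e. class). -/
def grad {N : ℕ} {m : ℝ} (u : H1m N m) : E N → E N := fun ξ => u.1.snd ξ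

/-- `u ∈ H¹_m` is the (a.e. class of the) function `f`. -/
def Represents {N : ℕ} {m : ℝ} (u : H1m N m) (f : E N → ℝ) : Prop :=
  ∀ᵐ ξ : E N, fn u ξ = f ξ

/-- The operator `𝓛 v = Δ v + ½ ξ · ∇v + (N/2) v`. -/
def opL {N : ℕ} (f : E N → ℝ) (ξ : E N) : ℝ :=
  Laplacian.laplacian f ξ + 1 / 2 * fderiv ℝ f ξ ξ + (N : ℝ) / 2 * f ξ

/-- The integral kernel of `e^{τ𝓛}`, `τ > 0`: with `a(τ) = 1 - e^{-τ}`,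
`k(τ, ξ, η) = (4π a(τ))^{-N/2} exp(-|ξ - e^{-τ/2} η|² / (4 a(τ)))`. -/
def kernelL {N : ℕ} (τ : ℝ) (ξ η : E N) : ℝ :=
  (4 * Real.pi * (1 - Real.exp (-τ))) ^ (-(N : ℝ) / 2) *
    Real.exp (-‖ξ - Real.exp (-τ / 2) • η‖ ^ 2 / (4 * (1 - Real.exp (-τ))))

/-- The kernel solves the linear equation: `∂_τ k = 𝓛 k` in the variables `(τ, ξ)`. -/
theorem hasDerivAt_kernelL {N : ℕ} {τ : ℝ} (hτ : 0 < τ) (ξ η : E N) :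
    HasDerivAt (fun t => kernelL t ξ η) (opL (fun x => kernelL τ x η) ξ) τ := by
  have ha : 0 < 1 - Real.exp (-τ) := by
    have : Real.exp (-τ) < 1 := Real.exp_lt_one_iff.mpr (by linarith)
    linarith
  obtain ⟨B, hB⟩ : ∃ B : E N →L[ℝ] E N →L[ℝ] ℝ, ∀ u v, B u v = inner ℝ u v :=
    ⟨innerSL ℝ, fun _ _ => rfl⟩
  set y : E N := Real.exp (-τ / 2) • η with hy
  set a : ℝ := 1 - Real.exp (-τ) with hadef
  set A : ℝ := (4 * Real.pi * a) ^ (-(N : ℝ) / 2) with hA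
  have hk : ∀ x : E N, kernelL τ x η = A * Real.exp (-‖x - y‖ ^ 2 * (4 * a)⁻¹) := by
    intro x
    rw [← div_eq_mul_inv]
    rfl
  have hf : ∀ x : E N, HasFDerivAt (fun x => kernelL τ x η)
      ((-(1 / (2 * a)) * kernelL τ x η) • B (x - y)) x := by
    intro x
    have h1 : HasFDerivAt (fun x : E N => ‖x - y‖ ^ 2) ((2 : ℝ) • B (x - y)) x := by
      refine (((hasFDerivAt_id x).sub_const y).norm_sq).congr_fderiv ?_
      ext v
      simp [hB]
    have h2 := (((h1.fun_neg.mul_const (4 * a)⁻¹).exp).const_mul A)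
    rw [funext hk]
    refine h2.congr_fderiv ?_
    ext v
    simp only [FunLike.coe_smul, Pi.smul_apply, FunLike.coe_neg, Pi.neg_apply, smul_eq_mul, hk]
    field_simp
    ring
  have hfd : fderiv ℝ (fun x => kernelL τ x η) =
      fun x => (-(1 / (2 * a)) * kernelL τ x η) • B (x - y) :=
    funext fun x => (hf x).fderiv
  have hlap : Laplacian.laplacian (fun x => kernelL τ x η) ξ =
      kernelL τ ξ η * (‖ξ - y‖ ^ 2 / (4 * a ^ 2) - N / (2 * a)) := by
    have h2 : HasFDerivAt (fun x => (-(1 / (2 * a)) * kernelL τ x η) • B (x - y))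
        ((-(1 / (2 * a)) * kernelL τ ξ η) • B +
          ((-(1 / (2 * a))) • ((-(1 / (2 * a)) * kernelL τ ξ η) • B (ξ - y))).smulRight
            (B (ξ - y))) ξ := by
      have h3 : HasFDerivAt (fun x : E N => B (x - y)) B ξ :=
        (B.hasFDerivAt (x := ξ - y)).comp ξ ((hasFDerivAt_id ξ).sub_const y)
      exact ((hf ξ).const_mul _).smul h3
    have hn : ‖ξ - y‖ ^ 2 = ∑ i, (ξ - y) i * (ξ - y) i := by
      rw [EuclideanSpace.norm_sq_eq]
      exact Finset.sum_congr rfl fun i _ => by rw [Real.norm_eq_abs, sq_abs, sq]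
    rw [InnerProductSpace.laplacian_eq_iteratedFDeriv_orthonormalBasis _
      (EuclideanSpace.basisFun (Fin N) ℝ)]
    simp only [iteratedFDeriv_two_apply, hfd, h2.fderiv]
    have hterm : ∀ i : Fin N, (((-(1 / (2 * a)) * kernelL τ ξ η) • B +
        ((-(1 / (2 * a))) • ((-(1 / (2 * a)) * kernelL τ ξ η) • B (ξ - y))).smulRight
            (B (ξ - y))) (EuclideanSpace.basisFun (Fin N) ℝ i))
              (EuclideanSpace.basisFun (Fin N) ℝ i) =
        kernelL τ ξ η / (4 * a ^ 2) * ((ξ - y) i * (ξ - y) i) -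
          kernelL τ ξ η / (2 * a) := by
      intro i
      simp [hB, EuclideanSpace.inner_single_right]
      field_simp
      ring
    refine (Finset.sum_congr rfl fun i _ => hterm i).trans ?_
    rw [Finset.sum_sub_distrib, ← Finset.mul_sum, ← hn]
    simp
    ring
  have ha' : HasDerivAt (fun t : ℝ => 1 - Real.exp (-t)) (1 - a) τ := by
    have h := ((hasDerivAt_neg τ).exp).const_sub 1
    simpa [hadef] using h
  have hy' : HasDerivAt (fun t : ℝ => ξ - Real.exp (-t / 2) • η) ((1 / 2 : ℝ) • y) τ := by
    have h := ((((hasDerivAt_id τ).neg.div_const 2).exp).smul_const η).const_sub ξ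
    refine h.congr_deriv ?_
    simp only [hy, smul_smul, ← neg_smul]
    congr 1
    simp
    ring
  have hA' := (ha'.const_mul (4 * Real.pi)).rpow_const (p := -(N : ℝ) / 2)
    (Or.inl (by positivity))
  have hE := (hy'.norm_sq.fun_neg.fun_div (ha'.const_mul 4) (by positivity)).exp
  refine (hA'.fun_mul hE).congr_deriv ?_
  have hpow : (4 * Real.pi * a) ^ (-(N : ℝ) / 2 - 1) = A / (4 * Real.pi * a) := by
    rw [hA, Real.rpow_sub_one (by positivity)]
  have hin : inner ℝ (ξ - y) ξ = ‖ξ - y‖ ^ 2 + inner ℝ (ξ - y) y := by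
    rw [← real_inner_self_eq_norm_sq, ← inner_add_right, sub_add_cancel]
  simp only [opL, hlap, hfd, FunLike.coe_smul, Pi.smul_apply, smul_eq_mul, hB, hin]
  simp only [← hadef, ← hy, hpow, ← hA, hk, inner_smul_right, ← div_eq_mul_inv]
  have hpi := Real.pi_pos
  field_simp
  ring

/-- The semigroup `e^{τ𝓛}`, `τ ≥ 0`, generated by `𝓛`. It acts on all integrable functions (the
Duhamel formula below applies it to functions that need not lie in `L²_m`). -/
def expL {N : ℕ} (τ : ℝ) (f : E N → ℝ) (ξ : E N) : ℝ :=
  if τ ≤ 0 then f ξ else ∫ η, kernelL τ ξ η * f η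

/-- The truncated nonlinearity `F_ϱ(v) = χ(‖v‖_m² / ϱ²) |∇v|^{q⋆}`. -/
def truncF {N : ℕ} {m : ℝ} (χ : ℝ → ℝ) (ϱ : ℝ) (v : H1m N m) (ξ : E N) : ℝ :=
  χ (‖v‖ ^ 2 / ϱ ^ 2) * ‖grad v ξ‖ ^ qStar N

/-- `v` is a global (mild) solution in `C([0,∞); H¹_m)` of `∂_τ v = 𝓛 v - F_ϱ(v)`, `v(0) = v₀`:
`v(τ) = e^{τ𝓛} v₀ - ∫₀^τ e^{(τ-s)𝓛} F_ϱ(v(s)) ds` for all `τ ≥ 0`, where the integral is a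
(convergent) Bochner integral in `H¹_m`. Here `w` is `e^{τ𝓛} v₀` and `g s` is
`e^{(τ-s)𝓛} F_ϱ(v(s))`, as elements of `H¹_m`. Only the values of `v` on `[0,∞)` matter. -/
structure IsGlobalSolution {N : ℕ} {m : ℝ} (χ : ℝ → ℝ) (ϱ : ℝ) (v₀ : H1m N m)
    (v : ℝ → H1m N m) : Prop where
  continuousOn : ContinuousOn v (Ici 0)
  duhamel : ∀ τ : ℝ, 0 ≤ τ → ∃ (w : H1m N m) (g : ℝ → H1m N m),
    Represents w (expL τ (fn v₀)) ∧
    (∀ s ∈ Ico 0 τ, Represents (g s) (expL (τ - s) (truncF χ ϱ (v s)))) ∧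
    IntervalIntegrable g volume 0 τ ∧
    v τ = w - ∫ s in (0 : ℝ)..τ, g s

/-- `φ` is the semiflow of the truncated equation on `H¹_m`: for each initial datum `v₀` the
equation has the global solution `τ ↦ φ τ v₀`, and no other one. -/
def IsSemiflow {N : ℕ} {m : ℝ} (χ : ℝ → ℝ) (ϱ : ℝ) (φ : ℝ → H1m N m → H1m N m) : Prop :=
  ∀ v₀ : H1m N m, IsGlobalSolution χ ϱ v₀ (fun τ => φ τ v₀) ∧
    ∀ v : ℝ → H1m N m, IsGlobalSolution χ ϱ v₀ v → ∀ τ : ℝ, 0 ≤ τ → v τ = φ τ v₀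

/-- A cut-off function: `χ ∈ C^∞([0,∞))`, `0 ≤ χ ≤ 1`, `χ = 1` on `[0,1]`, `χ = 0` on `[4,∞)`. -/
structure IsCutoff (χ : ℝ → ℝ) : Prop where
  smooth : ContDiffOn ℝ ∞ χ (Ici 0)
  nonneg : ∀ r, 0 ≤ r → 0 ≤ χ r
  le_one : ∀ r, 0 ≤ r → χ r ≤ 1
  eq_one : ∀ r, 0 ≤ r → r ≤ 1 → χ r = 1
  eq_zero : ∀ r, 4 ≤ r → χ r = 0

end ViscousHJ

end

/-!
Up to a scalar factor and dilations, `e^{t𝓛}` is convolution with a Gaussian of variance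
comparable to `1 - e^{-t}`. Gaussian decay absorbs the polynomial weight, so Young's inequality
shows that `e^{t𝓛}` maps the weighted `L^{2/q⋆}` into `H¹_m` with norm `O(t^{-θ})`, where
`θ = (N / (2 (N + 1)) + 1) / 2 < 1`: the singularity at `t = 0` is integrable.

Since `1 < q⋆ ≤ 2`, the map `g ↦ |g|^{q⋆}` is `C¹` from `L²` to `L^{2/q⋆}`, with derivative of
size `O(‖g‖^{q⋆ - 1})`. The cutoff confines it to the ball of radius `2ϱ`, so `F_ϱ` is `C¹`,
vanishes to first order at `0`, and has Lipschitz constant `O(ϱ^{q⋆ - 1})`.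

Duhamel's equation on `[0, a]` reads `u + V (F ∘ u) = e^{·𝓛} v₀` in `C([0, a]; H¹_m)`, with `V` a
Volterra operator. Conjugating by `e^{lτ}` makes `V` small, so the left-hand side is a
homeomorphism whose inverse is Lipschitz and `C¹`. The remainder
`𝓡 v₀ = -∫₀¹ e^{(1-s)𝓛} F_ϱ (v(s)) ds` then inherits from `F_ϱ` the smoothness, the vanishing to
first order and the Lipschitz constant.
-/

noncomputable section

namespace ViscousHJ

open Filter
open scoped Topology

/-! ### Superposition operators on `C(K, X)` -/

section Superposition

variable {K X Y : Type*} [TopologicalSpace K] [CompactSpace K]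

theorem lipschitzWith_postcomp [PseudoMetricSpace X] [PseudoMetricSpace Y] (F : C(X, Y))
    {L : ℝ≥0} (hF : LipschitzWith L F) : LipschitzWith L (F.comp : C(K, X) → C(K, Y)) :=
  LipschitzWith.of_dist_le_mul fun f g => (ContinuousMap.dist_le (by positivity)).2 fun k =>
    (hF.dist_le_mul _ _).trans (by gcongr; exact ContinuousMap.dist_apply_le_dist k)

theorem exists_forall_ball_norm_sub_le [NormedAddCommGroup X] [NormedAddCommGroup Y]
    (G : C(X, Y)) (f : C(K, X)) {ε : ℝ} (hε : 0 < ε) :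
    ∃ δ > 0, ∀ k, ∀ x ∈ Metric.ball (f k) δ, ‖G x - G (f k)‖ ≤ ε := by
  obtain ⟨δ, hδ, H⟩ := Metric.continuous_iff.1 (ContinuousMap.continuous_postcomp G) f ε hε
  refine ⟨δ, hδ, fun k x hx => ?_⟩
  have hshift : dist (f + ContinuousMap.const K (x - f k)) f < δ := by
    rw [dist_eq_norm, add_sub_cancel_left]
    refine lt_of_le_of_lt ((ContinuousMap.norm_le _ (norm_nonneg (x - f k))).2 fun _ => le_rfl) ?_
    rwa [← dist_eq_norm]
  have hk := (ContinuousMap.dist_apply_le_dist k).trans_lt (H _ hshift)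
  simp only [ContinuousMap.comp_apply, ContinuousMap.add_apply, ContinuousMap.const_apply,
    add_sub_cancel, dist_eq_norm] at hk
  exact hk.le

variable [NormedAddCommGroup X] [NormedSpace ℝ X] [NormedAddCommGroup Y] [NormedSpace ℝ Y]

/-- Pointwise application `(A f)(k) = A(k) f(k)` of a continuous family of operators, as a
continuous bilinear map. -/
def pointwiseApply : C(K, X →L[ℝ] Y) →L[ℝ] C(K, X) →L[ℝ] C(K, Y) :=
  LinearMap.mkContinuous₂
    (LinearMap.mk₂ ℝ (fun (A : C(K, X →L[ℝ] Y)) (f : C(K, X)) =>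
        (⟨fun k => A k (f k), A.continuous.clm_apply f.continuous⟩ : C(K, Y)))
      (fun _ _ _ => by ext; simp) (fun _ _ _ => by ext; simp)
      (fun _ _ _ => by ext; simp) (fun _ _ _ => by ext; simp)) 1 fun A f => by
    rw [one_mul, ContinuousMap.norm_le _ (by positivity)]
    exact fun k => ((A k).le_opNorm _).trans
      (by gcongr; exacts [A.norm_coe_le_norm k, f.norm_coe_le_norm k])

@[simp]
theorem pointwiseApply_apply (A : C(K, X →L[ℝ] Y)) (f : C(K, X)) (k : K) :
    pointwiseApply A f k = A k (f k) := rfl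

theorem hasFDerivAt_postcomp (F : C(X, Y)) (F' : C(X, X →L[ℝ] Y))
    (hF : ∀ x, HasFDerivAt F (F' x) x) (f : C(K, X)) :
    HasFDerivAt (F.comp : C(K, X) → C(K, Y)) (pointwiseApply (F'.comp f)) f := by
  rw [hasFDerivAt_iff_isLittleO_nhds_zero, Asymptotics.isLittleO_iff]
  intro ε hε
  obtain ⟨δ, hδ, hball⟩ := exists_forall_ball_norm_sub_le F' f hε
  filter_upwards [Metric.ball_mem_nhds (0 : C(K, X)) hδ] with h hh
  rw [ContinuousMap.norm_le _ (by positivity)]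
  intro k
  have hk : ‖h k‖ ≤ ‖h‖ := h.norm_coe_le_norm k
  have hmem : f k + h k ∈ Metric.ball (f k) δ := by
    rw [mem_ball_iff_norm, add_sub_cancel_left]
    exact hk.trans_lt (mem_ball_zero_iff.1 hh)
  have hmean : ‖F (f k + h k) - F (f k) - F' (f k) (h k)‖ ≤ ε * ‖h k‖ := by
    simpa only [add_sub_cancel_left] using
      (convex_ball (f k) δ).norm_image_sub_le_of_norm_hasFDerivWithin_le'
        (fun x _ => (hF x).hasFDerivWithinAt) (hball k) (Metric.mem_ball_self hδ) hmem
  exact hmean.trans (by gcongr)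

theorem contDiff_postcomp (F : C(X, Y)) (hF : ContDiff ℝ 1 F) :
    ContDiff ℝ 1 (F.comp : C(K, X) → C(K, Y)) := by
  obtain ⟨F', hc, hd⟩ := contDiff_one_iff_hasFDerivAt.1 hF
  exact contDiff_one_iff_hasFDerivAt.2 ⟨fun f => pointwiseApply ((⟨F', hc⟩ : C(X, _)).comp f),
    pointwiseApply.continuous.comp (ContinuousMap.continuous_postcomp _),
    hasFDerivAt_postcomp F ⟨F', hc⟩ hd⟩

theorem hasFDerivAt_postcomp_zero (F : C(X, Y)) (hF : ContDiff ℝ 1 F) (hF0 : fderiv ℝ F 0 = 0) :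
    HasFDerivAt (F.comp : C(K, X) → C(K, Y)) (0 : C(K, X) →L[ℝ] C(K, Y)) 0 := by
  obtain ⟨F', hc, hd⟩ := contDiff_one_iff_hasFDerivAt.1 hF
  refine (hasFDerivAt_postcomp F ⟨F', hc⟩ hd 0).congr_fderiv ?_
  ext u k
  simp [← (hd 0).fderiv, hF0]

end Superposition

section LipschitzPerturbation

variable {Z : Type*} [NormedAddCommGroup Z] [NormedSpace ℝ Z] {P : Z → Z} {c : ℝ≥0}

theorem approximatesLinearOn_id_add (hP : LipschitzWith c P) :
    ApproximatesLinearOn (fun z => z + P z)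
      ((ContinuousLinearEquiv.refl ℝ Z : Z ≃L[ℝ] Z) : Z →L[ℝ] Z) univ c := by
  rw [ApproximatesLinearOn.approximatesLinearOn_iff_lipschitzOnWith]
  convert hP.lipschitzOnWith (s := univ) using 1
  ext z
  simp

variable [CompleteSpace Z]

/-- The homeomorphism `z ↦ z + P z` for a contraction `P` of a Banach space. -/
def idAddHomeomorph (hP : LipschitzWith c P) (hc : c < 1) : Z ≃ₜ Z :=
  (approximatesLinearOn_id_add hP).toHomeomorph _ <| by
    rcases subsingleton_or_nontrivial Z with h | h
    · exact Or.inl h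
    · have hnorm : ‖((ContinuousLinearEquiv.refl ℝ Z).symm : Z →L[ℝ] Z)‖₊ = 1 :=
        NNReal.eq (by simp)
      exact Or.inr (by rwa [hnorm, inv_one])

theorem lipschitzWith_idAddHomeomorph_symm (hP : LipschitzWith c P) (hc : c < 1) :
    LipschitzWith (1 - c)⁻¹ (idAddHomeomorph hP hc).symm := by
  have hanti : AntilipschitzWith (1 - c)⁻¹ fun z => z + P z := by
    simpa using AntilipschitzWith.id.add_lipschitzWith hP (by simpa using hc)
  exact hanti.to_rightInverse (idAddHomeomorph hP hc).apply_symm_apply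

theorem contDiff_idAddHomeomorph_symm (hP : LipschitzWith c P) (hc : c < 1)
    (hPC : ContDiff ℝ 1 P) : ContDiff ℝ 1 (idAddHomeomorph hP hc).symm := by
  have hnorm : ∀ z, ‖-fderiv ℝ P z‖ < 1 := fun z => by
    rw [norm_neg]
    exact (norm_fderiv_le_of_lipschitz ℝ hP).trans_lt hc
  let U : Z → Z ≃L[ℝ] Z := fun z =>
    ContinuousLinearEquiv.unitsEquiv ℝ Z (Units.oneSub (-fderiv ℝ P z) (hnorm z))
  refine Homeomorph.contDiff_symm (idAddHomeomorph hP hc) (f₀' := U) (fun z => ?_)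
    (contDiff_id.add hPC)
  refine ((hasFDerivAt_id z).add (hPC.differentiable (by simp) z).hasFDerivAt).congr_fderiv ?_
  ext x
  simp [U]

end LipschitzPerturbation

/-! ### Volterra operators with a singular kernel -/

section Volterra

variable {X Y : Type*} [NormedAddCommGroup X] [NormedSpace ℝ X] [NormedAddCommGroup Y]
  [NormedSpace ℝ Y]

/-- A strongly continuous family of bounded operators on `(0, a]` whose norms are dominated by an
integrable function that is continuous on `(0, a]`. -/
structure IsSingularKernel (T : ℝ → Y →L[ℝ] X) (a : ℝ) (β : ℝ → ℝ) : Prop where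
  cont : ∀ y, ContinuousOn (fun t => T t y) (Ioc 0 a)
  bound : ∀ t ∈ Ioc 0 a, ‖T t‖ ≤ β t
  contBound : ContinuousOn β (Ioc 0 a)
  integrable : IntegrableOn β (Ioc 0 a)

variable {T : ℝ → Y →L[ℝ] X} {a : ℝ} {β : ℝ → ℝ}

theorem IsSingularKernel.nonneg (hT : IsSingularKernel T a β) {t : ℝ} (ht : t ∈ Ioc 0 a) :
    0 ≤ β t := (norm_nonneg _).trans (hT.bound t ht)

theorem IsSingularKernel.integral_nonneg (hT : IsSingularKernel T a β) :
    0 ≤ ∫ t in Ioc 0 a, β t :=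
  setIntegral_nonneg measurableSet_Ioc fun _ ht => hT.nonneg ht

theorem IsSingularKernel.continuousOn_apply (hT : IsSingularKernel T a β) {h : ℝ → Y}
    (hh : Continuous h) : ContinuousOn (fun s => T s (h s)) (Ioc 0 a) := by
  intro s₀ hs₀
  have hdiff : Tendsto (fun s => T s (h s - h s₀)) (𝓝[Ioc 0 a] s₀) (𝓝 0) := by
    have hbound : Tendsto (fun s => β s * ‖h s - h s₀‖) (𝓝[Ioc 0 a] s₀) (𝓝 0) := by
      have hh₀ : ContinuousWithinAt (fun s => ‖h s - h s₀‖) (Ioc 0 a) s₀ :=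
        Continuous.continuousWithinAt (by fun_prop)
      simpa using (hT.contBound s₀ hs₀).tendsto.mul hh₀.tendsto
    refine squeeze_zero_norm' ?_ hbound
    filter_upwards [self_mem_nhdsWithin] with s hs
    exact ((T s).le_opNorm _).trans (by gcongr; exact hT.bound s hs)
  have hsum := hdiff.add (hT.cont (h s₀) s₀ hs₀).tendsto
  rw [zero_add] at hsum
  exact hsum.congr fun s => by rw [map_sub, sub_add_cancel]

theorem IsSingularKernel.integrableOn_apply (hT : IsSingularKernel T a β) {h : ℝ → Y}
    (hh : Continuous h) {B : ℝ} (hB : ∀ s, ‖h s‖ ≤ B) {τ : ℝ} (hτ : τ ≤ a) :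
    IntegrableOn (fun s => T s (h s)) (Ioc 0 τ) := by
  have hsub : Ioc 0 τ ⊆ Ioc 0 a := Ioc_subset_Ioc_right hτ
  refine ((hT.integrable.mono_set hsub).mul_const B).mono'
    (((hT.continuousOn_apply hh).mono hsub).aestronglyMeasurable measurableSet_Ioc) ?_
  filter_upwards [ae_restrict_mem measurableSet_Ioc] with s hs
  have h0 := hT.nonneg (hsub hs)
  exact ((T s).le_opNorm _).trans (by gcongr; exacts [hT.bound s (hsub hs), hB s])

/-- The operator-valued convolution `(T * h)(τ) = ∫₀^τ T(τ - s) h(s) ds` of Duhamel's formula. -/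
def volterra (T : ℝ → Y →L[ℝ] X) (h : ℝ → Y) (τ : ℝ) : X := ∫ s in (0 : ℝ)..τ, T (τ - s) (h s)

theorem volterra_eq_comp_sub (T : ℝ → Y →L[ℝ] X) (h : ℝ → Y) (τ : ℝ) :
    volterra T h τ = ∫ s in (0 : ℝ)..τ, T s (h (τ - s)) := by
  have := intervalIntegral.integral_comp_sub_left (a := 0) (b := τ)
    (fun s => T s (h (τ - s))) τ
  simpa [volterra] using this

theorem IsSingularKernel.intervalIntegrable (hT : IsSingularKernel T a β) {h : ℝ → Y}
    (hh : Continuous h) {B : ℝ} (hB : ∀ s, ‖h s‖ ≤ B) {τ : ℝ} (hτ : τ ∈ Icc 0 a) :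
    IntervalIntegrable (fun s => T (τ - s) (h s)) volume 0 τ := by
  have h1 : IntervalIntegrable (fun s => T s (h (τ - s))) volume 0 τ := by
    rw [intervalIntegrable_iff_integrableOn_Ioc_of_le hτ.1]
    exact hT.integrableOn_apply (h := fun s => h (τ - s)) (by fun_prop) (fun s => hB _) hτ.2
  have := (h1.comp_sub_left τ).symm
  simpa using this

theorem IsSingularKernel.norm_volterra_le (hT : IsSingularKernel T a β) {h : ℝ → Y}
    {B : ℝ} (hB : ∀ s, ‖h s‖ ≤ B) {τ : ℝ} (hτ : τ ∈ Icc 0 a) :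
    ‖volterra T h τ‖ ≤ (∫ t in Ioc 0 a, β t) * B := by
  have hB0 : 0 ≤ B := (norm_nonneg _).trans (hB 0)
  have hsub : Ioc 0 τ ⊆ Ioc 0 a := Ioc_subset_Ioc_right hτ.2
  rw [volterra_eq_comp_sub, intervalIntegral.integral_of_le hτ.1]
  calc ‖∫ s in Ioc 0 τ, T s (h (τ - s))‖ ≤ ∫ s in Ioc 0 τ, β s * B := by
        refine norm_integral_le_of_norm_le ((hT.integrable.mono_set hsub).mul_const B) ?_
        filter_upwards [ae_restrict_mem measurableSet_Ioc] with s hs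
        have h0 := hT.nonneg (hsub hs)
        exact ((T s).le_opNorm _).trans (by gcongr; exacts [hT.bound s (hsub hs), hB _])
    _ ≤ ∫ s in Ioc 0 a, β s * B := by
        refine setIntegral_mono_set (hT.integrable.mul_const B) ?_ hsub.eventuallyLE
        filter_upwards [ae_restrict_mem measurableSet_Ioc] with s hs
        exact mul_nonneg (hT.nonneg hs) hB0
    _ = _ := integral_mul_const _ _

theorem IsSingularKernel.continuousOn_volterra (hT : IsSingularKernel T a β) {h : ℝ → Y}
    (hh : Continuous h) {B : ℝ} (hB : ∀ s, ‖h s‖ ≤ B) :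
    ContinuousOn (volterra T h) (Icc 0 a) := by
  let G : ℝ → ℝ → X := fun τ => (Ioc 0 a).indicator fun s => T s (h (τ - s))
  have hG : EqOn (volterra T h) (fun τ => ∫ s in (0 : ℝ)..τ, G τ s) (Icc 0 a) := fun τ hτ => by
    rw [volterra_eq_comp_sub]
    refine intervalIntegral.integral_congr_ae (.of_forall fun s hs => ?_)
    rw [uIoc_of_le hτ.1] at hs
    exact (indicator_of_mem (Ioc_subset_Ioc_right hτ.2 hs) fun s => T s (h (τ - s))).symm
  refine ContinuousOn.congr (fun τ₀ hτ₀ => ContinuousAt.continuousWithinAt ?_) hG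
  have hcont : ContinuousAt (fun p : ℝ × ℝ => ∫ s in (0 : ℝ)..p.2, G p.1 s) (τ₀, τ₀) := by
    refine intervalIntegral.continuousAt_parametric_primitive_of_dominated
      ((Ioc 0 a).indicator fun s => β s * B) (-1) (a + 1) (fun τ => ?_)
      (.of_forall fun τ => .of_forall fun s => ?_) ?_ (.of_forall fun s => ?_)
      ⟨by linarith, by linarith [hτ₀.1.trans hτ₀.2]⟩ ⟨by linarith [hτ₀.1], by linarith [hτ₀.2]⟩
      (by simp)
    · have hmeas := (hT.continuousOn_apply (h := fun s => h (τ - s)) (by fun_prop))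
        |>.aestronglyMeasurable measurableSet_Ioc (μ := volume)
      exact ((aestronglyMeasurable_indicator_iff measurableSet_Ioc).2 hmeas).mono_measure
        Measure.restrict_le_self
    · rw [norm_indicator_eq_indicator_norm]
      refine indicator_le_indicator' fun hs => ?_
      have h0 := hT.nonneg hs
      exact ((T s).le_opNorm _).trans (by gcongr; exacts [hT.bound s hs, hB _])
    · have hint : IntegrableOn (fun s => β s * B) (Ioc 0 a) := hT.integrable.mul_const B
      exact (hint.integrable_indicator measurableSet_Ioc).intervalIntegrable
    · by_cases hs : s ∈ Ioc 0 a
      · simp only [G, indicator_of_mem hs]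
        exact Continuous.continuousAt (by fun_prop)
      · simp only [G, indicator_of_notMem hs]
        exact continuousAt_const
  exact hcont.comp (f := fun τ => (τ, τ)) (by fun_prop)

theorem volterra_congr {h h' : ℝ → Y} {τ : ℝ} (hτ : 0 ≤ τ) (hh : ∀ s ∈ Icc 0 τ, h s = h' s) :
    volterra T h τ = volterra T h' τ := by
  refine intervalIntegral.integral_congr fun s hs => ?_
  rw [uIcc_of_le hτ] at hs
  simp only [hh s hs]

/-- The Volterra operator on `C([0, a])` with a singular kernel. -/
def volterraOp (hT : IsSingularKernel T a β) (ha : 0 ≤ a) : C(Icc 0 a, Y) →L[ℝ] C(Icc 0 a, X) :=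
  LinearMap.mkContinuous
    { toFun := fun f => ⟨fun τ => volterra T (IccExtend ha f) τ,
        (hT.continuousOn_volterra (f.continuous.Icc_extend' (h := ha)) (B := ‖f‖)
          (fun s => f.norm_coe_le_norm _)).domRestrict⟩
      map_add' := fun f g => by
        ext τ
        simp only [ContinuousMap.coe_mk, ContinuousMap.add_apply, volterra]
        rw [← intervalIntegral.integral_add
          (hT.intervalIntegrable (f.continuous.Icc_extend' (h := ha)) (B := ‖f‖)
            (fun s => f.norm_coe_le_norm _) τ.2)
          (hT.intervalIntegrable (g.continuous.Icc_extend' (h := ha)) (B := ‖g‖)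
            (fun s => g.norm_coe_le_norm _) τ.2)]
        simp [IccExtend]
      map_smul' := fun c f => by
        ext τ
        simp only [ContinuousMap.coe_mk, ContinuousMap.smul_apply, volterra, RingHom.id_apply]
        rw [← intervalIntegral.integral_smul]
        simp [IccExtend] }
    (∫ t in Ioc 0 a, β t) (fun f => by
      rw [ContinuousMap.norm_le _ (mul_nonneg hT.integral_nonneg (norm_nonneg _))]
      intro τ
      exact hT.norm_volterra_le (fun s => f.norm_coe_le_norm _) τ.2)

theorem volterraOp_apply (hT : IsSingularKernel T a β) (ha : 0 ≤ a) (f : C(Icc 0 a, Y))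
    (τ : Icc 0 a) : volterraOp hT ha f τ = volterra T (IccExtend ha f) τ := rfl

theorem norm_volterraOp_le (hT : IsSingularKernel T a β) (ha : 0 ≤ a) :
    ‖volterraOp hT ha‖ ≤ ∫ t in Ioc 0 a, β t :=
  LinearMap.mkContinuous_norm_le _ hT.integral_nonneg _

theorem IsSingularKernel.exp_smul (hT : IsSingularKernel T a β) (l : ℝ) :
    IsSingularKernel (fun t => Real.exp (-l * t) • T t) a (fun t => Real.exp (-l * t) * β t) where
  cont y := ContinuousOn.smul (by fun_prop) (hT.cont y)
  bound t ht := by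
    rw [norm_smul, Real.norm_eq_abs, Real.abs_exp]
    gcongr
    exact hT.bound t ht
  contBound := ContinuousOn.mul (by fun_prop) hT.contBound
  integrable := by
    have hexp : ContinuousOn (fun t : ℝ => Real.exp (-l * t)) (Icc 0 a) := by fun_prop
    have hβ : IntegrableOn β (Icc 0 a) := (integrableOn_Icc_iff_integrableOn_Ioc).2 hT.integrable
    exact (hβ.continuousOn_mul hexp isCompact_Icc).mono_set Ioc_subset_Icc_self

theorem IsSingularKernel.tendsto_integral_exp_mul (hT : IsSingularKernel T a β) :
    Tendsto (fun l : ℝ => ∫ t in Ioc 0 a, Real.exp (-l * t) * β t) atTop (𝓝 0) := by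
  suffices Tendsto (fun l : ℝ => ∫ t in Ioc 0 a, Real.exp (-l * t) * β t) atTop
      (𝓝 (∫ _ in Ioc 0 a, (0 : ℝ))) by simpa using this
  refine tendsto_integral_filter_of_dominated_convergence β
    (.of_forall fun l => (hT.exp_smul l).integrable.1) ?_ hT.integrable ?_
  · filter_upwards [eventually_ge_atTop 0] with l hl
    filter_upwards [ae_restrict_mem measurableSet_Ioc] with t ht
    have h0 := hT.nonneg ht
    rw [Real.norm_eq_abs, abs_mul, Real.abs_exp, abs_of_nonneg h0]
    exact mul_le_of_le_one_left h0 (Real.exp_le_one_iff.2 (by nlinarith [ht.1]))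
  · filter_upwards [ae_restrict_mem measurableSet_Ioc] with t ht
    have hexp : Tendsto (fun l : ℝ => Real.exp (-l * t)) atTop (𝓝 0) :=
      Real.tendsto_exp_atBot.comp (tendsto_neg_atTop_atBot.atBot_mul_const ht.1)
    simpa using hexp.mul_const (β t)

end Volterra

/-! ### Mild solutions of semilinear equations -/

section MildSolutions

variable {X Y Z : Type*} [NormedAddCommGroup X] [NormedSpace ℝ X] [NormedAddCommGroup Y]
  [NormedSpace ℝ Y] [NormedAddCommGroup Z] [NormedSpace ℝ Z] {a l : ℝ}

/-- Multiplication by `e^{lτ}` on `C([0, a])`. Conjugation by it replaces the kernel `T(t)` of a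
Volterra operator by `e^{-lt} T(t)`, which makes the operator small for large `l`. -/
def expMul (X : Type*) [NormedAddCommGroup X] [NormedSpace ℝ X] (a l : ℝ) :
    C(Icc 0 a, X) ≃L[ℝ] C(Icc 0 a, X) :=
  ContinuousLinearEquiv.equivOfInverse
    (pointwiseApply ⟨fun τ => Real.exp (l * τ) • ContinuousLinearMap.id ℝ X, by fun_prop⟩)
    (pointwiseApply ⟨fun τ => Real.exp (-l * τ) • ContinuousLinearMap.id ℝ X, by fun_prop⟩)
    (fun f => by ext τ; simp [smul_smul, ← Real.exp_add])
    (fun f => by ext τ; simp [smul_smul, ← Real.exp_add])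

@[simp]
theorem expMul_apply (f : C(Icc 0 a, X)) (τ : Icc 0 a) :
    expMul X a l f τ = Real.exp (l * τ) • f τ := rfl

@[simp]
theorem expMul_symm_apply (f : C(Icc 0 a, X)) (τ : Icc 0 a) :
    (expMul X a l).symm f τ = Real.exp (-l * τ) • f τ := rfl

theorem lipschitzWith_expMul_symm_comp_expMul (F : C(X, Y)) {L : ℝ≥0} (hF : LipschitzWith L F) :
    LipschitzWith L fun u => (expMul Y a l).symm (F.comp (expMul X a l u)) := by
  refine LipschitzWith.of_dist_le_mul fun u w =>
    (ContinuousMap.dist_le (by positivity)).2 fun τ => ?_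
  simp only [expMul_symm_apply, expMul_apply, ContinuousMap.comp_apply, dist_smul₀,
    Real.norm_eq_abs, Real.abs_exp]
  calc Real.exp (-l * τ) * dist (F (Real.exp (l * τ) • u τ)) (F (Real.exp (l * τ) • w τ))
      ≤ Real.exp (-l * τ) * (L * (Real.exp (l * τ) * dist (u τ) (w τ))) := by
        gcongr
        simpa only [dist_smul₀, Real.norm_eq_abs, Real.abs_exp] using
          hF.dist_le_mul (Real.exp (l * τ) • u τ) (Real.exp (l * τ) • w τ)
    _ = L * dist (u τ) (w τ) := by
        rw [mul_left_comm, ← mul_assoc (Real.exp _), ← Real.exp_add, neg_mul, neg_add_cancel,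
          Real.exp_zero, one_mul]
    _ ≤ L * dist u w := by
        gcongr
        exact ContinuousMap.dist_apply_le_dist τ

variable {T : ℝ → Y →L[ℝ] X} {β : ℝ → ℝ} {L : ℝ≥0}

theorem expMul_symm_volterraOp (hT : IsSingularKernel T a β) (ha : 0 ≤ a) (f : C(Icc 0 a, Y)) :
    (expMul X a l).symm (volterraOp hT ha f) =
      volterraOp (hT.exp_smul l) ha ((expMul Y a l).symm f) := by
  ext τ
  rw [expMul_symm_apply, volterraOp_apply, volterraOp_apply, volterra, volterra,
    ← intervalIntegral.integral_smul]
  refine intervalIntegral.integral_congr fun s hs => ?_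
  rw [uIcc_of_le τ.2.1] at hs
  have hs' : s ∈ Icc 0 a := ⟨hs.1, hs.2.trans τ.2.2⟩
  simp only [IccExtend_of_mem ha _ hs', expMul_symm_apply, FunLike.coe_smul, Pi.smul_apply,
    map_smul, smul_smul, ← Real.exp_add]
  congr 2
  ring

theorem exists_norm_volterraOp_exp_smul_mul_le (hT : IsSingularKernel T a β) (ha : 0 ≤ a)
    (L : ℝ≥0) : ∃ l, ‖volterraOp (hT.exp_smul l) ha‖₊ * L ≤ 1 / 2 := by
  obtain ⟨l, hl⟩ := (hT.tendsto_integral_exp_mul.eventually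
    (gt_mem_nhds (show (0 : ℝ) < 1 / (2 * (L + 1)) by positivity))).exists
  refine ⟨l, NNReal.coe_le_coe.1 ?_⟩
  push_cast
  calc ‖volterraOp (hT.exp_smul l) ha‖ * L
      ≤ 1 / (2 * (L + 1)) * (L + 1) := by
        gcongr
        · exact (norm_volterraOp_le (hT.exp_smul l) ha).trans hl.le
        · linarith
    _ = 1 / 2 := by field_simp

theorem exists_homeomorph_add_volterraOp [CompleteSpace X] (hT : IsSingularKernel T a β)
    (ha : 0 ≤ a) (L : ℝ≥0) :
    ∃ C : ℝ≥0, ∀ F : C(X, Y), LipschitzWith L F → ∃ Φ : C(Icc 0 a, X) ≃ₜ C(Icc 0 a, X),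
      (∀ u, Φ u = u + volterraOp hT ha (F.comp u)) ∧ LipschitzWith C Φ.symm ∧
      (ContDiff ℝ 1 F → ContDiff ℝ 1 Φ.symm) := by
  obtain ⟨l, hl⟩ := exists_norm_volterraOp_exp_smul_mul_le hT ha L
  let e := expMul X a l
  refine ⟨‖(e : C(Icc 0 a, X) →L[ℝ] C(Icc 0 a, X))‖₊ *
    ((1 - 1 / 2)⁻¹ * ‖(e.symm : C(Icc 0 a, X) →L[ℝ] C(Icc 0 a, X))‖₊), fun F hF => ?_⟩
  let P : C(Icc 0 a, X) → C(Icc 0 a, X) := fun u =>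
    volterraOp (hT.exp_smul l) ha ((expMul Y a l).symm (F.comp (e u)))
  have hP : LipschitzWith (1 / 2) P :=
    ((volterraOp (hT.exp_smul l) ha).lipschitz.comp
      (lipschitzWith_expMul_symm_comp_expMul F hF)).weaken hl
  have hhalf : (1 / 2 : ℝ≥0) < 1 := by norm_num
  refine ⟨e.symm.toHomeomorph.trans ((idAddHomeomorph hP hhalf).trans e.toHomeomorph), fun u => ?_,
    e.lipschitz.comp ((lipschitzWith_idAddHomeomorph_symm hP hhalf).comp e.symm.lipschitz),
    fun hFC => ?_⟩
  · change e (e.symm u + volterraOp (hT.exp_smul l) ha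
      ((expMul Y a l).symm (F.comp (e (e.symm u))))) = _
    rw [← expMul_symm_volterraOp, map_add, e.apply_symm_apply, e.apply_symm_apply]
  · have hPC : ContDiff ℝ 1 P := (volterraOp (hT.exp_smul l) ha).contDiff.comp
      ((expMul Y a l).symm.contDiff.comp ((contDiff_postcomp F hFC).comp e.contDiff))
    exact e.contDiff.comp ((contDiff_idAddHomeomorph_symm hP hhalf hPC).comp e.symm.contDiff)

theorem exists_norm_le_of_continuousOn_apply [CompleteSpace X] {S : ℝ → X →L[ℝ] Z} {s : Set ℝ}
    (hs : IsCompact s) (hS : ∀ x, ContinuousOn (fun t => S t x) s) :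
    ∃ M, ∀ t ∈ s, ‖S t‖ ≤ M := by
  obtain ⟨M, hM⟩ := banach_steinhaus (g := fun t : s => S t) fun x => by
    obtain ⟨M, hM⟩ := hs.exists_bound_of_continuousOn (hS x)
    exact ⟨M, fun t => hM t t.2⟩
  exact ⟨M, fun t ht => hM ⟨t, ht⟩⟩

/-- The orbits `x ↦ (τ ↦ S(τ) x)` of a strongly continuous family, as a bounded operator into
`C([0, a])`. -/
def orbitMap [CompleteSpace X] (S : ℝ → X →L[ℝ] Z)
    (hS : ∀ x, ContinuousOn (fun t => S t x) (Icc 0 a)) : X →L[ℝ] C(Icc 0 a, Z) :=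
  LinearMap.mkContinuousOfExistsBound
    { toFun := fun x => ⟨fun τ => S τ x, (hS x).domRestrict⟩
      map_add' := fun x y => by ext τ; exact map_add (S τ) x y
      map_smul' := fun c x => by ext τ; exact map_smul (S τ) c x } <| by
    obtain ⟨M, hM⟩ := exists_norm_le_of_continuousOn_apply isCompact_Icc hS
    refine ⟨max M 0, fun x => (ContinuousMap.norm_le _ (by positivity)).2 fun τ => ?_⟩
    exact ((S τ).le_opNorm x).trans (by gcongr; exact (hM τ τ.2).trans (le_max_left _ _))

/-- `v` is a mild solution on `[0, a]` of `v' = A v - F(v)`, `v(0) = x`, where `S(τ) = e^{τA}`. The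
operators `T(τ)`, `τ > 0`, are an extension of `S(τ)` to the space `Y` in which `F` takes its
values. -/
structure IsMildSolution (S : ℝ → X →L[ℝ] X) (T : ℝ → Y →L[ℝ] X) (F : X → Y) (a : ℝ) (x : X)
    (v : ℝ → X) : Prop where
  continuousOn : ContinuousOn v (Icc 0 a)
  eq : ∀ τ ∈ Icc 0 a, v τ = S τ x - volterra T (fun s => F (v s)) τ

variable {S : ℝ → X →L[ℝ] X}

theorem IsMildSolution.mono {F : X → Y} {b : ℝ} {x : X} {v : ℝ → X}
    (h : IsMildSolution S T F b x v) (hab : a ≤ b) : IsMildSolution S T F a x v :=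
  ⟨h.continuousOn.mono (Icc_subset_Icc_right hab), fun τ hτ => h.eq τ ⟨hτ.1, hτ.2.trans hab⟩⟩

theorem isMildSolution_iff_of_forall_horizon {F : X → Y} {x : X}
    {sol : ∀ a, 0 ≤ a → C(Icc 0 a, X)}
    (hsol : ∀ a ha v, IsMildSolution S T F a x v ↔ ∀ τ : Icc 0 a, v τ = sol a ha τ)
    (ha : 0 ≤ a) (v : ℝ → X) :
    IsMildSolution S T F a x v ↔
      ∀ τ ∈ Icc 0 a, v τ = sol |τ| (abs_nonneg τ) ⟨|τ|, abs_nonneg τ, le_rfl⟩ := by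
  have hcons : ∀ τ : Icc 0 a,
      sol a ha τ = sol |(τ : ℝ)| (abs_nonneg _) ⟨|(τ : ℝ)|, abs_nonneg _, le_rfl⟩ := fun τ => by
    have hmild : IsMildSolution S T F a x (IccExtend ha (sol a ha)) :=
      (hsol a ha _).2 fun σ => IccExtend_val ha _ σ
    have hle : |(τ : ℝ)| ≤ a := (abs_of_nonneg τ.2.1).trans_le τ.2.2
    refine .trans ?_ ((hsol _ (abs_nonneg _) _).1 (hmild.mono hle) _)
    simp only [abs_of_nonneg τ.2.1, IccExtend_val]
  rw [hsol a ha, Subtype.forall]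
  exact forall₂_congr fun τ hτ => by rw [hcons ⟨τ, hτ⟩]

theorem hasFDerivAt_postcomp_comp_zero {K : Type*} [TopologicalSpace K] [CompactSpace K]
    (F : C(X, Y)) (hF : ContDiff ℝ 1 F) (hF0 : fderiv ℝ F 0 = 0) {sol : Z → C(K, X)}
    (hsol : DifferentiableAt ℝ sol 0) (hsol0 : sol 0 = 0) (A : C(K, Y) →L[ℝ] X) :
    HasFDerivAt (fun x => A (F.comp (sol x))) (0 : Z →L[ℝ] X) 0 := by
  have hcomp := hasFDerivAt_postcomp_zero (K := K) F hF hF0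
  rw [← hsol0] at hcomp
  exact (A.hasFDerivAt.comp 0 (hcomp.comp 0 hsol.hasFDerivAt)).congr_fderiv (by simp)

variable [CompleteSpace X]

theorem isMildSolution_iff_add_volterraOp_eq (hS : ∀ x, ContinuousOn (fun t => S t x) (Icc 0 a))
    (hT : IsSingularKernel T a β) (ha : 0 ≤ a) (F : C(X, Y)) (x : X) {u : C(Icc 0 a, X)}
    {v : ℝ → X} (hv : ∀ τ : Icc 0 a, v τ = u τ) :
    IsMildSolution S T F a x v ↔ u + volterraOp hT ha (F.comp u) = orbitMap S hS x := by
  have hvolterra : ∀ τ : Icc 0 a, volterra T (fun s => F (v s)) τ =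
      volterraOp hT ha (F.comp u) τ := fun τ => volterra_congr τ.2.1 fun s hs => by
    have hs' : s ∈ Icc 0 a := ⟨hs.1, hs.2.trans τ.2.2⟩
    rw [IccExtend_of_mem ha _ hs', ContinuousMap.comp_apply, ← hv]
  have hcont : ContinuousOn v (Icc 0 a) := by
    rw [continuousOn_iff_continuous_domRestrict, show (Icc 0 a).domRestrict v = u from funext hv]
    exact u.continuous
  rw [← eq_sub_iff_add_eq]
  constructor
  · intro h
    ext τ
    rw [← hv, h.eq τ τ.2, hvolterra]
    rfl
  · refine fun h => ⟨hcont, fun τ hτ => ?_⟩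
    rw [hvolterra ⟨τ, hτ⟩, hv ⟨τ, hτ⟩]
    exact DFunLike.congr_fun h _

theorem exists_solutionMap (hS : ∀ x, ContinuousOn (fun t => S t x) (Icc 0 a))
    (hT : IsSingularKernel T a β) (ha : 0 ≤ a) (L : ℝ≥0) :
    ∃ C : ℝ≥0, ∀ F : C(X, Y), LipschitzWith L F → ∃ sol : X → C(Icc 0 a, X),
      (∀ x v, IsMildSolution S T F a x v ↔ ∀ τ : Icc 0 a, v τ = sol x τ) ∧
      (∀ x, sol x + volterraOp hT ha (F.comp (sol x)) = orbitMap S hS x) ∧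
      LipschitzWith C sol ∧ (ContDiff ℝ 1 F → ContDiff ℝ 1 sol) := by
  obtain ⟨C, hC⟩ := exists_homeomorph_add_volterraOp hT ha L
  refine ⟨C * ‖orbitMap S hS‖₊, fun F hF => ?_⟩
  obtain ⟨Φ, hΦ, hΦlip, hΦdiff⟩ := hC F hF
  refine ⟨fun x => Φ.symm (orbitMap S hS x), fun x v => ⟨fun hv τ => ?_, fun hv => ?_⟩,
    fun x => ?_, hΦlip.comp (orbitMap S hS).lipschitz,
    fun hFC => (hΦdiff hFC).comp (orbitMap S hS).contDiff⟩
  · let u : C(Icc 0 a, X) := ⟨fun τ => v τ, hv.continuousOn.domRestrict⟩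
    have hu := (isMildSolution_iff_add_volterraOp_eq hS hT ha F x (u := u) fun _ => rfl).1 hv
    change u τ = Φ.symm (orbitMap S hS x) τ
    rw [← hu, ← hΦ, Φ.symm_apply_apply]
  · rw [isMildSolution_iff_add_volterraOp_eq hS hT ha F x hv, ← hΦ, Φ.apply_symm_apply]
  · rw [← hΦ, Φ.apply_symm_apply]

theorem exists_semiflow {β : ℝ → ℝ → ℝ} (hS : ∀ x, ContinuousOn (fun t => S t x) (Ici 0))
    (hT : ∀ a, 0 ≤ a → IsSingularKernel T a (β a)) {t : ℝ} (ht : 0 ≤ t) (L₀ : ℝ≥0) :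
    ∃ C : ℝ≥0, ∀ (F : C(X, Y)) (L : ℝ≥0), L ≤ L₀ → LipschitzWith L F → ContDiff ℝ 1 F →
      F 0 = 0 → fderiv ℝ F 0 = 0 → ∃ φ : ℝ → X → X,
        (∀ a, 0 ≤ a → ∀ x v, IsMildSolution S T F a x v ↔ ∀ τ ∈ Icc 0 a, v τ = φ τ x) ∧
        ContDiff ℝ 1 (fun x => φ t x - S t x) ∧ φ t 0 - S t 0 = 0 ∧
        fderiv ℝ (fun x => φ t x - S t x) 0 = 0 ∧
        LipschitzWith (C * L) fun x => φ t x - S t x := by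
  have hSI : ∀ a x, ContinuousOn (fun t => S t x) (Icc 0 a) := fun a x =>
    (hS x).mono Icc_subset_Ici_self
  choose C hC using fun a ha => exists_solutionMap (hSI a) (hT a ha) ha L₀
  let ev : C(Icc 0 t, X) →L[ℝ] X := ContinuousMap.evalCLM ℝ ⟨t, ht, le_rfl⟩
  let A : C(Icc 0 t, Y) →L[ℝ] X := ev.comp (volterraOp (hT t ht) ht)
  refine ⟨‖A‖₊ * C t ht, fun F L hL hF hFC hF0 hF0' => ?_⟩
  choose sol hsol heq hlip hdiff using fun a ha => hC a ha F (hF.weaken hL)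
  let φ : ℝ → X → X := fun τ x => sol |τ| (abs_nonneg τ) x ⟨|τ|, abs_nonneg τ, le_rfl⟩
  have hφ : ∀ a, 0 ≤ a → ∀ x v, IsMildSolution S T F a x v ↔ ∀ τ ∈ Icc 0 a, v τ = φ τ x :=
    fun a ha x v => isMildSolution_iff_of_forall_horizon (sol := fun a ha => sol a ha x)
      (fun a ha v => hsol a ha x v) ha v
  have hrem : (fun x => φ t x - S t x) = fun x => -A (F.comp (sol t ht x)) := funext fun x => by
    have hφt : φ t x = sol t ht x ⟨t, ht, le_rfl⟩ :=
      (show ∀ τ (hτ : 0 ≤ τ), τ = t → sol τ hτ x ⟨τ, hτ, le_rfl⟩ = sol t ht x ⟨t, ht, le_rfl⟩ by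
        rintro τ hτ rfl; rfl) _ _ (abs_of_nonneg ht)
    rw [hφt, sub_eq_iff_eq_add, neg_add_eq_sub, eq_sub_iff_add_eq]
    exact DFunLike.congr_fun (heq t ht x) ⟨t, ht, le_rfl⟩
  have hFcomp0 : F.comp (0 : C(Icc 0 t, X)) = 0 := ContinuousMap.ext fun _ => hF0
  have hsol0 : sol t ht 0 = 0 := by
    have hmild : IsMildSolution S T F t 0 (0 : ℝ → X) :=
      (isMildSolution_iff_add_volterraOp_eq (hSI t) (hT t ht) ht F 0 (u := 0) fun _ => rfl).2
        (by rw [hFcomp0, map_zero, map_zero, add_zero])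
    exact (ContinuousMap.ext ((hsol t ht 0 _).1 hmild)).symm
  refine ⟨φ, hφ, ?_, ?_, ?_, ?_⟩
  · rw [hrem]
    exact (A.contDiff.comp ((contDiff_postcomp F hFC).comp (hdiff t ht hFC))).neg
  · rw [congrFun hrem 0, hsol0, hFcomp0, map_zero, neg_zero]
  · rw [hrem]
    have hderiv := hasFDerivAt_postcomp_comp_zero F hFC hF0'
      ((hdiff t ht hFC).differentiable (by simp) 0) hsol0 A
    exact hderiv.neg.fderiv.trans neg_zero
  · rw [hrem, mul_right_comm, mul_assoc]
    exact (A.lipschitz.comp ((lipschitzWith_postcomp F hF).comp (hlip t ht))).neg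

end MildSolutions

/-! ### Powers of the norm -/

section HolderEstimates

variable {V W : Type*} [NormedAddCommGroup V] [NormedAddCommGroup W]

theorem rpow_sub_one_mul_self {r s : ℝ} (hr : 0 ≤ r) (hs : s ≠ 0) : r ^ (s - 1) * r = r ^ s := by
  rw [← Real.rpow_add_one' hr (by rwa [sub_add_cancel]), sub_add_cancel]

theorem continuous_of_norm_sub_le_rpow {f : V → W} {c s : ℝ} (hs : 0 < s)
    (hf : ∀ x y, ‖f x - f y‖ ≤ c * ‖x - y‖ ^ s) : Continuous f := by
  refine continuous_iff_continuousAt.2 fun y => tendsto_iff_norm_sub_tendsto_zero.2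
    (squeeze_zero (fun _ => norm_nonneg _) (fun x => hf x y) ?_)
  have hcont : Continuous fun x : V => c * ‖x - y‖ ^ s :=
    continuous_const.mul ((Real.continuous_rpow_const hs.le).comp (by fun_prop))
  simpa only [sub_self, norm_zero, Real.zero_rpow hs.ne', mul_zero] using hcont.tendsto y

theorem hasFDerivAt_of_norm_sub_sub_le_rpow [NormedSpace ℝ V] [NormedSpace ℝ W] {f : V → W}
    {f' : V →L[ℝ] W} {x : V} {c q : ℝ} (hq : 1 < q)
    (hf : ∀ h, ‖f (x + h) - f x - f' h‖ ≤ c * ‖h‖ ^ q) : HasFDerivAt f f' x := by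
  have hsmall : Tendsto (fun h : V => ‖h‖ ^ (q - 1)) (𝓝 0) (𝓝 0) := by
    have hcont : Continuous fun h : V => ‖h‖ ^ (q - 1) :=
      (Real.continuous_rpow_const (by linarith)).comp continuous_norm
    simpa only [norm_zero, Real.zero_rpow (sub_pos.2 hq).ne'] using hcont.tendsto 0
  rw [hasFDerivAt_iff_isLittleO_nhds_zero]
  calc (fun h => f (x + h) - f x - f' h)
      =O[𝓝 0] fun h : V => ‖h‖ ^ (q - 1) * ‖h‖ := Asymptotics.isBigO_of_le' (c := c) _ fun h => by
        rw [rpow_sub_one_mul_self (norm_nonneg h) (by linarith),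
          Real.norm_of_nonneg (r := ‖h‖ ^ q) (by positivity)]
        exact hf h
    _ =o[𝓝 0] fun h : V => 1 * ‖h‖ := ((Asymptotics.isLittleO_one_iff ℝ).2 hsmall).mul_isBigO
        (Asymptotics.isBigO_refl _ _)
    _ =O[𝓝 0] fun h : V => h := by
        simpa only [one_mul] using (Asymptotics.isBigO_refl (fun h : V => h) _).norm_left

end HolderEstimates

section NormPow

variable {V : Type*} [NormedAddCommGroup V]

theorem norm_rpow_smul_self [NormedSpace ℝ V] {s : ℝ} (hs : s ≠ 0) (x : V) :
    ‖‖x‖ ^ (s - 1) • x‖ = ‖x‖ ^ s := by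
  rw [norm_smul, Real.norm_of_nonneg (by positivity), rpow_sub_one_mul_self (norm_nonneg x) hs]

theorem norm_rpow_smul_sub_le_of_norm_le [NormedSpace ℝ V] {s : ℝ} (hs : 0 < s) (hs1 : s ≤ 1)
    {x y : V} (hyx : ‖y‖ ≤ ‖x‖) :
    ‖‖x‖ ^ (s - 1) • x - ‖y‖ ^ (s - 1) • y‖ ≤ 2 * (‖x‖ ^ (s - 1) * ‖x - y‖) := by
  rcases eq_or_ne y 0 with rfl | hy
  · rw [smul_zero, sub_zero, sub_zero, norm_smul, Real.norm_of_nonneg (by positivity)]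
    exact le_mul_of_one_le_left (by positivity) one_le_two
  have hmono : ‖x‖ ^ (s - 1) ≤ ‖y‖ ^ (s - 1) :=
    Real.rpow_le_rpow_of_nonpos (norm_pos_iff.2 hy) hyx (by linarith)
  have hdiff : (‖y‖ ^ (s - 1) - ‖x‖ ^ (s - 1)) * ‖y‖ ≤ ‖x‖ ^ (s - 1) * ‖x - y‖ := by
    calc (‖y‖ ^ (s - 1) - ‖x‖ ^ (s - 1)) * ‖y‖ = ‖y‖ ^ s - ‖x‖ ^ (s - 1) * ‖y‖ := by
          rw [sub_mul, rpow_sub_one_mul_self (norm_nonneg y) hs.ne']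
      _ ≤ ‖x‖ ^ s - ‖x‖ ^ (s - 1) * ‖y‖ := by gcongr
      _ = ‖x‖ ^ (s - 1) * (‖x‖ - ‖y‖) := by
          rw [mul_sub, rpow_sub_one_mul_self (norm_nonneg x) hs.ne']
      _ ≤ ‖x‖ ^ (s - 1) * ‖x - y‖ := by gcongr; exact norm_sub_norm_le x y
  calc ‖‖x‖ ^ (s - 1) • x - ‖y‖ ^ (s - 1) • y‖
      = ‖‖x‖ ^ (s - 1) • (x - y) - (‖y‖ ^ (s - 1) - ‖x‖ ^ (s - 1)) • y‖ := by
        rw [smul_sub, sub_smul]; abel_nf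
    _ ≤ ‖x‖ ^ (s - 1) * ‖x - y‖ + (‖y‖ ^ (s - 1) - ‖x‖ ^ (s - 1)) * ‖y‖ := by
        refine (norm_sub_le _ _).trans_eq ?_
        rw [norm_smul, norm_smul, Real.norm_of_nonneg (by positivity),
          Real.norm_of_nonneg (sub_nonneg.2 hmono)]
    _ ≤ 2 * (‖x‖ ^ (s - 1) * ‖x - y‖) := by linarith

theorem norm_rpow_smul_sub_le [NormedSpace ℝ V] {s : ℝ} (hs : 0 < s) (hs1 : s ≤ 1) (x y : V) :
    ‖‖x‖ ^ (s - 1) • x - ‖y‖ ^ (s - 1) • y‖ ≤ 2 * ‖x - y‖ ^ s := by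
  wlog hyx : ‖y‖ ≤ ‖x‖ generalizing x y
  · rw [norm_sub_rev, norm_sub_rev x y]
    exact this y x (le_of_not_ge hyx)
  rcases le_or_gt ‖x‖ ‖x - y‖ with hfar | hnear
  · calc ‖‖x‖ ^ (s - 1) • x - ‖y‖ ^ (s - 1) • y‖ ≤ ‖x‖ ^ s + ‖y‖ ^ s := by
          refine (norm_sub_le _ _).trans_eq ?_
          rw [norm_rpow_smul_self hs.ne', norm_rpow_smul_self hs.ne']
      _ ≤ ‖x - y‖ ^ s + ‖x - y‖ ^ s := by gcongr; exact hyx.trans hfar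
      _ = 2 * ‖x - y‖ ^ s := (two_mul _).symm
  · refine (norm_rpow_smul_sub_le_of_norm_le hs hs1 hyx).trans ?_
    rcases (norm_nonneg (x - y)).eq_or_lt with hxy | hxy
    · rw [← hxy, mul_zero, Real.zero_rpow hs.ne']
    · rw [← rpow_sub_one_mul_self hxy.le hs.ne']
      have := Real.rpow_le_rpow_of_nonpos hxy hnear.le (sub_nonpos.2 hs1)
      gcongr

variable [InnerProductSpace ℝ V]

/-- The gradient of `x ↦ ‖x‖ ^ q`, for `1 < q`. -/
def gradNormPow (q : ℝ) (x : V) : V := (q * ‖x‖ ^ (q - 2)) • x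

theorem gradNormPow_eq (q : ℝ) (x : V) : gradNormPow q x = q • ‖x‖ ^ (q - 1 - 1) • x := by
  rw [gradNormPow, mul_smul]
  norm_num [sub_sub]

theorem norm_gradNormPow {q : ℝ} (hq : 1 < q) (x : V) :
    ‖gradNormPow q x‖ = q * ‖x‖ ^ (q - 1) := by
  rw [gradNormPow_eq, norm_smul, norm_rpow_smul_self (sub_pos.2 hq).ne',
    Real.norm_of_nonneg (by linarith)]

theorem norm_gradNormPow_sub_le {q : ℝ} (hq : 1 < q) (hq2 : q ≤ 2) (x y : V) :
    ‖gradNormPow q x - gradNormPow q y‖ ≤ 2 * q * ‖x - y‖ ^ (q - 1) := by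
  rw [gradNormPow_eq, gradNormPow_eq, ← smul_sub, norm_smul, Real.norm_of_nonneg (by linarith),
    mul_comm 2 q, mul_assoc]
  gcongr
  exact norm_rpow_smul_sub_le (by linarith) (by linarith) x y

theorem hasFDerivAt_normPow {q : ℝ} (hq : 1 < q) (x : V) :
    HasFDerivAt (fun x : V => ‖x‖ ^ q) (innerSL ℝ (gradNormPow q x)) x := by
  rw [gradNormPow, map_smul]
  exact hasFDerivAt_norm_rpow x hq

theorem norm_normPow_taylor_le {q : ℝ} (hq : 1 < q) (hq2 : q ≤ 2) (x h : V) :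
    ‖‖x + h‖ ^ q - ‖x‖ ^ q - inner ℝ (gradNormPow q x) h‖ ≤ 2 * q * ‖h‖ ^ q := by
  have hderiv : ∀ y ∈ Metric.closedBall x ‖h‖,
      ‖innerSL ℝ (gradNormPow q y) - innerSL ℝ (gradNormPow q x)‖ ≤ 2 * q * ‖h‖ ^ (q - 1) := by
    intro y hy
    rw [← map_sub, innerSL_apply_norm]
    refine (norm_gradNormPow_sub_le hq hq2 y x).trans ?_
    gcongr
    exact mem_closedBall_iff_norm.1 hy
  have hmvt := (convex_closedBall x ‖h‖).norm_image_sub_le_of_norm_hasFDerivWithin_le'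
    (f := fun x : V => ‖x‖ ^ q) (fun y _ => (hasFDerivAt_normPow hq y).hasFDerivWithinAt) hderiv
    (Metric.mem_closedBall_self (norm_nonneg h)) (y := x + h)
    (by rw [mem_closedBall_iff_norm, add_sub_cancel_left])
  rwa [add_sub_cancel_left, innerSL_apply_apply, mul_assoc,
    rpow_sub_one_mul_self (norm_nonneg h) (by linarith)] at hmvt

end NormPow

section Nemytskii

variable {α V W : Type*} [MeasurableSpace α] {μ : Measure α} [NormedAddCommGroup V]
  [NormedAddCommGroup W]

theorem eLpNorm_norm_rpow_two {s : ℝ} (hs : 0 < s) (f : α → V) :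
    eLpNorm (fun x => ‖f x‖ ^ s) (ENNReal.ofReal (2 / s)) μ = eLpNorm f 2 μ ^ s := by
  rw [eLpNorm_norm_rpow f hs, ← ENNReal.ofReal_mul (by positivity), div_mul_cancel₀ _ hs.ne',
    ENNReal.ofReal_ofNat]

theorem memLp_of_norm_le_rpow {s c : ℝ} (hs : 0 < s) {f : α → W} {g : α → V}
    (hf : AEStronglyMeasurable f μ) (hg : MemLp g 2 μ) (hfg : ∀ x, ‖f x‖ ≤ c * ‖g x‖ ^ s) :
    MemLp f (ENNReal.ofReal (2 / s)) μ := by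
  refine ⟨hf, lt_of_le_of_lt (eLpNorm_le_mul_eLpNorm_of_ae_le_mul (c := c)
    (g := fun x => ‖g x‖ ^ s) (.of_forall fun x => ?_) _) ?_⟩
  · rw [Real.norm_of_nonneg (by positivity)]
    exact hfg x
  · rw [eLpNorm_norm_rpow_two hs]
    exact ENNReal.mul_lt_top ENNReal.ofReal_lt_top (ENNReal.rpow_lt_top_of_nonneg hs.le hg.2.ne)

theorem norm_le_mul_rpow {s c : ℝ} (hs : 0 < s) (hc : 0 ≤ c)
    {f : Lp W (ENNReal.ofReal (2 / s)) μ} {g : Lp V 2 μ}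
    (hfg : ∀ᵐ x ∂μ, ‖f x‖ ≤ c * ‖g x‖ ^ s) : ‖f‖ ≤ c * ‖g‖ ^ s := by
  have hle := eLpNorm_le_mul_eLpNorm_of_ae_le_mul (c := c) (f := f) (g := fun x => ‖g x‖ ^ s)
    (hfg.mono fun x hx => by rwa [Real.norm_of_nonneg (by positivity)])
    (ENNReal.ofReal (2 / s))
  rw [eLpNorm_norm_rpow_two hs] at hle
  rw [Lp.norm_def, Lp.norm_def, ENNReal.toReal_rpow]
  refine (ENNReal.toReal_mono ?_ hle).trans_eq ?_
  · exact (ENNReal.mul_lt_top ENNReal.ofReal_lt_top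
      (ENNReal.rpow_lt_top_of_nonneg hs.le (Lp.eLpNorm_ne_top g))).ne
  · rw [ENNReal.toReal_mul, ENNReal.toReal_ofReal hc]

theorem memLp_normPow {q : ℝ} (hq : 0 < q) {g : α → V} (hg : MemLp g 2 μ) :
    MemLp (fun x => ‖g x‖ ^ q) (ENNReal.ofReal (2 / q)) μ :=
  memLp_of_norm_le_rpow hq
    ((Real.continuous_rpow_const hq.le).comp_aestronglyMeasurable hg.1.norm) hg (c := 1)
    (fun x => by rw [one_mul, Real.norm_of_nonneg (by positivity)])

/-- The superposition operator `g ↦ |g|^q` from `L²` to `L^{2/q}`. -/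
def normPowLp {q : ℝ} (hq : 0 < q) (g : Lp V 2 μ) : Lp ℝ (ENNReal.ofReal (2 / q)) μ :=
  (memLp_normPow hq (Lp.memLp g)).toLp

theorem coeFn_normPowLp {q : ℝ} (hq : 0 < q) (g : Lp V 2 μ) :
    normPowLp hq g =ᵐ[μ] fun x => ‖g x‖ ^ q := MemLp.coeFn_toLp _

theorem norm_normPowLp_le {q : ℝ} (hq : 0 < q) (g : Lp V 2 μ) : ‖normPowLp hq g‖ ≤ ‖g‖ ^ q := by
  rw [← one_mul (‖g‖ ^ q)]
  refine norm_le_mul_rpow hq zero_le_one ((coeFn_normPowLp hq g).mono fun x hx => ?_)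
  rw [hx, one_mul, Real.norm_of_nonneg (by positivity)]

variable [InnerProductSpace ℝ V] {q : ℝ}

theorem memLp_gradNormPow (hq : 1 < q) (hq2 : q ≤ 2) {g : α → V} (hg : MemLp g 2 μ) :
    MemLp (fun x => gradNormPow q (g x)) (ENNReal.ofReal (2 / (q - 1))) μ :=
  memLp_of_norm_le_rpow (sub_pos.2 hq)
    ((continuous_of_norm_sub_le_rpow (sub_pos.2 hq)
      (norm_gradNormPow_sub_le hq hq2)).comp_aestronglyMeasurable hg.1) hg
    fun x => (norm_gradNormPow hq (g x)).le

/-- The gradient of `normPowLp`, as a map from `L²` to `L^{2/(q-1)}`. -/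
def gradNormPowLp (hq : 1 < q) (hq2 : q ≤ 2) (g : Lp V 2 μ) :
    Lp V (ENNReal.ofReal (2 / (q - 1))) μ :=
  (memLp_gradNormPow hq hq2 (Lp.memLp g)).toLp

theorem coeFn_gradNormPowLp (hq : 1 < q) (hq2 : q ≤ 2) (g : Lp V 2 μ) :
    gradNormPowLp hq hq2 g =ᵐ[μ] fun x => gradNormPow q (g x) := MemLp.coeFn_toLp _

theorem norm_gradNormPowLp_le (hq : 1 < q) (hq2 : q ≤ 2) (g : Lp V 2 μ) :
    ‖gradNormPowLp hq hq2 g‖ ≤ q * ‖g‖ ^ (q - 1) :=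
  norm_le_mul_rpow (sub_pos.2 hq) (by linarith) <| (coeFn_gradNormPowLp hq hq2 g).mono fun x hx =>
    by rw [hx, norm_gradNormPow hq]

theorem continuous_gradNormPowLp [Fact (1 ≤ ENNReal.ofReal (2 / (q - 1)))] (hq : 1 < q)
    (hq2 : q ≤ 2) :
    Continuous (gradNormPowLp hq hq2 : Lp V 2 μ → Lp V (ENNReal.ofReal (2 / (q - 1))) μ) := by
  refine continuous_of_norm_sub_le_rpow (c := 2 * q) (sub_pos.2 hq) fun g g' =>
    norm_le_mul_rpow (sub_pos.2 hq) (by linarith) ?_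
  filter_upwards [Lp.coeFn_sub (gradNormPowLp hq hq2 g) (gradNormPowLp hq hq2 g'),
    Lp.coeFn_sub g g', coeFn_gradNormPowLp hq hq2 g, coeFn_gradNormPowLp hq hq2 g']
    with x hx_sub hx_sub' hxg hxg'
  rw [hx_sub, hx_sub', Pi.sub_apply, Pi.sub_apply, hxg, hxg']
  exact norm_gradNormPow_sub_le hq hq2 _ _

theorem fact_one_le_ofReal_two_div {s : ℝ} (hs : 0 < s) (hs2 : s ≤ 2) :
    Fact (1 ≤ ENNReal.ofReal (2 / s)) :=
  ⟨by rwa [ENNReal.one_le_ofReal, le_div_iff₀ hs, one_mul]⟩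

theorem holderTriple_two_div (hq : 1 < q) :
    ENNReal.HolderTriple (ENNReal.ofReal (2 / (q - 1))) 2 (ENNReal.ofReal (2 / q)) := ⟨by
  have := sub_pos.2 hq
  rw [← ENNReal.ofReal_inv_of_pos (by positivity), ← ENNReal.ofReal_inv_of_pos (by positivity),
    ← ENNReal.ofReal_ofNat 2, ← ENNReal.ofReal_inv_of_pos (by positivity),
    ← ENNReal.ofReal_add (by positivity) (by positivity)]
  congr 1
  field_simp
  ring⟩

theorem hasFDerivAt_normPowLp [Fact (1 ≤ ENNReal.ofReal (2 / q))]
    [Fact (1 ≤ ENNReal.ofReal (2 / (q - 1)))]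
    [ENNReal.HolderTriple (ENNReal.ofReal (2 / (q - 1))) 2 (ENNReal.ofReal (2 / q))]
    (hq : 1 < q) (hq2 : q ≤ 2) (g : Lp V 2 μ) :
    HasFDerivAt (normPowLp (one_pos.trans hq))
      ((innerSL ℝ : V →L[ℝ] V →L[ℝ] ℝ).holderL μ (ENNReal.ofReal (2 / (q - 1))) 2
        (ENNReal.ofReal (2 / q)) (gradNormPowLp hq hq2 g)) g := by
  have hq0 : 0 < q := one_pos.trans hq
  refine hasFDerivAt_of_norm_sub_sub_le_rpow hq fun h =>
    norm_le_mul_rpow (c := 2 * q) hq0 (by positivity) ?_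
  set D := (innerSL ℝ : V →L[ℝ] V →L[ℝ] ℝ).holderL μ (ENNReal.ofReal (2 / (q - 1))) 2
    (ENNReal.ofReal (2 / q)) (gradNormPowLp hq hq2 g) h
  have hD : D =ᵐ[μ] fun x => innerSL ℝ (gradNormPowLp hq hq2 g x) (h x) :=
    (innerSL ℝ : V →L[ℝ] V →L[ℝ] ℝ).coeFn_holder (gradNormPowLp hq hq2 g) h
  filter_upwards [Lp.coeFn_sub (normPowLp hq0 (g + h) - normPowLp hq0 g) D,
    Lp.coeFn_sub (normPowLp hq0 (g + h)) (normPowLp hq0 g), coeFn_normPowLp hq0 (g + h),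
    coeFn_normPowLp hq0 g, Lp.coeFn_add g h, coeFn_gradNormPowLp hq hq2 g, hD]
    with x hx_rem hx_diff hx_gh hx_g hx_add hx_grad hx_D
  rw [hx_rem, Pi.sub_apply, hx_diff, Pi.sub_apply, hx_gh, hx_g, hx_add, Pi.add_apply, hx_D,
    hx_grad, innerSL_apply_apply]
  exact norm_normPow_taylor_le hq hq2 _ _

theorem contDiff_normPowLp [Fact (1 ≤ ENNReal.ofReal (2 / q))] (hq : 1 < q) (hq2 : q ≤ 2) :
    ContDiff ℝ 1 (normPowLp (one_pos.trans hq) : Lp V 2 μ → Lp ℝ (ENNReal.ofReal (2 / q)) μ) := by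
  have := fact_one_le_ofReal_two_div (s := q - 1) (by linarith) (by linarith)
  have := holderTriple_two_div hq
  exact contDiff_one_iff_hasFDerivAt.2 ⟨_, (ContinuousLinearMap.continuous _).comp
    (continuous_gradNormPowLp hq hq2), hasFDerivAt_normPowLp hq hq2⟩

theorem norm_fderiv_normPowLp_le [Fact (1 ≤ ENNReal.ofReal (2 / q))] (hq : 1 < q) (hq2 : q ≤ 2)
    (g : Lp V 2 μ) :
    ‖fderiv ℝ (normPowLp (one_pos.trans hq) : Lp V 2 μ → Lp ℝ (ENNReal.ofReal (2 / q)) μ) g‖ ≤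
      q * ‖g‖ ^ (q - 1) := by
  have := fact_one_le_ofReal_two_div (s := q - 1) (by linarith) (by linarith)
  have := holderTriple_two_div hq
  rw [(hasFDerivAt_normPowLp hq hq2 g).fderiv]
  refine ContinuousLinearMap.opNorm_le_bound _ (by positivity) fun h => ?_
  calc _ ≤ ‖(innerSL ℝ : V →L[ℝ] V →L[ℝ] ℝ)‖ * ‖gradNormPowLp hq hq2 g‖ * ‖h‖ :=
        (innerSL ℝ : V →L[ℝ] V →L[ℝ] ℝ).norm_holder_apply_apply_le (gradNormPowLp hq hq2 g) h
    _ ≤ 1 * (q * ‖g‖ ^ (q - 1)) * ‖h‖ := by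
        gcongr
        · exact norm_innerSL_le ℝ
        · exact norm_gradNormPowLp_le hq hq2 g
    _ = q * ‖g‖ ^ (q - 1) * ‖h‖ := by rw [one_mul]

end Nemytskii

/-! ### Truncation -/

section Truncation

/-- The cutoff `χ`, prescribed on `[0, ∞)` only, extended to the line by the value `χ 0 = 1`. -/
def extendCutoff (χ : ℝ → ℝ) (r : ℝ) : ℝ := χ (max r 0)

theorem extendCutoff_of_nonneg (χ : ℝ → ℝ) {r : ℝ} (hr : 0 ≤ r) : extendCutoff χ r = χ r := by
  rw [extendCutoff, max_eq_left hr]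

variable {χ : ℝ → ℝ}

theorem IsCutoff.extendCutoff_of_four_le (hχ : IsCutoff χ) {r : ℝ} (hr : 4 ≤ r) :
    extendCutoff χ r = 0 := hχ.eq_zero _ (hr.trans (le_max_left _ _))

theorem IsCutoff.abs_extendCutoff_le_one (hχ : IsCutoff χ) (r : ℝ) : |extendCutoff χ r| ≤ 1 := by
  rw [extendCutoff, abs_of_nonneg (hχ.nonneg _ (le_max_right _ _))]
  exact hχ.le_one _ (le_max_right _ _)

theorem IsCutoff.contDiff_extendCutoff (hχ : IsCutoff χ) : ContDiff ℝ 1 (extendCutoff χ) := by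
  refine contDiff_iff_contDiffAt.2 fun r => ?_
  rcases lt_or_ge r 1 with hr | hr
  · refine (contDiffAt_const (c := (1 : ℝ))).congr_of_eventuallyEq ?_
    filter_upwards [gt_mem_nhds hr] with x hx
    exact hχ.eq_one _ (le_max_right _ _) (max_le hx.le zero_le_one)
  · have hr0 : 0 < r := one_pos.trans_le hr
    have hχr : ContDiffAt ℝ 1 χ r :=
      ((hχ.smooth r hr0.le).contDiffAt (Ici_mem_nhds hr0)).of_le (by exact_mod_cast le_top)
    refine hχr.congr_of_eventuallyEq ?_
    filter_upwards [lt_mem_nhds hr0] with x hx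
    exact extendCutoff_of_nonneg χ hx.le

theorem IsCutoff.deriv_extendCutoff_of_four_le (hχ : IsCutoff χ) {r : ℝ} (hr : 4 ≤ r) :
    deriv (extendCutoff χ) r = 0 := by
  have hclosed : IsClosed {r : ℝ | deriv (extendCutoff χ) r = 0} :=
    isClosed_eq (hχ.contDiff_extendCutoff.continuous_deriv le_rfl) continuous_const
  have hsub : Ioi (4 : ℝ) ⊆ {r : ℝ | deriv (extendCutoff χ) r = 0} := fun r hr => by
    have hzero : extendCutoff χ =ᶠ[𝓝 r] fun _ => 0 := by
      filter_upwards [lt_mem_nhds (show (4 : ℝ) < r from hr)] with x hx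
      exact hχ.extendCutoff_of_four_le hx.le
    exact hzero.deriv_eq.trans (deriv_const _ _)
  exact closure_minimal hsub hclosed (closure_Ioi (4 : ℝ) ▸ hr)

theorem IsCutoff.exists_abs_deriv_extendCutoff_le (hχ : IsCutoff χ) :
    ∃ B : ℝ, 0 ≤ B ∧ ∀ r, 0 ≤ r → |deriv (extendCutoff χ) r| ≤ B := by
  obtain ⟨B, hB⟩ := (isCompact_Icc (a := (0 : ℝ)) (b := 4)).exists_bound_of_continuousOn
    (hχ.contDiff_extendCutoff.continuous_deriv le_rfl).continuousOn
  refine ⟨max B 0, le_max_right _ _, fun r hr => ?_⟩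
  rcases le_total r 4 with hr4 | hr4
  · exact (hB r ⟨hr, hr4⟩).trans (le_max_left _ _)
  · rw [hχ.deriv_extendCutoff_of_four_le hr4, abs_zero]
    exact le_max_right _ _

variable {X Y : Type*} [NormedAddCommGroup X] [NormedAddCommGroup Y] [NormedSpace ℝ Y] {G : X → Y}

/-- The map `G` cut off smoothly outside the ball of radius `2ϱ`. -/
def truncate (χ : ℝ → ℝ) (ϱ : ℝ) (G : X → Y) (v : X) : Y := χ (‖v‖ ^ 2 / ϱ ^ 2) • G v

theorem truncate_eq (χ : ℝ → ℝ) (ϱ : ℝ) (G : X → Y) :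
    truncate χ ϱ G = fun v => extendCutoff χ (‖v‖ ^ 2 / ϱ ^ 2) • G v :=
  funext fun v => by rw [truncate, extendCutoff_of_nonneg χ (by positivity)]

variable [InnerProductSpace ℝ X]

theorem IsCutoff.contDiff_truncate (hχ : IsCutoff χ) (ϱ : ℝ) (hG : ContDiff ℝ 1 G) :
    ContDiff ℝ 1 (truncate χ ϱ G) := by
  rw [truncate_eq]
  exact (hχ.contDiff_extendCutoff.comp ((contDiff_norm_sq ℝ).div_const _)).smul hG

theorem IsCutoff.hasFDerivAt_truncate (hχ : IsCutoff χ) (ϱ : ℝ) {G' : X →L[ℝ] Y} {v : X}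
    (hG : HasFDerivAt G G' v) :
    HasFDerivAt (truncate χ ϱ G) (extendCutoff χ (‖v‖ ^ 2 / ϱ ^ 2) • G' +
      (deriv (extendCutoff χ) (‖v‖ ^ 2 / ϱ ^ 2) •
        ((ϱ ^ 2)⁻¹ • (2 : ℝ) • innerSL ℝ v)).smulRight (G v)) v := by
  have hsq : HasFDerivAt (fun v : X => ‖v‖ ^ 2 / ϱ ^ 2) ((ϱ ^ 2)⁻¹ • (2 : ℝ) • innerSL ℝ v) v := by
    simp_rw [div_eq_inv_mul]
    exact ((hasStrictFDerivAt_norm_sq v).hasFDerivAt.const_mul _).congr_fderiv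
      (by rw [two_smul, two_smul])
  have hcut := (hχ.contDiff_extendCutoff.differentiable one_ne_zero (‖v‖ ^ 2 / ϱ ^ 2)).hasDerivAt
  rw [truncate_eq]
  exact (hcut.comp_hasFDerivAt v hsq).smul hG

theorem IsCutoff.fderiv_truncate_zero (hχ : IsCutoff χ) (ϱ : ℝ)
    (hG : HasFDerivAt G (0 : X →L[ℝ] Y) 0) (hG0 : G 0 = 0) : fderiv ℝ (truncate χ ϱ G) 0 = 0 := by
  rw [(hχ.hasFDerivAt_truncate ϱ hG).fderiv, hG0, smul_zero, zero_add]
  ext w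
  simp only [ContinuousLinearMap.smulRight_apply, smul_zero, FunLike.coe_zero, Pi.zero_apply]

theorem norm_fderiv_cutoff_smulRight_le {b B ϱ q : ℝ} (hb : |b| ≤ B) (hϱ : 0 < ϱ) (hq : 0 < q)
    {v : X} (hv : ‖v‖ ≤ 2 * ϱ) {y : Y} (hy : ‖y‖ ≤ ‖v‖ ^ q) :
    ‖(b • ((ϱ ^ 2)⁻¹ • (2 : ℝ) • innerSL ℝ v)).smulRight y‖ ≤ 8 * B * ‖v‖ ^ (q - 1) := by
  have hsq : ‖v‖ ^ 2 ≤ 4 * ϱ ^ 2 := by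
    calc ‖v‖ ^ 2 ≤ (2 * ϱ) ^ 2 := by gcongr
      _ = 4 * ϱ ^ 2 := by ring
  calc ‖(b • ((ϱ ^ 2)⁻¹ • (2 : ℝ) • innerSL ℝ v)).smulRight y‖
      = |b| * ((ϱ ^ 2)⁻¹ * (2 * ‖v‖)) * ‖y‖ := by
        rw [ContinuousLinearMap.norm_smulRight_apply, norm_smul, norm_smul, norm_smul,
          innerSL_apply_norm, Real.norm_eq_abs, Real.norm_ofNat,
          Real.norm_of_nonneg (r := (ϱ ^ 2)⁻¹) (by positivity)]
    _ ≤ B * ((ϱ ^ 2)⁻¹ * (2 * ‖v‖)) * (‖v‖ ^ (q - 1) * ‖v‖) := by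
        have := (abs_nonneg b).trans hb
        rw [rpow_sub_one_mul_self (norm_nonneg v) hq.ne']
        gcongr
    _ = 2 * B * (ϱ ^ 2)⁻¹ * ‖v‖ ^ 2 * ‖v‖ ^ (q - 1) := by ring
    _ ≤ 2 * B * (ϱ ^ 2)⁻¹ * (4 * ϱ ^ 2) * ‖v‖ ^ (q - 1) := by
        have := (abs_nonneg b).trans hb
        gcongr
    _ = 8 * B * ‖v‖ ^ (q - 1) := by field_simp; ring

theorem IsCutoff.norm_fderiv_truncate_le (hχ : IsCutoff χ) {q c B ϱ : ℝ} (hq : 1 < q)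
    (hB : ∀ r, 0 ≤ r → |deriv (extendCutoff χ) r| ≤ B) (hϱ : 0 < ϱ) {v : X}
    (hG : DifferentiableAt ℝ G v) (hG' : ‖fderiv ℝ G v‖ ≤ c * ‖v‖ ^ (q - 1))
    (hGv : ‖G v‖ ≤ ‖v‖ ^ q) (hv : ‖v‖ ≤ 2 * ϱ) :
    ‖fderiv ℝ (truncate χ ϱ G) v‖ ≤ (c + 8 * B) * ‖v‖ ^ (q - 1) := by
  rw [(hχ.hasFDerivAt_truncate ϱ hG.hasFDerivAt).fderiv, add_mul]
  refine (norm_add_le _ _).trans (add_le_add ?_ (norm_fderiv_cutoff_smulRight_le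
    (hB _ (by positivity)) hϱ (one_pos.trans hq) hv hGv))
  rw [norm_smul, Real.norm_eq_abs]
  exact (mul_le_of_le_one_left (norm_nonneg _) (hχ.abs_extendCutoff_le_one _)).trans hG'

theorem IsCutoff.fderiv_truncate_eq_zero (hχ : IsCutoff χ) {ϱ : ℝ} (hϱ : 0 < ϱ) {v : X}
    (hG : DifferentiableAt ℝ G v) (hv : 2 * ϱ ≤ ‖v‖) : fderiv ℝ (truncate χ ϱ G) v = 0 := by
  have hfour : 4 ≤ ‖v‖ ^ 2 / ϱ ^ 2 := by
    rw [le_div_iff₀ (by positivity)]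
    calc 4 * ϱ ^ 2 = (2 * ϱ) ^ 2 := by ring
      _ ≤ ‖v‖ ^ 2 := by gcongr
  rw [(hχ.hasFDerivAt_truncate ϱ hG.hasFDerivAt).fderiv, hχ.extendCutoff_of_four_le hfour,
    hχ.deriv_extendCutoff_of_four_le hfour, zero_smul, zero_smul, zero_add,
    ContinuousLinearMap.zero_smulRight]

theorem IsCutoff.exists_lipschitzWith_truncate (hχ : IsCutoff χ) {q c : ℝ} (hq : 1 < q)
    (hG : ContDiff ℝ 1 G) (hG' : ∀ v, ‖fderiv ℝ G v‖ ≤ c * ‖v‖ ^ (q - 1))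
    (hGv : ∀ v, ‖G v‖ ≤ ‖v‖ ^ q) :
    ∃ C : ℝ, 0 < C ∧ ∀ ϱ : ℝ, 0 < ϱ →
      LipschitzWith (C * ϱ ^ (q - 1)).toNNReal (truncate χ ϱ G) := by
  obtain ⟨B, hB0, hB⟩ := hχ.exists_abs_deriv_extendCutoff_le
  have hGdiff : Differentiable ℝ G := hG.differentiable one_ne_zero
  refine ⟨(|c| + 8 * B + 1) * 2 ^ (q - 1), by positivity, fun ϱ hϱ => ?_⟩
  refine lipschitzWith_of_nnnorm_fderiv_le
    ((hχ.contDiff_truncate ϱ hG).differentiable one_ne_zero) fun v => ?_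
  rw [← NNReal.coe_le_coe, Real.coe_toNNReal _ (by positivity), coe_nnnorm]
  rcases le_total (2 * ϱ) ‖v‖ with hv | hv
  · rw [hχ.fderiv_truncate_eq_zero hϱ (hGdiff v) hv, norm_zero]
    positivity
  · calc ‖fderiv ℝ (truncate χ ϱ G) v‖ ≤ (c + 8 * B) * ‖v‖ ^ (q - 1) :=
          hχ.norm_fderiv_truncate_le hq hB hϱ (hGdiff v) (hG' v) (hGv v) hv
      _ ≤ (|c| + 8 * B + 1) * (2 * ϱ) ^ (q - 1) := by
          have := le_abs_self c
          exact mul_le_mul (by linarith) (by gcongr) (by positivity) (by positivity)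
      _ = (|c| + 8 * B + 1) * 2 ^ (q - 1) * ϱ ^ (q - 1) := by
          rw [Real.mul_rpow zero_le_two hϱ.le, mul_assoc]

end Truncation

/-! ### The polynomial weight -/

section Weight

variable {N : ℕ} {m : ℝ}

/-- The density `1 + |ξ|^{2m}` of `weightMeasure N m`. -/
def wt (m : ℝ) (ξ : E N) : ℝ := 1 + ‖ξ‖ ^ (2 * m)

theorem one_le_wt (m : ℝ) (ξ : E N) : 1 ≤ wt m ξ :=
  le_add_of_nonneg_right (Real.rpow_nonneg (norm_nonneg _) _)

theorem wt_pos (m : ℝ) (ξ : E N) : 0 < wt m ξ := one_pos.trans_le (one_le_wt m ξ)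

theorem measurable_wt (m : ℝ) : Measurable (wt m : E N → ℝ) := by
  unfold wt
  fun_prop

theorem continuous_wt (hm : 0 < m) : Continuous (wt m : E N → ℝ) :=
  continuous_const.add ((Real.continuous_rpow_const (by positivity)).comp continuous_norm)

theorem wt_le_wt (hm : 0 < m) {x y : E N} (hxy : ‖x‖ ≤ ‖y‖) : wt m x ≤ wt m y := by
  unfold wt
  gcongr

theorem norm_add_rpow_le {X : Type*} [SeminormedAddCommGroup X] {a : ℝ} (ha : 0 ≤ a) (x y : X) :
    ‖x + y‖ ^ a ≤ 2 ^ a * (‖x‖ ^ a + ‖y‖ ^ a) := by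
  have hmax : ‖x + y‖ ≤ 2 * max ‖x‖ ‖y‖ := by
    linarith [norm_add_le x y, le_max_left ‖x‖ ‖y‖, le_max_right ‖x‖ ‖y‖]
  calc ‖x + y‖ ^ a ≤ (2 * max ‖x‖ ‖y‖) ^ a := by gcongr
    _ = 2 ^ a * max ‖x‖ ‖y‖ ^ a := Real.mul_rpow (by norm_num) (by positivity)
    _ ≤ 2 ^ a * (‖x‖ ^ a + ‖y‖ ^ a) := by
      have hx : 0 ≤ ‖x‖ ^ a := by positivity
      have hy : 0 ≤ ‖y‖ ^ a := by positivity
      gcongr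
      rcases max_cases ‖x‖ ‖y‖ with h | h <;> rw [h.1] <;> linarith

theorem wt_add_le (hm : 0 < m) (x y : E N) :
    wt m (x + y) ≤ 2 ^ (2 * m) * (wt m x * wt m y) := by
  have hone : (1 : ℝ) ≤ 2 ^ (2 * m) := Real.one_le_rpow (by norm_num) (by positivity)
  have hx : 0 ≤ ‖x‖ ^ (2 * m) := by positivity
  have hy : 0 ≤ ‖y‖ ^ (2 * m) := by positivity
  have hadd := norm_add_rpow_le (a := 2 * m) (by positivity) x y
  simp only [wt]
  nlinarith [mul_nonneg hx hy]

theorem wt_le_rescaled (hm : 0 < m) {b c : ℝ} (hb : 1 ≤ b) (hc : 0 ≤ c) (hc1 : c ≤ 1)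
    (ξ z : E N) : wt m ξ ≤ 2 ^ (2 * m) * (wt m z * wt m (b • (ξ - c • z))) := by
  have hcz : wt m (c • z) ≤ wt m z := wt_le_wt hm (by
    rw [norm_smul, Real.norm_of_nonneg hc]
    exact mul_le_of_le_one_left (norm_nonneg _) hc1)
  have hbξ : wt m (ξ - c • z) ≤ wt m (b • (ξ - c • z)) := wt_le_wt hm (by
    rw [norm_smul, Real.norm_of_nonneg (zero_le_one.trans hb)]
    exact le_mul_of_one_le_left (norm_nonneg _) hb)
  calc wt m ξ = wt m (c • z + (ξ - c • z)) := by rw [add_sub_cancel]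
    _ ≤ 2 ^ (2 * m) * (wt m (c • z) * wt m (ξ - c • z)) := wt_add_le hm _ _
    _ ≤ _ := by
      have := (wt_pos m (ξ - c • z)).le
      have := (wt_pos m z).le
      gcongr

theorem exists_wt_le_exp (hm : 0 < m) {ε : ℝ} (hε : 0 < ε) :
    ∃ C : ℝ, 0 < C ∧ ∀ z : E N, wt m z ≤ C * Real.exp (ε * ‖z‖ ^ 2) := by
  refine ⟨1 + (m / ε) ^ m, by positivity, fun z => ?_⟩
  have hone : 1 ≤ Real.exp (ε * ‖z‖ ^ 2) := Real.one_le_exp (by positivity)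
  have hsq : ‖z‖ ^ 2 ≤ m / ε * Real.exp (ε / m * ‖z‖ ^ 2) := by
    have := Real.add_one_le_exp (ε / m * ‖z‖ ^ 2)
    calc ‖z‖ ^ 2 = m / ε * (ε / m * ‖z‖ ^ 2) := by field_simp
      _ ≤ m / ε * Real.exp (ε / m * ‖z‖ ^ 2) := by gcongr; linarith
  have hpow : ‖z‖ ^ (2 * m) ≤ (m / ε) ^ m * Real.exp (ε * ‖z‖ ^ 2) := by
    calc ‖z‖ ^ (2 * m) = (‖z‖ ^ 2) ^ m := by
          rw [Real.rpow_mul (norm_nonneg _), Real.rpow_two]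
      _ ≤ (m / ε * Real.exp (ε / m * ‖z‖ ^ 2)) ^ m := by gcongr
      _ = (m / ε) ^ m * Real.exp (ε * ‖z‖ ^ 2) := by
          rw [Real.mul_rpow (by positivity) (by positivity), ← Real.exp_mul]
          congr 2
          field_simp
  simp only [wt]
  nlinarith

theorem integrable_exp_neg_mul_sq {b : ℝ} (hb : 0 < b) :
    Integrable fun z : E N => Real.exp (-b * ‖z‖ ^ 2) := by
  refine Integrable.of_integral_ne_zero ?_
  rw [GaussianFourier.integral_rexp_neg_mul_sq_norm hb]
  positivity

theorem weightMeasure_absolutelyContinuous (N : ℕ) (m : ℝ) :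
    weightMeasure N m ≪ (volume : Measure (E N)) := withDensity_absolutelyContinuous _ _

theorem lintegral_weightMeasure (f : E N → ℝ≥0∞) :
    ∫⁻ ξ, f ξ ∂(weightMeasure N m) = ∫⁻ ξ, ENNReal.ofReal (wt m ξ) * f ξ :=
  lintegral_withDensity_eq_lintegral_mul_non_measurable _
    (measurable_wt m).ennreal_ofReal (.of_forall fun _ => ENNReal.ofReal_lt_top) f

theorem lintegral_comp_smul {b : ℝ} (hb : 0 < b) {f : E N → ℝ≥0∞} (hf : Measurable f) :
    ∫⁻ x, f (b • x) = ENNReal.ofReal (b ^ (-(N : ℝ))) * ∫⁻ x, f x := by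
  rw [← lintegral_map hf (measurable_const_smul b), Measure.map_addHaar_smul volume hb.ne',
    lintegral_smul_measure, finrank_euclideanSpace, Fintype.card_fin, smul_eq_mul,
    abs_of_pos (by positivity), Real.rpow_neg hb.le, Real.rpow_natCast]

end Weight

/-! ### Young's inequality for kernels -/

section Young

variable {α β : Type*} [MeasurableSpace α] [MeasurableSpace β] {μ : Measure α} {ν : Measure β}
  {r p s : ℝ}

theorem mul_eq_rpow_mul_rpow_mul_rpow (hs : 0 ≤ s) (hs2 : s ≤ 1 / 2) (hr : r * (1 - s) = 1)
    (hp : p * (1 / 2 + s) = 1) (x y : ℝ≥0∞) :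
    (x ^ r * y ^ p) ^ (1 / 2 : ℝ) * (x ^ r) ^ (1 / 2 - s) * (y ^ p) ^ s = x * y := by
  have hr0 : 0 ≤ r := by nlinarith
  have hp0 : 0 ≤ p := by nlinarith
  have hx : x ^ (r * (1 / 2)) * x ^ (r * (1 / 2 - s)) = x := by
    rw [← ENNReal.rpow_add_of_nonneg _ _ (by positivity) (mul_nonneg hr0 (by linarith)),
      show r * (1 / 2) + r * (1 / 2 - s) = 1 by linarith, ENNReal.rpow_one]
  have hy : y ^ (p * (1 / 2)) * y ^ (p * s) = y := by
    rw [← ENNReal.rpow_add_of_nonneg _ _ (by positivity) (by positivity), ← mul_add, hp,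
      ENNReal.rpow_one]
  calc (x ^ r * y ^ p) ^ (1 / 2 : ℝ) * (x ^ r) ^ (1 / 2 - s) * (y ^ p) ^ s
      = (x ^ (r * (1 / 2)) * x ^ (r * (1 / 2 - s))) *
        (y ^ (p * (1 / 2)) * y ^ (p * s)) := by
        rw [ENNReal.mul_rpow_of_nonneg _ _ (by norm_num)]
        simp only [← ENNReal.rpow_mul]
        ring
    _ = x * y := by rw [hx, hy]

theorem lintegral_mul_rpow_two_le (hs : 0 ≤ s) (hs2 : s ≤ 1 / 2) (hr : r * (1 - s) = 1)
    (hp : p * (1 / 2 + s) = 1) {g h : α → ℝ≥0∞} (hg : AEMeasurable g μ) (hh : AEMeasurable h μ) :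
    (∫⁻ z, g z * h z ∂μ) ^ (2 : ℝ) ≤ (∫⁻ z, g z ^ r * h z ^ p ∂μ) *
      ((∫⁻ z, g z ^ r ∂μ) ^ (1 - 2 * s) * (∫⁻ z, h z ^ p ∂μ) ^ (2 * s)) := by
  have holder := ENNReal.lintegral_prod_norm_pow_le (μ := μ) (Finset.univ : Finset (Fin 3))
    (f := ![fun z => g z ^ r * h z ^ p, fun z => g z ^ r, fun z => h z ^ p])
    (p := ![1 / 2, 1 / 2 - s, s])
    (by
      intro i _
      fin_cases i
      exacts [(hg.pow_const _).mul (hh.pow_const _), hg.pow_const _, hh.pow_const _])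
    (by
      simp only [Fin.sum_univ_three, Matrix.cons_val]
      ring)
    (by
      intro i _
      fin_cases i
      exacts [one_half_pos.le, sub_nonneg.2 hs2, hs])
  simp only [Fin.prod_univ_three, Matrix.cons_val,
    mul_eq_rpow_mul_rpow_mul_rpow hs hs2 hr hp] at holder
  refine (ENNReal.rpow_le_rpow holder zero_le_two).trans_eq ?_
  rw [ENNReal.mul_rpow_of_nonneg _ _ zero_le_two, ENNReal.mul_rpow_of_nonneg _ _ zero_le_two,
    ← ENNReal.rpow_mul, ← ENNReal.rpow_mul, ← ENNReal.rpow_mul,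
    show (1 / 2 * 2 : ℝ) = 1 by norm_num, ENNReal.rpow_one,
    show (1 / 2 - s) * 2 = 1 - 2 * s by ring, mul_comm s 2, mul_assoc]

theorem lintegral_kernel_rpow_two_le [SFinite μ] [SFinite ν] (hs : 0 ≤ s) (hs2 : s ≤ 1 / 2)
    (hr : r * (1 - s) = 1) (hp : p * (1 / 2 + s) = 1) {g : β → ℝ≥0∞} (hg : Measurable g)
    {k : α → β → ℝ≥0∞} (hk : Measurable (Function.uncurry k)) {I J : ℝ≥0∞}
    (hI : ∀ z, ∫⁻ ξ, k ξ z ^ p ∂μ ≤ I) (hJ : ∀ ξ, (∫⁻ z, k ξ z ^ p ∂ν) ^ (2 * s) ≤ J) :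
    ∫⁻ ξ, (∫⁻ z, g z * k ξ z ∂ν) ^ (2 : ℝ) ∂μ ≤
      (∫⁻ z, g z ^ r ∂ν) ^ (2 * (1 - s)) * J * I := by
  have hgk : Measurable (Function.uncurry fun ξ z => g z ^ r * k ξ z ^ p) :=
    ((hg.comp measurable_snd).pow_const _).mul (hk.pow_const _)
  have hpoint : ∀ ξ, (∫⁻ z, g z * k ξ z ∂ν) ^ (2 : ℝ) ≤
      (∫⁻ z, g z ^ r * k ξ z ^ p ∂ν) * ((∫⁻ z, g z ^ r ∂ν) ^ (1 - 2 * s) * J) := fun ξ =>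
    (lintegral_mul_rpow_two_le hs hs2 hr hp hg.aemeasurable
      hk.of_uncurry_left.aemeasurable).trans (by gcongr; exact hJ ξ)
  have hswap : ∫⁻ ξ, ∫⁻ z, g z ^ r * k ξ z ^ p ∂ν ∂μ ≤ (∫⁻ z, g z ^ r ∂ν) * I := by
    rw [lintegral_lintegral_swap hgk.aemeasurable, ← lintegral_mul_const _ (hg.pow_const _)]
    refine lintegral_mono fun z => ?_
    rw [lintegral_const_mul _ (hk.of_uncurry_right.pow_const _)]
    gcongr
    exact hI z
  calc ∫⁻ ξ, (∫⁻ z, g z * k ξ z ∂ν) ^ (2 : ℝ) ∂μ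
      ≤ ∫⁻ ξ, (∫⁻ z, g z ^ r * k ξ z ^ p ∂ν) * ((∫⁻ z, g z ^ r ∂ν) ^ (1 - 2 * s) * J) ∂μ :=
        lintegral_mono hpoint
    _ = (∫⁻ ξ, ∫⁻ z, g z ^ r * k ξ z ^ p ∂ν ∂μ) * ((∫⁻ z, g z ^ r ∂ν) ^ (1 - 2 * s) * J) :=
        lintegral_mul_const _ hgk.lintegral_prod_right'
    _ ≤ ((∫⁻ z, g z ^ r ∂ν) * I) * ((∫⁻ z, g z ^ r ∂ν) ^ (1 - 2 * s) * J) := by gcongr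
    _ = ((∫⁻ z, g z ^ r ∂ν) ^ (1 : ℝ) * (∫⁻ z, g z ^ r ∂ν) ^ (1 - 2 * s)) * J * I := by
        rw [ENNReal.rpow_one]
        ring
    _ = (∫⁻ z, g z ^ r ∂ν) ^ (2 * (1 - s)) * J * I := by
        rw [← ENNReal.rpow_add_of_nonneg _ _ zero_le_one (by linarith)]
        congr 3
        ring

end Young

/-! ### Weighted convolution estimates -/

section WeightedNorm

variable {N : ℕ} {m b c : ℝ} {V : Type*} [NormedAddCommGroup V]

theorem lintegral_ofReal_exp_rpow_ne_top {K a r : ℝ} (hK : 0 ≤ K) (ha : 0 < a) (hr : 0 < r) :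
    ∫⁻ z : E N, ENNReal.ofReal (K * Real.exp (-a * ‖z‖ ^ 2)) ^ r ≠ ⊤ := by
  have hrpow : ∀ z : E N, ENNReal.ofReal (K * Real.exp (-a * ‖z‖ ^ 2)) ^ r =
      ENNReal.ofReal (K ^ r * Real.exp (-(r * a) * ‖z‖ ^ 2)) := fun z => by
    rw [ENNReal.ofReal_rpow_of_nonneg (by positivity) hr.le, Real.mul_rpow hK (by positivity),
      ← Real.exp_mul]
    congr 3
    ring
  simp_rw [hrpow]
  exact ((integrable_exp_neg_mul_sq (by positivity)).const_mul _).lintegral_lt_top.ne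

/-- The function `√(1 + |x|^{2m}) |f(x)|`, dilated by `b`. -/
def weightedNorm (m b : ℝ) (f : E N → V) (x : E N) : ℝ≥0∞ :=
  ENNReal.ofReal √(wt m (b • x)) * ‖f (b • x)‖ₑ

theorem measurable_weightedNorm (b : ℝ) {f : E N → V} (hf : StronglyMeasurable f) :
    Measurable (weightedNorm m b f) :=
  ((measurable_wt m).sqrt.ennreal_ofReal.mul hf.enorm).comp (measurable_const_smul b)

theorem lintegral_weightedNorm_rpow_le {p : ℝ} (hp : 0 < p) (hp2 : p ≤ 2) (hb : 1 ≤ b)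
    {f : E N → V} (hf : StronglyMeasurable f) :
    ∫⁻ x, weightedNorm m b f x ^ p ≤ ∫⁻ x, ‖f x‖ₑ ^ p ∂(weightMeasure N m) := by
  have hmeas : Measurable fun x => (ENNReal.ofReal √(wt m x) * ‖f x‖ₑ) ^ p :=
    ((measurable_wt m).sqrt.ennreal_ofReal.mul hf.enorm).pow_const p
  calc ∫⁻ x, weightedNorm m b f x ^ p
      = ENNReal.ofReal (b ^ (-(N : ℝ))) * ∫⁻ x, (ENNReal.ofReal √(wt m x) * ‖f x‖ₑ) ^ p :=
        lintegral_comp_smul (one_pos.trans_le hb) hmeas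
    _ ≤ 1 * ∫⁻ x, (ENNReal.ofReal √(wt m x) * ‖f x‖ₑ) ^ p := by
        gcongr
        rw [ENNReal.ofReal_le_one]
        exact Real.rpow_le_one_of_one_le_of_nonpos hb (by simp only [Left.neg_nonpos_iff,
          Nat.cast_nonneg])
    _ ≤ ∫⁻ x, ‖f x‖ₑ ^ p ∂(weightMeasure N m) := by
        rw [one_mul, lintegral_weightMeasure]
        refine lintegral_mono fun x => ?_
        rw [ENNReal.mul_rpow_of_nonneg _ _ hp.le,
          ENNReal.ofReal_rpow_of_nonneg (Real.sqrt_nonneg _) hp.le]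
        gcongr
        calc √(wt m x) ^ p ≤ √(wt m x) ^ (2 : ℝ) :=
              Real.rpow_le_rpow_of_exponent_le (Real.one_le_sqrt.2 (one_le_wt m x)) hp2
          _ = wt m x := by rw [Real.rpow_two, Real.sq_sqrt (wt_pos m x).le]

theorem lintegral_comp_sub_smul_rpow {s : ℝ} (hs : 0 ≤ s) (hc : 0 ≤ c) (hcs : 0 < c ∨ s = 0)
    {h : E N → ℝ≥0∞} (hh : Measurable h) (ξ : E N) :
    (∫⁻ z, h (ξ - c • z)) ^ (2 * s) =
      ENNReal.ofReal (c ^ (-(N * s))) ^ (2 : ℝ) * (∫⁻ x, h x) ^ (2 * s) := by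
  rcases hcs with hc0 | rfl
  · rw [lintegral_comp_smul hc0 (f := fun y => h (ξ - y)) (by fun_prop),
      lintegral_sub_left_eq_self h ξ, ENNReal.mul_rpow_of_nonneg _ _ (by positivity),
      ENNReal.ofReal_rpow_of_pos (by positivity), ENNReal.ofReal_rpow_of_pos (by positivity),
      ← Real.rpow_mul hc, ← Real.rpow_mul hc]
    congr 3
    ring
  · simp only [mul_zero, neg_zero, Real.rpow_zero, ENNReal.rpow_zero, ENNReal.ofReal_one,
      ENNReal.one_rpow, mul_one]

theorem lintegral_weighted_conv_le {s r p : ℝ} (hs : 0 ≤ s) (hs2 : s ≤ 1 / 2)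
    (hr : r * (1 - s) = 1) (hp : p * (1 / 2 + s) = 1) (hb : 1 ≤ b) (hc : 0 ≤ c)
    (hcs : 0 < c ∨ s = 0) {g : E N → ℝ≥0∞} (hg : Measurable g) {f : E N → V}
    (hf : StronglyMeasurable f) :
    (∫⁻ ξ, (∫⁻ z, g z * weightedNorm m b f (ξ - c • z)) ^ (2 : ℝ)) ^ (1 / 2 : ℝ) ≤
      (∫⁻ z, g z ^ r) ^ (1 - s) * ENNReal.ofReal (c ^ (-(N * s))) *
        (∫⁻ x, ‖f x‖ₑ ^ p ∂(weightMeasure N m)) ^ (1 / 2 + s) := by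
  have hp0 : 0 < p := by nlinarith
  have hp2 : p ≤ 2 := by nlinarith
  have hk : Measurable (Function.uncurry fun ξ z : E N => weightedNorm m b f (ξ - c • z)) :=
    (measurable_weightedNorm b hf).comp (by fun_prop)
  have hI := lintegral_weightedNorm_rpow_le (m := m) hp0 hp2 hb hf
  set I := ∫⁻ x, ‖f x‖ₑ ^ p ∂(weightMeasure N m)
  have hyoung := lintegral_kernel_rpow_two_le (μ := volume) (ν := volume) hs hs2 hr hp hg hk
    (I := I) (J := ENNReal.ofReal (c ^ (-(N * s))) ^ (2 : ℝ) * I ^ (2 * s))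
    (fun z => (lintegral_sub_right_eq_self (fun x => weightedNorm m b f x ^ p) (c • z)).trans_le hI)
    (fun ξ => by
      rw [lintegral_comp_sub_smul_rpow hs hc hcs ((measurable_weightedNorm b hf).pow_const p) ξ]
      gcongr)
  calc _ ≤ ((∫⁻ z, g z ^ r) ^ (2 * (1 - s)) *
          (ENNReal.ofReal (c ^ (-(N * s))) ^ (2 : ℝ) * I ^ (2 * s)) * I) ^ (1 / 2 : ℝ) := by
        gcongr
    _ = (((∫⁻ z, g z ^ r) ^ (1 - s) * ENNReal.ofReal (c ^ (-(N * s))) *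
          I ^ (1 / 2 + s)) ^ (2 : ℝ)) ^ (1 / 2 : ℝ) := by
        congr 1
        rw [ENNReal.mul_rpow_of_nonneg _ _ zero_le_two, ENNReal.mul_rpow_of_nonneg _ _ zero_le_two,
          ← ENNReal.rpow_mul, ← ENNReal.rpow_mul, show (1 / 2 + s) * 2 = 2 * s + 1 by ring,
          ENNReal.rpow_add_of_nonneg (2 * s) 1 (by positivity) zero_le_one, ENNReal.rpow_one,
          mul_comm (1 - s) 2]
        ring
    _ = _ := by rw [← ENNReal.rpow_mul, show (2 * (1 / 2) : ℝ) = 1 by norm_num, ENNReal.rpow_one]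

end WeightedNorm

/-! ### Rescaled convolutions -/

section RescaledConv

variable {N : ℕ} {m : ℝ} {V V' : Type*} [NormedAddCommGroup V] [NormedSpace ℝ V]
  [NormedAddCommGroup V'] [NormedSpace ℝ V'] {Γ : E N → V →L[ℝ] V'} {A b c : ℝ}

/-- A continuous operator-valued kernel with Gaussian decay. The rate `1/8` is smaller than the
rate `1/4` of the heat kernel, so that the gradient of the heat kernel also qualifies. -/
structure IsGaussianKernel (Γ : E N → V →L[ℝ] V') (A : ℝ) : Prop where
  continuous : Continuous Γ
  bound : ∀ z, ‖Γ z‖ ≤ A * Real.exp (-(1 / 8) * ‖z‖ ^ 2)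

/-- The convolution `f ↦ ∫ Γ(z) f(b (ξ - c z)) dz` with dilated arguments. With
`b = e^{τ/2}`, `c = a(τ)^{1/2}` it represents `e^{τ𝓛}` up to a constant. -/
def rescaledConv (Γ : E N → V →L[ℝ] V') (b c : ℝ) (f : E N → V) (ξ : E N) : V' :=
  ∫ z, Γ z (f (b • (ξ - c • z)))

theorem IsGaussianKernel.nonneg (hΓ : IsGaussianKernel Γ A) : 0 ≤ A := by
  simpa only [norm_zero, ne_eq, OfNat.ofNat_ne_zero, not_false_eq_true, zero_pow, mul_zero,
    Real.exp_zero, mul_one] using (norm_nonneg _).trans (hΓ.bound 0)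

theorem IsGaussianKernel.stronglyMeasurable_uncurry (hΓ : IsGaussianKernel Γ A) (b c : ℝ)
    {f : E N → V} (hf : StronglyMeasurable f) :
    StronglyMeasurable fun x : E N × E N => Γ x.2 (f (b • (x.1 - c • x.2))) := by
  have hkernel : StronglyMeasurable fun x : E N × E N => Γ x.2 :=
    (hΓ.continuous.comp continuous_snd).stronglyMeasurable
  have hfun : StronglyMeasurable fun x : E N × E N => f (b • (x.1 - c • x.2)) :=
    hf.comp_measurable (by fun_prop)
  exact isBoundedBilinearMap_apply.continuous.comp_stronglyMeasurable (hkernel.prodMk hfun)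

theorem IsGaussianKernel.stronglyMeasurable_rescaledConv (hΓ : IsGaussianKernel Γ A) (b c : ℝ)
    {f : E N → V} (hf : StronglyMeasurable f) : StronglyMeasurable (rescaledConv Γ b c f) :=
  (hΓ.stronglyMeasurable_uncurry b c hf).integral_prod_right'

/-- Half of the Gaussian decay absorbs the growth of the weight. -/
theorem IsGaussianKernel.exists_sqrt_wt_mul_norm_le (hm : 0 < m) (hΓ : IsGaussianKernel Γ A) :
    ∃ K : ℝ, 0 ≤ K ∧ ∀ b c : ℝ, 1 ≤ b → 0 ≤ c → c ≤ 1 → ∀ ξ z : E N,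
      √(wt m ξ) * ‖Γ z‖ ≤
        K * Real.exp (-(1 / 16) * ‖z‖ ^ 2) * √(wt m (b • (ξ - c • z))) := by
  obtain ⟨C, hC, hwt⟩ := exists_wt_le_exp (N := N) hm (show (0 : ℝ) < 1 / 8 by norm_num)
  have hA := hΓ.nonneg
  refine ⟨√(2 ^ (2 * m) * C) * A, by positivity, fun b c hb hc hc1 ξ z => ?_⟩
  have hsqrt_exp : √(Real.exp (1 / 8 * ‖z‖ ^ 2)) = Real.exp (1 / 16 * ‖z‖ ^ 2) := by
    rw [← Real.exp_half]
    congr 1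
    ring
  have hsqrt : √(wt m ξ) ≤
      √(2 ^ (2 * m) * C) * Real.exp (1 / 16 * ‖z‖ ^ 2) * √(wt m (b • (ξ - c • z))) := by
    rw [← hsqrt_exp, ← Real.sqrt_mul (by positivity), ← Real.sqrt_mul (by positivity)]
    refine Real.sqrt_le_sqrt ((wt_le_rescaled hm hb hc hc1 ξ z).trans ?_)
    have := (wt_pos m (b • (ξ - c • z))).le
    rw [mul_assoc, mul_assoc, ← mul_assoc C]
    gcongr
    exact hwt z
  calc √(wt m ξ) * ‖Γ z‖
      ≤ (√(2 ^ (2 * m) * C) * Real.exp (1 / 16 * ‖z‖ ^ 2) * √(wt m (b • (ξ - c • z)))) *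
        (A * Real.exp (-(1 / 8) * ‖z‖ ^ 2)) := by
        gcongr
        exact hΓ.bound z
    _ = √(2 ^ (2 * m) * C) * A *
          (Real.exp (1 / 16 * ‖z‖ ^ 2) * Real.exp (-(1 / 8) * ‖z‖ ^ 2)) *
          √(wt m (b • (ξ - c • z))) := by ring
    _ = _ := by
        rw [← Real.exp_add]
        congr 3
        ring

theorem lintegral_conv_le_lintegral_weighted_conv {K a : ℝ} (hK : 0 ≤ K) {f : E N → V}
    (hΓ : ∀ ξ z, √(wt m ξ) * ‖Γ z‖ ≤
      K * Real.exp (-a * ‖z‖ ^ 2) * √(wt m (b • (ξ - c • z)))) :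
    ∫⁻ ξ, (∫⁻ z, ‖Γ z‖ₑ * ‖f (b • (ξ - c • z))‖ₑ) ^ (2 : ℝ) ∂(weightMeasure N m) ≤
      ∫⁻ ξ, (∫⁻ z, ENNReal.ofReal (K * Real.exp (-a * ‖z‖ ^ 2)) *
        weightedNorm m b f (ξ - c • z)) ^ (2 : ℝ) := by
  rw [lintegral_weightMeasure]
  refine lintegral_mono fun ξ => ?_
  have hsq : ENNReal.ofReal (wt m ξ) = ENNReal.ofReal √(wt m ξ) ^ (2 : ℝ) := by
    rw [ENNReal.ofReal_rpow_of_nonneg (Real.sqrt_nonneg _) zero_le_two, Real.rpow_two,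
      Real.sq_sqrt (wt_pos m ξ).le]
  rw [hsq, ← ENNReal.mul_rpow_of_nonneg _ _ zero_le_two]
  gcongr
  rw [← lintegral_const_mul' _ _ ENNReal.ofReal_ne_top]
  refine lintegral_mono fun z => ?_
  rw [weightedNorm, ← mul_assoc, ← mul_assoc]
  refine mul_le_mul_left ?_ _
  rw [← ofReal_norm, ← ENNReal.ofReal_mul (Real.sqrt_nonneg _),
    ← ENNReal.ofReal_mul (by positivity)]
  exact ENNReal.ofReal_le_ofReal (hΓ ξ z)

/-- Parameters `(b, c)` for which the rescaled convolution acts from `L^p` to `L²`,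
`1/p = 1/2 + s`. The value `c = 0`, the dilation `f ↦ f (b ·)`, is admissible only for `p = 2`. -/
def convParams (s : ℝ) : Set (ℝ × ℝ) := {x | 1 ≤ x.1 ∧ 0 ≤ x.2 ∧ x.2 ≤ 1 ∧ (0 < x.2 ∨ s = 0)}

theorem IsGaussianKernel.exists_lintegral_bound (hm : 0 < m) (hΓ : IsGaussianKernel Γ A) {s : ℝ}
    (hs : 0 ≤ s) (hs2 : s ≤ 1 / 2) :
    ∃ C : ℝ, 0 ≤ C ∧ ∀ x ∈ convParams s, ∀ f : E N → V, StronglyMeasurable f →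
      (∫⁻ ξ, (∫⁻ z, ‖Γ z‖ₑ * ‖f (x.1 • (ξ - x.2 • z))‖ₑ) ^ (2 : ℝ)
          ∂(weightMeasure N m)) ^ (1 / 2 : ℝ) ≤
        ENNReal.ofReal (C * x.2 ^ (-(N * s))) *
          eLpNorm f (ENNReal.ofReal (1 / (1 / 2 + s))) (weightMeasure N m) := by
  obtain ⟨K, hK, hdecay⟩ := hΓ.exists_sqrt_wt_mul_norm_le hm
  have hr : (1 / (1 - s)) * (1 - s) = 1 := one_div_mul_cancel (by linarith)
  have hp : (1 / (1 / 2 + s)) * (1 / 2 + s) = 1 := one_div_mul_cancel (by linarith)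
  have hr0 : 0 < 1 / (1 - s) := one_div_pos.2 (by linarith)
  have hp0 : 0 < 1 / (1 / 2 + s) := by positivity
  let g : E N → ℝ≥0∞ := fun z => ENNReal.ofReal (K * Real.exp (-(1 / 16) * ‖z‖ ^ 2))
  have hfin : (∫⁻ z, g z ^ (1 / (1 - s))) ^ (1 - s) ≠ ⊤ :=
    ENNReal.rpow_ne_top_of_nonneg (by linarith)
      (lintegral_ofReal_exp_rpow_ne_top hK (by norm_num) hr0)
  refine ⟨((∫⁻ z, g z ^ (1 / (1 - s))) ^ (1 - s)).toReal, ENNReal.toReal_nonneg, ?_⟩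
  rintro ⟨b, c⟩ ⟨hb, hc, hc1, hcs⟩ f hf
  rw [eLpNorm_eq_lintegral_rpow_enorm_toReal (by simpa only [ne_eq, ENNReal.ofReal_eq_zero,
      not_le] using hp0) ENNReal.ofReal_ne_top, ENNReal.toReal_ofReal hp0.le, one_div_one_div,
    ENNReal.ofReal_mul ENNReal.toReal_nonneg, ENNReal.ofReal_toReal hfin]
  exact (ENNReal.rpow_le_rpow (lintegral_conv_le_lintegral_weighted_conv hK
    (hdecay b c hb hc hc1)) one_half_pos.le).trans
      (lintegral_weighted_conv_le hs hs2 hr hp hb hc hcs (by fun_prop) hf)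

end RescaledConv

section ConvOperator

variable {N : ℕ} {m : ℝ} {V V' : Type*} [NormedAddCommGroup V] [NormedSpace ℝ V]
  [NormedAddCommGroup V'] [NormedSpace ℝ V'] {Γ : E N → V →L[ℝ] V'} {A b c s : ℝ}

theorem enorm_rescaledConv_le (b c : ℝ) (f : E N → V) (ξ : E N) :
    ‖rescaledConv Γ b c f ξ‖ₑ ≤ ∫⁻ z, ‖Γ z‖ₑ * ‖f (b • (ξ - c • z))‖ₑ :=
  (enorm_integral_le_lintegral_enorm _).trans (lintegral_mono fun z => (Γ z).le_opENorm _)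

theorem rescaledConv_add {f g : E N → V} {ξ : E N}
    (hf : Integrable fun z => Γ z (f (b • (ξ - c • z))))
    (hg : Integrable fun z => Γ z (g (b • (ξ - c • z)))) :
    rescaledConv Γ b c (f + g) ξ = rescaledConv Γ b c f ξ + rescaledConv Γ b c g ξ := by
  simp only [rescaledConv, Pi.add_apply, map_add]
  exact integral_add hf hg

theorem rescaledConv_smul (k : ℝ) (f : E N → V) :
    rescaledConv Γ b c (k • f) = k • rescaledConv Γ b c f := by
  ext ξ
  simp only [rescaledConv, Pi.smul_apply, map_smul]
  exact integral_smul k _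

theorem rescaledConv_congr_ae (hb : b ≠ 0) (c : ℝ) {f g : E N → V} (hfg : f =ᵐ[volume] g) :
    rescaledConv Γ b c f =ᵐ[volume] rescaledConv Γ b c g := by
  obtain ⟨T, hT, hT_meas, hT_null⟩ := exists_measurable_superset_of_null (ae_iff.1 hfg)
  have hslice : ∀ z : E N, ∀ᵐ ξ : E N, b • (ξ - c • z) ∉ T := fun z => by
    have hmp : Measure.QuasiMeasurePreserving fun ξ : E N => b • (ξ - c • z) :=
      (Measure.quasiMeasurePreserving_smul volume hb).comp
        (measurePreserving_sub_right volume (c • z)).quasiMeasurePreserving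
    exact hmp.ae (measure_eq_zero_iff_ae_notMem.1 hT_null)
  have hswap : ∀ᵐ ξ : E N, ∀ᵐ z : E N, b • (ξ - c • z) ∉ T := by
    refine (Measure.ae_ae_comm ?_).1 (.of_forall hslice)
    exact (hT_meas.compl).preimage
      (f := fun y : E N × E N => b • (y.2 - c • y.1)) (by fun_prop)
  filter_upwards [hswap] with ξ hξ
  refine integral_congr_ae (hξ.mono fun z hz => ?_)
  have heq : f (b • (ξ - c • z)) = g (b • (ξ - c • z)) := by
    by_contra hne
    exact hz (hT hne)
  simp only [heq]

theorem IsGaussianKernel.exists_eLpNorm_rescaledConv_le (hm : 0 < m) (hΓ : IsGaussianKernel Γ A)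
    (hs : 0 ≤ s) (hs2 : s ≤ 1 / 2) :
    ∃ C : ℝ, 0 ≤ C ∧ ∀ x ∈ convParams s, ∀ f : E N → V, StronglyMeasurable f →
      eLpNorm (rescaledConv Γ x.1 x.2 f) 2 (weightMeasure N m) ≤
        ENNReal.ofReal (C * x.2 ^ (-(N * s))) *
          eLpNorm f (ENNReal.ofReal (1 / (1 / 2 + s))) (weightMeasure N m) := by
  obtain ⟨C, hC, hbound⟩ := hΓ.exists_lintegral_bound hm hs hs2
  refine ⟨C, hC, fun x hx f hf => (?_ : _ ≤ _).trans (hbound x hx f hf)⟩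
  rw [eLpNorm_eq_lintegral_rpow_enorm_toReal two_ne_zero ENNReal.ofNat_ne_top]
  simp only [ENNReal.toReal_ofNat]
  gcongr with ξ
  exact enorm_rescaledConv_le x.1 x.2 f ξ

theorem IsGaussianKernel.ae_integrable (hm : 0 < m) (hΓ : IsGaussianKernel Γ A) (hs : 0 ≤ s)
    (hs2 : s ≤ 1 / 2) {x : ℝ × ℝ} (hx : x ∈ convParams s) {f : E N → V}
    (hf : StronglyMeasurable f)
    (hfp : MemLp f (ENNReal.ofReal (1 / (1 / 2 + s))) (weightMeasure N m)) :
    ∀ᵐ ξ ∂(weightMeasure N m), Integrable fun z => Γ z (f (x.1 • (ξ - x.2 • z))) := by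
  obtain ⟨C, -, hbound⟩ := hΓ.exists_lintegral_bound hm hs hs2
  have hlt := (hbound x hx f hf).trans_lt (ENNReal.mul_lt_top ENNReal.ofReal_lt_top hfp.2)
  have hmeas : Measurable fun ξ : E N => ∫⁻ z, ‖Γ z‖ₑ * ‖f (x.1 • (ξ - x.2 • z))‖ₑ := by
    have hkernel : Measurable fun y : E N × E N => ‖Γ y.2‖ₑ :=
      (hΓ.continuous.comp continuous_snd).enorm.measurable
    have hfun : Measurable fun y : E N × E N => ‖f (x.1 • (y.1 - x.2 • y.2))‖ₑ :=
      (hf.comp_measurable (by fun_prop)).enorm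
    exact (hkernel.mul hfun).lintegral_prod_right'
  have hfin := ae_lt_top (μ := weightMeasure N m) (hmeas.pow_const (2 : ℝ))
    (((ENNReal.rpow_lt_top_iff_of_pos one_half_pos).1 hlt).ne)
  filter_upwards [hfin] with ξ hξ
  exact ⟨((hΓ.stronglyMeasurable_uncurry x.1 x.2 hf).comp_measurable
    measurable_prodMk_left).aestronglyMeasurable, (lintegral_mono fun z =>
      (Γ z).le_opENorm _).trans_lt ((ENNReal.rpow_lt_top_iff_of_pos two_pos).1 hξ)⟩

/-- `T` acts on `L^p(μ)` as the rescaled convolution. The representative `g` is arbitrary because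
`rescaledConv` is defined on functions, not on a.e. classes. -/
def ActsAsRescaledConv {p : ℝ≥0∞} [Fact (1 ≤ p)] (Γ : E N → V →L[ℝ] V') (b c : ℝ)
    (T : Lp V p (weightMeasure N m) →L[ℝ] Lp V' 2 (weightMeasure N m)) : Prop :=
  ∀ (f : Lp V p (weightMeasure N m)) (g : E N → V),
    f =ᵐ[weightMeasure N m] g → T f =ᵐ[weightMeasure N m] rescaledConv Γ b c g

theorem IsGaussianKernel.exists_operator_of_mem (hm : 0 < m) (hΓ : IsGaussianKernel Γ A)
    (hs : 0 ≤ s) (hs2 : s ≤ 1 / 2) {p : ℝ≥0∞} [Fact (1 ≤ p)]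
    (hp : p = ENNReal.ofReal (1 / (1 / 2 + s))) {x : ℝ × ℝ} (hx : x ∈ convParams s) {K : ℝ}
    (hK : 0 ≤ K)
    (hbound : ∀ f : E N → V, StronglyMeasurable f →
      eLpNorm (rescaledConv Γ x.1 x.2 f) 2 (weightMeasure N m) ≤
        ENNReal.ofReal K * eLpNorm f p (weightMeasure N m)) :
    ∃ T : Lp V p (weightMeasure N m) →L[ℝ] Lp V' 2 (weightMeasure N m),
      ‖T‖ ≤ K ∧ ActsAsRescaledConv Γ x.1 x.2 T := by
  have hac := weightMeasure_absolutelyContinuous N m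
  have hb : x.1 ≠ 0 := (one_pos.trans_le hx.1).ne'
  have hcongr : ∀ f g : E N → V, f =ᵐ[weightMeasure N m] g →
      rescaledConv Γ x.1 x.2 f =ᵐ[weightMeasure N m] rescaledConv Γ x.1 x.2 g := fun f g hfg =>
    hac.ae_le (rescaledConv_congr_ae hb x.2 (ae_volume_of_ae_weight hfg))
  have hint := fun f : Lp V p (weightMeasure N m) =>
    hΓ.ae_integrable hm hs hs2 hx (Lp.stronglyMeasurable f) (hp ▸ Lp.memLp f)
  have hmem : ∀ f : Lp V p (weightMeasure N m),
      MemLp (rescaledConv Γ x.1 x.2 f) 2 (weightMeasure N m) := fun f =>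
    ⟨(hΓ.stronglyMeasurable_rescaledConv _ _ (Lp.stronglyMeasurable f)).aestronglyMeasurable,
      (hbound f (Lp.stronglyMeasurable f)).trans_lt
        (ENNReal.mul_lt_top ENNReal.ofReal_lt_top (Lp.eLpNorm_lt_top f))⟩
  let T₀ : Lp V p (weightMeasure N m) →ₗ[ℝ] Lp V' 2 (weightMeasure N m) :=
    { toFun := fun f => (hmem f).toLp
      map_add' := fun f g => by
        rw [← MemLp.toLp_add, MemLp.toLp_eq_toLp_iff]
        refine (hcongr _ _ (Lp.coeFn_add f g)).trans ?_
        filter_upwards [hint f, hint g] with ξ hfξ hgξ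
        exact rescaledConv_add hfξ hgξ
      map_smul' := fun k f => by
        rw [RingHom.id_apply, ← MemLp.toLp_const_smul, MemLp.toLp_eq_toLp_iff,
          ← rescaledConv_smul]
        exact hcongr _ _ (Lp.coeFn_smul k f) }
  refine ⟨T₀.mkContinuous K fun f => ?_, LinearMap.mkContinuous_norm_le _ hK _, fun f g hfg =>
    (MemLp.coeFn_toLp (hmem f)).trans (hcongr f g hfg)⟩
  change ‖(hmem f).toLp‖ ≤ _
  rw [Lp.norm_toLp, Lp.norm_def, ← ENNReal.toReal_ofReal hK, ← ENNReal.toReal_mul]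
  exact ENNReal.toReal_mono (ENNReal.mul_ne_top ENNReal.ofReal_ne_top (Lp.eLpNorm_ne_top f))
    (hbound f (Lp.stronglyMeasurable f))

theorem IsGaussianKernel.exists_operator (hm : 0 < m) (hΓ : IsGaussianKernel Γ A) (hs : 0 ≤ s)
    (hs2 : s ≤ 1 / 2) {p : ℝ≥0∞} [Fact (1 ≤ p)] (hp : p = ENNReal.ofReal (1 / (1 / 2 + s))) :
    ∃ C : ℝ, 0 ≤ C ∧ ∃ Op : ℝ × ℝ → Lp V p (weightMeasure N m) →L[ℝ] Lp V' 2 (weightMeasure N m),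
      ∀ x ∈ convParams s, ‖Op x‖ ≤ C * x.2 ^ (-(N * s)) ∧
        ActsAsRescaledConv Γ x.1 x.2 (Op x) := by
  obtain ⟨C, hC, hbound⟩ := hΓ.exists_eLpNorm_rescaledConv_le hm hs hs2
  have hOp : ∀ x ∈ convParams s,
      ∃ T : Lp V p (weightMeasure N m) →L[ℝ] Lp V' 2 (weightMeasure N m),
        ‖T‖ ≤ C * x.2 ^ (-(N * s)) ∧ ActsAsRescaledConv Γ x.1 x.2 T := fun x hx =>
    hΓ.exists_operator_of_mem hm hs hs2 hp hx (mul_nonneg hC (Real.rpow_nonneg hx.2.1 _))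
      (hp ▸ hbound x hx)
  choose! Op hOp using hOp
  exact ⟨C, hC, Op, hOp⟩

end ConvOperator

/-! ### Strong continuity -/

section StrongContinuity

theorem continuousOn_apply_of_dense {X Y P : Type*} [NormedAddCommGroup X] [NormedSpace ℝ X]
    [NormedAddCommGroup Y] [NormedSpace ℝ Y] [TopologicalSpace P] {Op : P → Y →L[ℝ] X} {D : Set P}
    {K : P → ℝ} (hK : ContinuousOn K D) (hOp : ∀ x ∈ D, ‖Op x‖ ≤ K x) {S : Set Y} (hS : Dense S)
    (hcont : ∀ y ∈ S, ContinuousOn (fun x => Op x y) D) (y : Y) :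
    ContinuousOn (fun x => Op x y) D := by
  intro x₀ hx₀
  have hK0 : 0 ≤ K x₀ := (norm_nonneg _).trans (hOp x₀ hx₀)
  rw [ContinuousWithinAt, Metric.tendsto_nhds]
  intro ε hε
  obtain ⟨y', hy', hdist⟩ := hS.exists_dist_lt y (ε := ε / (3 * (K x₀ + 1))) (by positivity)
  rw [dist_eq_norm, lt_div_iff₀ (by positivity)] at hdist
  have hy'_near := (Metric.tendsto_nhds.1 (hcont y' hy' x₀ hx₀)) (ε / 3) (by positivity)
  have hK_near : ∀ᶠ x in 𝓝[D] x₀, K x < K x₀ + 1 :=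
    (hK x₀ hx₀).eventually (gt_mem_nhds (by linarith))
  filter_upwards [hy'_near, hK_near, self_mem_nhdsWithin] with x hx_y' hx_K hx
  have happly : ∀ x' ∈ D, K x' ≤ K x₀ + 1 → ‖Op x' (y - y')‖ ≤ (K x₀ + 1) * ‖y - y'‖ :=
    fun x' hx' hKx' => (Op x').le_of_opNorm_le ((hOp x' hx').trans hKx') _
  have hsplit : Op x y - Op x₀ y = Op x (y - y') + (Op x y' - Op x₀ y') - Op x₀ (y - y') := by
    simp only [map_sub]
    abel
  rw [dist_eq_norm] at hx_y' ⊢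
  calc ‖Op x y - Op x₀ y‖
      ≤ ‖Op x (y - y')‖ + ‖Op x y' - Op x₀ y'‖ + ‖Op x₀ (y - y')‖ := by
        rw [hsplit]
        exact (norm_sub_le _ _).trans (by gcongr; exact norm_add_le _ _)
    _ < ε := by linarith [happly x hx hx_K.le, happly x₀ hx₀ (by linarith)]

variable {N : ℕ} {m : ℝ} {V V' : Type*} [NormedAddCommGroup V] [NormedSpace ℝ V]
  [NormedAddCommGroup V'] [NormedSpace ℝ V'] {Γ : E N → V →L[ℝ] V'} {A s : ℝ}

theorem IsGaussianKernel.continuous_rescaledConv (hΓ : IsGaussianKernel Γ A) {g : E N → V}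
    (hg : Continuous g) {B : ℝ} (hB : ∀ x, ‖g x‖ ≤ B) (ξ : E N) :
    Continuous fun x : ℝ × ℝ => rescaledConv Γ x.1 x.2 g ξ := by
  have hA := hΓ.nonneg
  refine continuous_of_dominated (bound := fun z => A * Real.exp (-(1 / 8) * ‖z‖ ^ 2) * B)
    (fun x => ?_) (fun x => .of_forall fun z => ?_) ?_ (.of_forall fun z => ?_)
  · exact (hΓ.continuous.clm_apply (by fun_prop)).aestronglyMeasurable
  · exact ((Γ z).le_opNorm _).trans (by gcongr; exacts [hΓ.bound z, hB _])
  · exact ((integrable_exp_neg_mul_sq (by norm_num)).const_mul _).mul_const _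
  · fun_prop

theorem norm_sq_le_of_norm_rescaled_le {b c R : ℝ} (hb : 1 ≤ b) (hc : 0 ≤ c) (hc1 : c ≤ 1)
    {ξ z : E N} (hR : ‖b • (ξ - c • z)‖ ≤ R) : ‖ξ‖ ^ 2 ≤ 2 * R ^ 2 + 2 * ‖z‖ ^ 2 := by
  have hsub : ‖ξ - c • z‖ ≤ R := by
    refine le_trans ?_ hR
    rw [norm_smul, Real.norm_of_nonneg (zero_le_one.trans hb)]
    exact le_mul_of_one_le_left (norm_nonneg _) hb
  have hcz : ‖c • z‖ ≤ ‖z‖ := by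
    rw [norm_smul, Real.norm_of_nonneg hc]
    exact mul_le_of_le_one_left (norm_nonneg _) hc1
  have hξ : ‖ξ‖ ≤ R + ‖z‖ := by
    calc ‖ξ‖ = ‖(ξ - c • z) + c • z‖ := by rw [sub_add_cancel]
      _ ≤ R + ‖z‖ := (norm_add_le _ _).trans (add_le_add hsub hcz)
  nlinarith [norm_nonneg ξ, norm_nonneg z, sq_nonneg (R - ‖z‖)]

theorem IsGaussianKernel.exists_norm_rescaledConv_le (hΓ : IsGaussianKernel Γ A) {g : E N → V}
    (hg : HasCompactSupport g) {B : ℝ} (hB : ∀ x, ‖g x‖ ≤ B) :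
    ∃ C : ℝ, 0 ≤ C ∧ ∀ b c : ℝ, 1 ≤ b → 0 ≤ c → c ≤ 1 → ∀ ξ,
      ‖rescaledConv Γ b c g ξ‖ ≤ C * Real.exp (-(1 / 32) * ‖ξ‖ ^ 2) := by
  have hA := hΓ.nonneg
  have hB0 : 0 ≤ B := (norm_nonneg _).trans (hB 0)
  obtain ⟨R, hR⟩ := hg.isCompact.isBounded.exists_norm_le
  have hint : Integrable fun z : E N => A * Real.exp (R ^ 2 / 16) * B *
      Real.exp (-(1 / 16) * ‖z‖ ^ 2) :=
    (integrable_exp_neg_mul_sq (by norm_num)).const_mul _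
  refine ⟨∫ z : E N, A * Real.exp (R ^ 2 / 16) * B * Real.exp (-(1 / 16) * ‖z‖ ^ 2),
    integral_nonneg fun z => by positivity, fun b c hb hc hc1 ξ => ?_⟩
  rw [rescaledConv, ← integral_mul_const]
  refine norm_integral_le_of_norm_le (hint.mul_const _) (.of_forall fun z => ?_)
  by_cases hgz : g (b • (ξ - c • z)) = 0
  · rw [hgz, map_zero, norm_zero]
    positivity
  have hsq := norm_sq_le_of_norm_rescaled_le hb hc hc1 (hR _ (subset_tsupport _ hgz))
  calc ‖Γ z (g (b • (ξ - c • z)))‖ ≤ A * Real.exp (-(1 / 8) * ‖z‖ ^ 2) * B :=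
        ((Γ z).le_opNorm _).trans (by gcongr; exacts [hΓ.bound z, hB _])
    _ ≤ A * (Real.exp (R ^ 2 / 16) * Real.exp (-(1 / 16) * ‖z‖ ^ 2) *
        Real.exp (-(1 / 32) * ‖ξ‖ ^ 2)) * B := by
        gcongr
        rw [← Real.exp_add, ← Real.exp_add, Real.exp_le_exp]
        linarith
    _ = _ := by ring

theorem lintegral_exp_neg_sq_weightMeasure_ne_top (hm : 0 < m) {K a : ℝ} (hK : 0 ≤ K)
    (ha : 0 < a) : ∫⁻ ξ : E N, ENNReal.ofReal (K * Real.exp (-a * ‖ξ‖ ^ 2)) ^ (2 : ℝ)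
      ∂(weightMeasure N m) ≠ ⊤ := by
  obtain ⟨C, -, hwt⟩ := exists_wt_le_exp (N := N) hm ha
  have hint : Integrable fun ξ : E N => C * K ^ 2 * Real.exp (-a * ‖ξ‖ ^ 2) :=
    (integrable_exp_neg_mul_sq ha).const_mul _
  rw [lintegral_weightMeasure]
  refine ne_top_of_le_ne_top hint.lintegral_lt_top.ne (lintegral_mono fun ξ => ?_)
  rw [ENNReal.ofReal_rpow_of_nonneg (by positivity) zero_le_two,
    ← ENNReal.ofReal_mul (wt_pos m ξ).le, Real.rpow_two]
  refine ENNReal.ofReal_le_ofReal ?_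
  calc wt m ξ * (K * Real.exp (-a * ‖ξ‖ ^ 2)) ^ 2
      ≤ C * Real.exp (a * ‖ξ‖ ^ 2) * (K * Real.exp (-a * ‖ξ‖ ^ 2)) ^ 2 := by
        gcongr
        exact hwt ξ
    _ = C * K ^ 2 * Real.exp (-a * ‖ξ‖ ^ 2) *
        (Real.exp (a * ‖ξ‖ ^ 2) * Real.exp (-a * ‖ξ‖ ^ 2)) := by ring
    _ = C * K ^ 2 * Real.exp (-a * ‖ξ‖ ^ 2) := by
        rw [← Real.exp_add, ← add_mul, add_neg_cancel, zero_mul, Real.exp_zero, mul_one]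

theorem IsGaussianKernel.tendsto_lintegral_rescaledConv_sub (hm : 0 < m)
    (hΓ : IsGaussianKernel Γ A) {g : E N → V} (hg : Continuous g) (hgc : HasCompactSupport g)
    {x₀ : ℝ × ℝ} (hx₀ : x₀ ∈ convParams s) :
    Tendsto (fun x : ℝ × ℝ => ∫⁻ ξ, ‖rescaledConv Γ x.1 x.2 g ξ -
      rescaledConv Γ x₀.1 x₀.2 g ξ‖ₑ ^ (2 : ℝ) ∂(weightMeasure N m))
      (𝓝[convParams s] x₀) (𝓝 0) := by
  obtain ⟨B, hB⟩ := hg.bounded_above_of_compact_support hgc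
  obtain ⟨C, hC, hbound⟩ := hΓ.exists_norm_rescaledConv_le hgc hB
  have hmeas := fun x : ℝ × ℝ => hΓ.stronglyMeasurable_rescaledConv x.1 x.2 hg.stronglyMeasurable
  rw [← lintegral_zero (μ := weightMeasure N m)]
  refine tendsto_lintegral_filter_of_dominated_convergence
    (fun ξ => ENNReal.ofReal (2 * C * Real.exp (-(1 / 32) * ‖ξ‖ ^ 2)) ^ (2 : ℝ))
    (.of_forall fun x => ((hmeas x).sub (hmeas x₀)).enorm.pow_const _) ?_
    (lintegral_exp_neg_sq_weightMeasure_ne_top hm (by positivity) (by norm_num))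
    (.of_forall fun ξ => ?_)
  · filter_upwards [self_mem_nhdsWithin] with x hx
    refine .of_forall fun ξ => ?_
    gcongr
    rw [← ofReal_norm]
    refine ENNReal.ofReal_le_ofReal ((norm_sub_le _ _).trans ?_)
    linarith [hbound x.1 x.2 hx.1 hx.2.1 hx.2.2.1 ξ,
      hbound x₀.1 x₀.2 hx₀.1 hx₀.2.1 hx₀.2.2.1 ξ]
  · have hcont : Continuous fun x : ℝ × ℝ =>
        ‖rescaledConv Γ x.1 x.2 g ξ - rescaledConv Γ x₀.1 x₀.2 g ξ‖ₑ ^ (2 : ℝ) :=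
      ENNReal.continuous_rpow_const.comp
        ((hΓ.continuous_rescaledConv hg hB ξ).sub continuous_const).enorm
    refine (hcont.tendsto' x₀ 0 ?_).mono_left nhdsWithin_le_nhds
    rw [sub_self, enorm_zero, ENNReal.zero_rpow_of_pos two_pos]

theorem dense_hasCompactSupport_Lp (hm : 0 < m) {p : ℝ≥0∞} [Fact (1 ≤ p)] (hp : p ≠ ⊤) :
    Dense {f : Lp V p (weightMeasure N m) | ∃ g : E N → V, Continuous g ∧ HasCompactSupport g ∧
      f =ᵐ[weightMeasure N m] g} := by
  have : IsLocallyFiniteMeasure (weightMeasure N m) :=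
    IsLocallyFiniteMeasure.withDensity_ofReal (continuous_wt hm)
  rw [Metric.dense_iff]
  intro f ε hε
  obtain ⟨g, hgc, hdist, hg, hgp⟩ := (Lp.memLp f).exists_hasCompactSupport_eLpNorm_sub_le hp
    (ε := ENNReal.ofReal (ε / 2)) (ENNReal.ofReal_pos.2 (half_pos hε)).ne'
  refine ⟨hgp.toLp, ?_, g, hg, hgc, hgp.coeFn_toLp⟩
  rw [Metric.mem_ball, dist_comm, Lp.dist_def, eLpNorm_congr_ae
    ((EventuallyEq.refl _ _).sub hgp.coeFn_toLp)]
  calc _ ≤ (ENNReal.ofReal (ε / 2)).toReal := ENNReal.toReal_mono ENNReal.ofReal_ne_top hdist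
    _ = ε / 2 := ENNReal.toReal_ofReal (half_pos hε).le
    _ < ε := half_lt_self hε

theorem continuousOn_convParams (C a s : ℝ) :
    ContinuousOn (fun x : ℝ × ℝ => C * x.2 ^ (-(a * s))) (convParams s) := by
  rintro x ⟨-, -, -, hpos | rfl⟩
  · have hrpow : ContinuousAt (fun x : ℝ × ℝ => x.2 ^ (-(a * s))) x :=
      continuousAt_snd.rpow_const (Or.inl hpos.ne')
    exact (continuousAt_const.mul hrpow).continuousWithinAt
  · simp only [mul_zero, neg_zero, Real.rpow_zero]
    exact continuousWithinAt_const

theorem IsGaussianKernel.continuousOn_operator (hm : 0 < m) (hΓ : IsGaussianKernel Γ A)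
    {p : ℝ≥0∞} [Fact (1 ≤ p)] (hp : p ≠ ⊤) {C : ℝ}
    {Op : ℝ × ℝ → Lp V p (weightMeasure N m) →L[ℝ] Lp V' 2 (weightMeasure N m)}
    (hOp : ∀ x ∈ convParams s, ‖Op x‖ ≤ C * x.2 ^ (-(N * s)) ∧
      ActsAsRescaledConv Γ x.1 x.2 (Op x))
    (f : Lp V p (weightMeasure N m)) :
    ContinuousOn (fun x => Op x f) (convParams s) := by
  refine continuousOn_apply_of_dense (continuousOn_convParams C N s)
    (fun x hx => (hOp x hx).1) (dense_hasCompactSupport_Lp hm hp) ?_ f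
  rintro f ⟨g, hg, hgc, hfg⟩ x₀ hx₀
  rw [ContinuousWithinAt, Lp.tendsto_Lp_iff_tendsto_eLpNorm']
  have hlim := (ENNReal.continuous_rpow_const (y := 1 / 2)).tendsto' 0 0
    (ENNReal.zero_rpow_of_pos one_half_pos) |>.comp
      (hΓ.tendsto_lintegral_rescaledConv_sub hm hg hgc hx₀)
  refine hlim.congr' ?_
  filter_upwards [self_mem_nhdsWithin] with x hx
  rw [eLpNorm_congr_ae (((hOp x hx).2 f g hfg).sub ((hOp x₀ hx₀).2 f g hfg)),
    eLpNorm_eq_lintegral_rpow_enorm_toReal two_ne_zero ENNReal.ofNat_ne_top]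
  simp only [Function.comp_apply, Pi.sub_apply, ENNReal.toReal_ofNat]

end StrongContinuity

section SobolevSpace

variable {N : ℕ} {m : ℝ}

theorem IsWeakGradient.congr_ae {v v' : E N → ℝ} {g g' : E N → E N} (h : IsWeakGradient v g)
    (hv : v =ᵐ[volume] v') (hg : g =ᵐ[volume] g') : IsWeakGradient v' g' := by
  intro ψ hψ hc e
  calc ∫ ξ, v' ξ * fderiv ℝ ψ ξ e = ∫ ξ, v ξ * fderiv ℝ ψ ξ e :=
        integral_congr_ae (hv.mono fun ξ hξ => by simp only [hξ])
    _ = -∫ ξ, inner ℝ (g ξ) e * ψ ξ := h ψ hψ hc e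
    _ = -∫ ξ, inner ℝ (g' ξ) e * ψ ξ :=
        congrArg Neg.neg (integral_congr_ae (hg.mono fun ξ hξ => by simp only [hξ]))

theorem IsWeakGradient.const_mul {v : E N → ℝ} {g : E N → E N} (h : IsWeakGradient v g) (k : ℝ) :
    IsWeakGradient (fun ξ => k * v ξ) (fun ξ => k • g ξ) := by
  intro ψ hψ hc e
  simp only [mul_assoc, real_inner_smul_left]
  rw [integral_const_mul, integral_const_mul, h ψ hψ hc e, mul_neg]

theorem IsWeakGradient.ae_unique {v : E N → ℝ} {g g' : E N → E N} (h : IsWeakGradient v g)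
    (h' : IsWeakGradient v g') (hg : LocallyIntegrable g) (hg' : LocallyIntegrable g') :
    g =ᵐ[volume] g' := by
  have hint : ∀ {k : E N → E N}, LocallyIntegrable k → ∀ {ψ : E N → ℝ}, ContDiff ℝ ∞ ψ →
      HasCompactSupport ψ → ∀ e : E N,
      inner ℝ e (∫ ξ, ψ ξ • k ξ) = ∫ ξ, inner ℝ (k ξ) e * ψ ξ := by
    intro k hk ψ hψ hc e
    rw [← integral_inner (hk.integrable_smul_left_of_hasCompactSupport hψ.continuous hc)]
    simp only [real_inner_smul_right, real_inner_comm, mul_comm]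
  refine ae_eq_of_integral_contDiff_smul_eq hg hg' fun ψ hψ hc =>
    ext_inner_left ℝ fun e => ?_
  rw [hint hg hψ hc, hint hg' hψ hc, ← neg_inj, ← h ψ hψ hc e, ← h' ψ hψ hc e]

/-- The inclusion of the weighted space `L²(μ)` into `L²`. Test functions are paired with elements
of `L²` without weight, so this is what makes weak gradients stable under limits in `L²(μ)`. -/
def toVolume (V : Type*) [NormedAddCommGroup V] [NormedSpace ℝ V] (N : ℕ) (m : ℝ) :
    Lp V 2 (weightMeasure N m) →L[ℝ] Lp V 2 (volume : Measure (E N)) :=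
  LinearMap.mkContinuous
    { toFun := fun f => ((Lp.memLp f).mono_measure (volume_le_weightMeasure N m)).toLp
      map_add' := fun f g => by
        rw [← MemLp.toLp_add, MemLp.toLp_eq_toLp_iff]
        exact ae_volume_of_ae_weight (Lp.coeFn_add f g)
      map_smul' := fun k f => by
        rw [RingHom.id_apply, ← MemLp.toLp_const_smul, MemLp.toLp_eq_toLp_iff]
        exact ae_volume_of_ae_weight (Lp.coeFn_smul k f) } 1 (fun f => by
    rw [one_mul, LinearMap.coe_mk, AddHom.coe_mk, Lp.norm_toLp, Lp.norm_def]
    exact ENNReal.toReal_mono (Lp.eLpNorm_ne_top f)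
      (eLpNorm_mono_measure _ (volume_le_weightMeasure N m)))

theorem coeFn_toVolume {V : Type*} [NormedAddCommGroup V] [NormedSpace ℝ V]
    (f : Lp V 2 (weightMeasure N m)) : toVolume V N m f =ᵐ[volume] f :=
  MemLp.coeFn_toLp ((Lp.memLp f).mono_measure (volume_le_weightMeasure N m))

theorem continuous_integral_inner {V : Type*} [NormedAddCommGroup V] [InnerProductSpace ℝ V]
    {φ : E N → V} (hφ : MemLp φ 2) :
    Continuous fun f : Lp V 2 (weightMeasure N m) => ∫ ξ, inner ℝ (φ ξ) (f ξ) := by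
  have hinner : ∀ f : Lp V 2 (weightMeasure N m),
      ∫ ξ, inner ℝ (φ ξ) (f ξ) = inner ℝ hφ.toLp (toVolume V N m f) := fun f => by
    rw [L2.inner_def]
    refine integral_congr_ae ?_
    filter_upwards [hφ.coeFn_toLp, coeFn_toVolume f] with ξ hφξ hfξ
    rw [hφξ, hfξ]
  simp only [hinner]
  exact continuous_const.inner (toVolume V N m).continuous

theorem isClosed_H1m (N : ℕ) (m : ℝ) : IsClosed (H1m N m :
    Set (WithLp 2 (Lp ℝ 2 (weightMeasure N m) × Lp (E N) 2 (weightMeasure N m)))) := by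
  have hset : (H1m N m :
      Set (WithLp 2 (Lp ℝ 2 (weightMeasure N m) × Lp (E N) 2 (weightMeasure N m)))) =
      ⋂ (ψ : E N → ℝ) (_ : ContDiff ℝ ∞ ψ) (_ : HasCompactSupport ψ) (e : E N),
        {u | ∫ ξ, inner ℝ (fderiv ℝ ψ ξ e) (u.fst ξ) = -∫ ξ, inner ℝ (ψ ξ • e) (u.snd ξ)} := by
    have hscalar : ∀ a b : ℝ, inner ℝ a b = b * a := fun a b => rfl
    have hvector : ∀ (t : ℝ) (e g : E N), inner ℝ (t • e) g = inner ℝ g e * t := fun t e g => by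
      rw [real_inner_smul_left, real_inner_comm, mul_comm]
    ext u
    simp only [mem_iInter, hscalar, hvector]
    rfl
  rw [hset]
  refine isClosed_iInter fun ψ => isClosed_iInter fun hψ => isClosed_iInter fun hc =>
    isClosed_iInter fun e => ?_
  have hderiv : MemLp (fun ξ => fderiv ℝ ψ ξ e) 2 :=
    ((hψ.continuous_fderiv (by simp)).clm_apply continuous_const).memLp_of_hasCompactSupport
      (hc.fderiv_apply (𝕜 := ℝ) e)
  have hsmul : MemLp (fun ξ => ψ ξ • e) 2 :=
    (hψ.continuous.smul continuous_const).memLp_of_hasCompactSupport hc.smul_right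
  exact isClosed_eq
    ((continuous_integral_inner hderiv).comp (WithLp.prod_continuous_ofLp 2 _ _).fst)
    ((continuous_integral_inner hsmul).comp (WithLp.prod_continuous_ofLp 2 _ _).snd).neg

instance : CompleteSpace (H1m N m) := (isClosed_H1m N m).completeSpace_coe

theorem Represents.unique {u u' : H1m N m} {f : E N → ℝ} (h : Represents u f)
    (h' : Represents u' f) : u = u' := by
  have hfst : fn u =ᵐ[volume] fn u' := EventuallyEq.trans h (EventuallyEq.symm h')
  have hloc : ∀ w : H1m N m, LocallyIntegrable (grad w) := fun w =>
    ((Lp.memLp w.1.snd).mono_measure (volume_le_weightMeasure N m)).locallyIntegrable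
      one_le_two
  have hsnd : grad u =ᵐ[volume] grad u' :=
    (IsWeakGradient.congr_ae u.2 hfst .rfl).ae_unique u'.2 (hloc u) (hloc u')
  have hac := weightMeasure_absolutelyContinuous N m
  exact Subtype.ext (WithLp.ofLp_injective 2
    (Prod.ext (Lp.ext (hac.ae_le hfst)) (Lp.ext (hac.ae_le hsnd))))

end SobolevSpace

section Fubini

variable {N : ℕ} {κ f φ : E N → ℝ} {b : ℝ}

theorem le_one_add_rpow {p : ℝ} (hp : 1 ≤ p) (x : ℝ≥0∞) : x ≤ 1 + x ^ p := by
  rcases le_total x 1 with hx | hx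
  · exact hx.trans le_self_add
  · calc x = x ^ (1 : ℝ) := (ENNReal.rpow_one x).symm
      _ ≤ x ^ p := ENNReal.rpow_le_rpow_of_exponent_le hx hp
      _ ≤ 1 + x ^ p := le_add_self

theorem lintegral_enorm_mul_le {p B : ℝ} (hp : 1 ≤ p) (hb : 0 < b) (hf : Measurable f)
    (hφ : Measurable φ) (hB : ∀ x, ‖φ x‖ ≤ B) (y z : E N) :
    ∫⁻ x, ‖f (b • (x + y)) * φ (x + z)‖ₑ ≤ (∫⁻ x, ‖φ x‖ₑ) +
      ENNReal.ofReal (b ^ (-(N : ℝ))) * (∫⁻ x, ‖f x‖ₑ ^ p) * ENNReal.ofReal B := by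
  have hφz : Measurable fun x => ‖φ (x + z)‖ₑ := (hφ.comp (measurable_add_const z)).enorm
  calc ∫⁻ x, ‖f (b • (x + y)) * φ (x + z)‖ₑ
      ≤ ∫⁻ x, (‖φ (x + z)‖ₑ + ‖f (b • (x + y))‖ₑ ^ p * ENNReal.ofReal B) := by
        refine lintegral_mono fun x => ?_
        calc ‖f (b • (x + y)) * φ (x + z)‖ₑ
            ≤ (1 + ‖f (b • (x + y))‖ₑ ^ p) * ‖φ (x + z)‖ₑ := by
              rw [enorm_mul]
              gcongr
              exact le_one_add_rpow hp _
          _ = ‖φ (x + z)‖ₑ + ‖f (b • (x + y))‖ₑ ^ p * ‖φ (x + z)‖ₑ := by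
              rw [add_mul, one_mul]
          _ ≤ ‖φ (x + z)‖ₑ + ‖f (b • (x + y))‖ₑ ^ p * ENNReal.ofReal B := by
              gcongr
              rw [← ofReal_norm]
              exact ENNReal.ofReal_le_ofReal (hB _)
    _ = (∫⁻ x, ‖φ x‖ₑ) +
        ENNReal.ofReal (b ^ (-(N : ℝ))) * (∫⁻ x, ‖f x‖ₑ ^ p) * ENNReal.ofReal B := by
        rw [lintegral_add_left hφz, lintegral_mul_const' _ _ ENNReal.ofReal_ne_top,
          lintegral_add_right_eq_self (fun x => ‖φ x‖ₑ) z,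
          lintegral_add_right_eq_self (fun x => ‖f (b • x)‖ₑ ^ p) y,
          lintegral_comp_smul hb (f := fun x => ‖f x‖ₑ ^ p) (hf.enorm.pow_const _)]

theorem integrable_prod_mul_mul {p : ℝ≥0∞} (hp : 1 ≤ p) (hp' : p ≠ ⊤) (hb : 0 < b)
    (hκ : Integrable κ) (hκc : Continuous κ) (hf : StronglyMeasurable f) (hfp : MemLp f p)
    (hφ : Continuous φ) (hφc : HasCompactSupport φ) (α β : ℝ) :
    Integrable (fun x : E N × E N => κ x.2 * (f (b • (x.1 + α • x.2)) * φ (x.1 + β • x.2)))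
      (volume.prod volume) := by
  obtain ⟨B, hB⟩ := hφ.bounded_above_of_compact_support hφc
  have hf_meas : StronglyMeasurable fun x : E N × E N => f (b • (x.1 + α • x.2)) :=
    hf.comp_measurable (by fun_prop)
  have hφ_cont : Continuous fun x : E N × E N => φ (x.1 + β • x.2) := by fun_prop
  have hmeas : StronglyMeasurable fun x : E N × E N =>
      κ x.2 * (f (b • (x.1 + α • x.2)) * φ (x.1 + β • x.2)) :=
    (hκc.comp continuous_snd).stronglyMeasurable.mul (hf_meas.mul hφ_cont.stronglyMeasurable)
  refine ⟨hmeas.aestronglyMeasurable, ?_⟩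
  rw [HasFiniteIntegral, lintegral_prod_symm _ hmeas.enorm.aemeasurable]
  set M : ℝ≥0∞ := (∫⁻ x, ‖φ x‖ₑ) +
    ENNReal.ofReal (b ^ (-(N : ℝ))) * (∫⁻ x, ‖f x‖ₑ ^ p.toReal) * ENNReal.ofReal B
  have hp_real : 1 ≤ p.toReal := by
    simpa only [ENNReal.toReal_one] using ENNReal.toReal_mono hp' hp
  have hf_fin : ∫⁻ x, ‖f x‖ₑ ^ p.toReal < ⊤ :=
    lintegral_rpow_enorm_lt_top_of_eLpNorm_lt_top (one_pos.trans_le hp).ne' hp' hfp.2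
  have hM_lt : M < ⊤ := ENNReal.add_lt_top.2 ⟨(hφ.integrable_of_hasCompactSupport hφc).2,
    ENNReal.mul_lt_top (ENNReal.mul_lt_top ENNReal.ofReal_lt_top hf_fin)
      ENNReal.ofReal_lt_top⟩
  calc ∫⁻ z, ∫⁻ x, ‖κ z * (f (b • (x + α • z)) * φ (x + β • z))‖ₑ ≤ ∫⁻ z, ‖κ z‖ₑ * M := by
        refine lintegral_mono fun z => ?_
        simp only [enorm_mul (κ z)]
        rw [lintegral_const_mul' _ _ enorm_ne_top]
        gcongr
        exact lintegral_enorm_mul_le hp_real hb hf.measurable hφ.measurable hB _ _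
    _ = (∫⁻ z, ‖κ z‖ₑ) * M := lintegral_mul_const' _ _ hM_lt.ne
    _ < ⊤ := ENNReal.mul_lt_top hκ.2 hM_lt

theorem integral_conv_mul_eq {p : ℝ≥0∞} (hp : 1 ≤ p) (hp' : p ≠ ⊤) (hb : 0 < b)
    (hκ : Integrable κ) (hκc : Continuous κ) (hf : StronglyMeasurable f) (hfp : MemLp f p)
    (hφ : Continuous φ) (hφc : HasCompactSupport φ) (c : ℝ) :
    ∫ ξ, (∫ z, κ z * f (b • (ξ - c • z))) * φ ξ = ∫ z, κ z * ∫ x, f (b • x) * φ (x + c • z) := by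
  have hint := integrable_prod_mul_mul hp hp' hb hκ hκc hf hfp hφ hφc (-c) 0
  simp only [zero_smul, add_zero, neg_smul, ← sub_eq_add_neg] at hint
  calc ∫ ξ, (∫ z, κ z * f (b • (ξ - c • z))) * φ ξ
      = ∫ ξ, ∫ z, κ z * (f (b • (ξ - c • z)) * φ ξ) := by
        simp only [← integral_mul_const, mul_assoc]
    _ = ∫ z, ∫ ξ, κ z * (f (b • (ξ - c • z)) * φ ξ) := integral_integral_swap hint
    _ = ∫ z, κ z * ∫ x, f (b • x) * φ (x + c • z) := by
        refine integral_congr_ae (.of_forall fun z => ?_)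
        beta_reduce
        rw [integral_const_mul,
          ← integral_add_right_eq_self (fun ξ => f (b • (ξ - c • z)) * φ ξ) (c • z)]
        simp only [add_sub_cancel_right]

theorem integral_conv_mul_eq_swap {p : ℝ≥0∞} (hp : 1 ≤ p) (hp' : p ≠ ⊤) (hb : 0 < b)
    (hκ : Integrable κ) (hκc : Continuous κ) (hf : StronglyMeasurable f) (hfp : MemLp f p)
    (hφ : Continuous φ) (hφc : HasCompactSupport φ) (c : ℝ) :
    ∫ ξ, (∫ z, κ z * f (b • (ξ - c • z))) * φ ξ = ∫ x, f (b • x) * ∫ z, κ z * φ (x + c • z) := by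
  have hint := integrable_prod_mul_mul hp hp' hb hκ hκc hf hfp hφ hφc 0 c
  simp only [zero_smul, add_zero] at hint
  calc ∫ ξ, (∫ z, κ z * f (b • (ξ - c • z))) * φ ξ
      = ∫ z, κ z * ∫ x, f (b • x) * φ (x + c • z) :=
        integral_conv_mul_eq hp hp' hb hκ hκc hf hfp hφ hφc c
    _ = ∫ z, ∫ x, κ z * (f (b • x) * φ (x + c • z)) := by simp only [integral_const_mul]
    _ = ∫ x, ∫ z, κ z * (f (b • x) * φ (x + c • z)) := (integral_integral_swap hint).symm
    _ = ∫ x, f (b • x) * ∫ z, κ z * φ (x + c • z) := by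
        simp only [mul_left_comm (κ _), integral_const_mul]

end Fubini

section Gaussian

variable {N : ℕ}

/-- The Gaussian `(4π)^{-N/2} e^{-|z|²/4}`, the heat kernel at time `1`. -/
def gauss (z : E N) : ℝ := (4 * Real.pi) ^ (-(N : ℝ) / 2) * Real.exp (-(1 / 4) * ‖z‖ ^ 2)

/-- The gradient of `gauss`. -/
def gaussGrad (z : E N) : E N := (-(1 / 2) * gauss z) • z

theorem gauss_pos (z : E N) : 0 < gauss z := by
  have := Real.pi_pos
  unfold gauss
  positivity

theorem contDiff_gauss : ContDiff ℝ ∞ (gauss : E N → ℝ) := by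
  unfold gauss
  exact contDiff_const.mul (contDiff_const.mul (contDiff_norm_sq ℝ)).exp

theorem continuous_gauss : Continuous (gauss : E N → ℝ) := contDiff_gauss.continuous

theorem continuous_gaussGrad : Continuous (gaussGrad : E N → E N) := by
  have hgauss := continuous_gauss (N := N)
  unfold gaussGrad
  fun_prop

theorem integrable_gauss : Integrable (gauss : E N → ℝ) :=
  (integrable_exp_neg_mul_sq (by norm_num)).const_mul _

theorem integral_gauss : ∫ z : E N, gauss z = 1 := by
  have := Real.pi_pos
  simp only [gauss]
  rw [integral_const_mul, GaussianFourier.integral_rexp_neg_mul_sq_norm (by norm_num),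
    finrank_euclideanSpace, Fintype.card_fin, show Real.pi / (1 / 4) = 4 * Real.pi by ring,
    ← Real.rpow_add (by positivity), ← add_div, neg_add_cancel, zero_div, Real.rpow_zero]

theorem fderiv_gauss (z e : E N) : fderiv ℝ gauss z e = inner ℝ (gaussGrad z) e := by
  have hderiv : HasFDerivAt (gauss : E N → ℝ) ((4 * Real.pi) ^ (-(N : ℝ) / 2) •
      (Real.exp (-(1 / 4) * ‖z‖ ^ 2) • ((-(1 / 4) : ℝ) • (2 • innerSL ℝ z)))) z := by
    unfold gauss
    exact (((hasStrictFDerivAt_norm_sq z).hasFDerivAt.const_mul (-(1 / 4))).exp).const_mul _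
  rw [hderiv.fderiv, gaussGrad, real_inner_smul_left, gauss]
  simp
  ring

theorem norm_gauss_le (z : E N) :
    ‖gauss z‖ ≤ (4 * Real.pi) ^ (-(N : ℝ) / 2) * Real.exp (-(1 / 8) * ‖z‖ ^ 2) := by
  have := Real.pi_pos
  rw [Real.norm_of_nonneg (gauss_pos z).le, gauss]
  gcongr
  norm_num

theorem norm_gaussGrad_le (z : E N) :
    ‖gaussGrad z‖ ≤ 2 * (4 * Real.pi) ^ (-(N : ℝ) / 2) * Real.exp (-(1 / 8) * ‖z‖ ^ 2) := by
  have := Real.pi_pos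
  have hz : ‖z‖ ≤ 4 * Real.exp (1 / 8 * ‖z‖ ^ 2) := by
    have hexp := Real.add_one_le_exp (1 / 8 * ‖z‖ ^ 2)
    nlinarith [sq_nonneg (‖z‖ - 1)]
  have hexp : Real.exp (-(1 / 4) * ‖z‖ ^ 2) * Real.exp (1 / 8 * ‖z‖ ^ 2) =
      Real.exp (-(1 / 8) * ‖z‖ ^ 2) := by
    rw [← Real.exp_add, ← add_mul]
    norm_num
  calc ‖gaussGrad z‖
      = 1 / 2 * ((4 * Real.pi) ^ (-(N : ℝ) / 2) * Real.exp (-(1 / 4) * ‖z‖ ^ 2)) * ‖z‖ := by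
        rw [gaussGrad, norm_smul, norm_mul, Real.norm_of_nonneg (gauss_pos z).le, gauss]
        norm_num
    _ ≤ 1 / 2 * ((4 * Real.pi) ^ (-(N : ℝ) / 2) * Real.exp (-(1 / 4) * ‖z‖ ^ 2)) *
        (4 * Real.exp (1 / 8 * ‖z‖ ^ 2)) := by gcongr
    _ = 2 * (4 * Real.pi) ^ (-(N : ℝ) / 2) *
        (Real.exp (-(1 / 4) * ‖z‖ ^ 2) * Real.exp (1 / 8 * ‖z‖ ^ 2)) := by ring
    _ = 2 * (4 * Real.pi) ^ (-(N : ℝ) / 2) * Real.exp (-(1 / 8) * ‖z‖ ^ 2) := by rw [hexp]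

theorem integrable_inner_gaussGrad (e : E N) : Integrable fun z => inner ℝ (gaussGrad z) e :=
  (((integrable_exp_neg_mul_sq (by norm_num)).const_mul _).mono'
    continuous_gaussGrad.aestronglyMeasurable (.of_forall norm_gaussGrad_le)).inner_const e

theorem integral_gauss_mul_fderiv {φ : E N → ℝ} (hφ : ContDiff ℝ 1 φ)
    (hφc : HasCompactSupport φ) (e : E N) :
    ∫ z, gauss z * fderiv ℝ φ z e = -∫ z, inner ℝ (gaussGrad z) e * φ z := by
  have hderiv : Continuous fun z => fderiv ℝ φ z e :=
    (hφ.continuous_fderiv one_ne_zero).clm_apply continuous_const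
  have hinner : Continuous fun z : E N => inner ℝ (gaussGrad z) e :=
    continuous_gaussGrad.inner continuous_const
  simp only [← fderiv_gauss] at hinner ⊢
  exact integral_mul_fderiv_eq_neg_fderiv_mul_of_integrable
    ((hinner.mul hφ.continuous).integrable_of_hasCompactSupport hφc.mul_left)
    ((continuous_gauss.mul hderiv).integrable_of_hasCompactSupport
      (hφc.fderiv_apply (𝕜 := ℝ) e).mul_left)
    ((continuous_gauss.mul hφ.continuous).integrable_of_hasCompactSupport hφc.mul_left)
    (fun z _ => contDiff_gauss.differentiable (by simp) z)
    (fun z _ => hφ.differentiable one_ne_zero z)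

/-- The kernel `z ↦ gauss z • id`, acting on functions with values in `V`. -/
def gaussKer (N : ℕ) (V : Type*) [NormedAddCommGroup V] [NormedSpace ℝ V] (z : E N) : V →L[ℝ] V :=
  gauss z • ContinuousLinearMap.id ℝ V

/-- The kernel `z ↦ (r ↦ r • gaussGrad z)`, which turns a scalar function into the gradient of its
Gaussian convolution. -/
def gaussGradKer (N : ℕ) (z : E N) : ℝ →L[ℝ] E N :=
  ContinuousLinearMap.toSpanSingleton ℝ (gaussGrad z)

theorem isGaussianKernel_gaussKer (V : Type*) [NormedAddCommGroup V] [NormedSpace ℝ V] :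
    IsGaussianKernel (gaussKer N V) ((4 * Real.pi) ^ (-(N : ℝ) / 2)) where
  continuous := continuous_gauss.smul continuous_const
  bound z := by
    rw [gaussKer, norm_smul]
    exact (mul_le_of_le_one_right (norm_nonneg _) ContinuousLinearMap.norm_id_le).trans
      (norm_gauss_le z)

theorem isGaussianKernel_gaussGradKer :
    IsGaussianKernel (gaussGradKer N) (2 * (4 * Real.pi) ^ (-(N : ℝ) / 2)) where
  continuous :=
    (ContinuousLinearMap.toSpanSingletonCLE (𝕜 := ℝ) (E := E N)).continuous.comp
      continuous_gaussGrad
  bound z := by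
    rw [gaussGradKer, ContinuousLinearMap.norm_toSpanSingleton]
    exact norm_gaussGrad_le z

theorem rescaledConv_gaussKer_real (b c : ℝ) (f : E N → ℝ) (ξ : E N) :
    rescaledConv (gaussKer N ℝ) b c f ξ = ∫ z, gauss z * f (b • (ξ - c • z)) := rfl

theorem inner_rescaledConv_gaussKer {b c : ℝ} {g : E N → E N} {ξ : E N}
    (hint : Integrable fun z => gaussKer N (E N) z (g (b • (ξ - c • z)))) (e : E N) :
    inner ℝ (rescaledConv (gaussKer N (E N)) b c g ξ) e =
      ∫ z, gauss z * inner ℝ (g (b • (ξ - c • z))) e := by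
  rw [rescaledConv, real_inner_comm, ← integral_inner hint]
  refine integral_congr_ae (.of_forall fun z => ?_)
  simp only [gaussKer, FunLike.coe_smul, Pi.smul_apply, ContinuousLinearMap.id_apply,
    real_inner_smul_right, real_inner_comm]

theorem inner_rescaledConv_gaussGradKer {b c : ℝ} {f : E N → ℝ} {ξ : E N}
    (hint : Integrable fun z => gaussGradKer N z (f (b • (ξ - c • z)))) (e : E N) :
    inner ℝ (rescaledConv (gaussGradKer N) b c f ξ) e =
      ∫ z, inner ℝ (gaussGrad z) e * f (b • (ξ - c • z)) := by
  rw [rescaledConv, real_inner_comm, ← integral_inner hint]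
  refine integral_congr_ae (.of_forall fun z => ?_)
  simp only [gaussGradKer, ContinuousLinearMap.toSpanSingleton_apply, real_inner_smul_right]
  rw [real_inner_comm, mul_comm]

end Gaussian

section WeakGradientRescaledConv

variable {N : ℕ} {b c : ℝ}

theorem fderiv_comp_smul_add {ψ : E N → ℝ} (k : ℝ) (w z e : E N) :
    fderiv ℝ (fun y => ψ (k • y + w)) z e = k * fderiv ℝ ψ (k • z + w) e := by
  rw [fderiv_comp_smul (f := fun y => ψ (y + w)), fderiv_comp_add_right]
  rfl

theorem hasCompactSupport_comp_smul_add {ψ : E N → ℝ} (hψ : HasCompactSupport ψ) {k : ℝ}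
    (hk : k ≠ 0) (w : E N) : HasCompactSupport fun y => ψ (k • y + w) :=
  hψ.comp_homeomorph ((Homeomorph.smulOfNeZero k hk).trans (Homeomorph.addRight w))

theorem integral_gauss_mul_fderiv_comp {ψ : E N → ℝ} (hψ : ContDiff ℝ 1 ψ)
    (hψc : HasCompactSupport ψ) (hc : c ≠ 0) (x e : E N) :
    ∫ z, gauss z * fderiv ℝ ψ (x + c • z) e =
      -(c⁻¹ * ∫ z, inner ℝ (gaussGrad z) e * ψ (x + c • z)) := by
  have hparts := integral_gauss_mul_fderiv (φ := fun z => ψ (c • z + x)) (hψ.comp (by fun_prop))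
    (hasCompactSupport_comp_smul_add hψc hc x) e
  simp only [fderiv_comp_smul_add c x, mul_left_comm _ c, integral_const_mul] at hparts
  simp only [add_comm _ x] at hparts
  rw [← mul_neg, ← hparts, inv_mul_cancel_left₀ hc]

theorem isWeakGradient_rescaledConv {p : ℝ≥0∞} (hp : 1 ≤ p) (hp' : p ≠ ⊤) (hb : 0 < b)
    (hc : c ≠ 0) {f : E N → ℝ} (hf : StronglyMeasurable f) (hfp : MemLp f p)
    (hint : ∀ᵐ ξ : E N, Integrable fun z => gaussGradKer N z (f (b • (ξ - c • z)))) :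
    IsWeakGradient (rescaledConv (gaussKer N ℝ) b c f)
      (fun ξ => c⁻¹ • rescaledConv (gaussGradKer N) b c f ξ) := by
  intro ψ hψ hψc e
  have hψ_deriv : Continuous fun ξ => fderiv ℝ ψ ξ e :=
    (hψ.continuous_fderiv (by simp)).clm_apply continuous_const
  have hinner : Continuous fun z : E N => inner ℝ (gaussGrad z) e :=
    continuous_gaussGrad.inner continuous_const
  calc ∫ ξ, rescaledConv (gaussKer N ℝ) b c f ξ * fderiv ℝ ψ ξ e
      = ∫ x, f (b • x) * ∫ z, gauss z * fderiv ℝ ψ (x + c • z) e :=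
        integral_conv_mul_eq_swap hp hp' hb integrable_gauss continuous_gauss hf hfp hψ_deriv
          (hψc.fderiv_apply (𝕜 := ℝ) e) c
    _ = -(c⁻¹ * ∫ x, f (b • x) * ∫ z, inner ℝ (gaussGrad z) e * ψ (x + c • z)) := by
        simp only [integral_gauss_mul_fderiv_comp (hψ.of_le (by simp)) hψc hc, mul_neg,
          integral_neg, mul_left_comm _ c⁻¹, integral_const_mul]
    _ = -(c⁻¹ * ∫ ξ, (∫ z, inner ℝ (gaussGrad z) e * f (b • (ξ - c • z))) * ψ ξ) := by
        rw [integral_conv_mul_eq_swap hp hp' hb (integrable_inner_gaussGrad e) hinner hf hfp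
          hψ.continuous hψc]
    _ = -∫ ξ, inner ℝ (c⁻¹ • rescaledConv (gaussGradKer N) b c f ξ) e * ψ ξ := by
        rw [← integral_const_mul]
        refine congrArg Neg.neg (integral_congr_ae ?_)
        filter_upwards [hint] with ξ hξ
        rw [real_inner_smul_left, inner_rescaledConv_gaussGradKer hξ, mul_assoc]

theorem IsWeakGradient.comp_smul {v : E N → ℝ} {g : E N → E N} (h : IsWeakGradient v g)
    (hb : b ≠ 0) : IsWeakGradient (fun x => v (b • x)) (fun x => b • g (b • x)) := by
  intro ψ hψ hψc e
  have hweak := h (fun y => ψ (b⁻¹ • y + 0)) (hψ.comp (by fun_prop))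
    (hasCompactSupport_comp_smul_add hψc (inv_ne_zero hb) 0) e
  simp only [fderiv_comp_smul_add b⁻¹ 0, mul_left_comm _ b⁻¹, integral_const_mul] at hweak
  simp only [add_zero] at hweak
  have hv := Measure.integral_comp_smul volume (fun y => v y * fderiv ℝ ψ (b⁻¹ • y) e) b
  have hg := Measure.integral_comp_smul volume (fun y => inner ℝ (g y) e * ψ (b⁻¹ • y)) b
  simp only [inv_smul_smul₀ hb] at hv hg
  simp only [real_inner_smul_left, mul_assoc, integral_const_mul]
  rw [hv, hg, (inv_mul_eq_iff_eq_mul₀ hb).1 hweak, smul_eq_mul, smul_eq_mul]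
  ring

theorem IsWeakGradient.integral_mul_fderiv_add {v : E N → ℝ} {g : E N → E N}
    (h : IsWeakGradient v g) {ψ : E N → ℝ} (hψ : ContDiff ℝ ∞ ψ) (hψc : HasCompactSupport ψ)
    (w e : E N) :
    ∫ x, v x * fderiv ℝ ψ (x + w) e = -∫ x, inner ℝ (g x) e * ψ (x + w) := by
  simpa only [fderiv_comp_add_right] using h (fun x => ψ (x + w)) (hψ.comp (by fun_prop))
    (hψc.comp_homeomorph (Homeomorph.addRight w)) e

theorem IsWeakGradient.rescaledConv_gaussKer {v : E N → ℝ} {g : E N → E N}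
    (h : IsWeakGradient v g) (hb : 0 < b) (hv : StronglyMeasurable v) (hg : StronglyMeasurable g)
    (hv2 : MemLp v 2) (hg2 : MemLp g 2)
    (hint : ∀ᵐ ξ : E N, Integrable fun z => gaussKer N (E N) z (g (b • (ξ - c • z)))) :
    IsWeakGradient (rescaledConv (gaussKer N ℝ) b c v)
      (fun ξ => b • rescaledConv (gaussKer N (E N)) b c g ξ) := by
  intro ψ hψ hψc e
  have hψ_deriv : Continuous fun ξ => fderiv ℝ ψ ξ e :=
    (hψ.continuous_fderiv (by simp)).clm_apply continuous_const
  calc ∫ ξ, rescaledConv (gaussKer N ℝ) b c v ξ * fderiv ℝ ψ ξ e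
      = ∫ z, gauss z * ∫ x, v (b • x) * fderiv ℝ ψ (x + c • z) e :=
        integral_conv_mul_eq one_le_two ENNReal.ofNat_ne_top hb integrable_gauss continuous_gauss
          hv hv2 hψ_deriv (hψc.fderiv_apply (𝕜 := ℝ) e) c
    _ = -(b * ∫ z, gauss z * ∫ x, inner ℝ (g (b • x)) e * ψ (x + c • z)) := by
        simp only [(h.comp_smul hb.ne').integral_mul_fderiv_add hψ hψc, real_inner_smul_left,
          mul_assoc, integral_const_mul, mul_neg, integral_neg, mul_left_comm _ b]
    _ = -(b * ∫ ξ, (∫ z, gauss z * inner ℝ (g (b • (ξ - c • z))) e) * ψ ξ) := by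
        rw [integral_conv_mul_eq one_le_two ENNReal.ofNat_ne_top hb integrable_gauss
          continuous_gauss (f := fun x => inner ℝ (g x) e) (hg.inner stronglyMeasurable_const)
          (hg2.inner_const e) hψ.continuous hψc]
    _ = -∫ ξ, inner ℝ (b • rescaledConv (gaussKer N (E N)) b c g ξ) e * ψ ξ := by
        rw [← integral_const_mul]
        refine congrArg Neg.neg (integral_congr_ae ?_)
        filter_upwards [hint] with ξ hξ
        rw [real_inner_smul_left, inner_rescaledConv_gaussKer hξ, mul_assoc]

end WeakGradientRescaledConv

/-! ### The semigroup on the weighted Sobolev space -/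

section ExpL

variable {N : ℕ}

/-- The pair `(e^{t/2}, (1 - e^{-t})^{1/2})` of parameters `(b, c)` for which `e^{t𝓛}` is, up to a
scalar, the rescaled convolution with the Gaussian at time `1`. -/
def semigroupParams (t : ℝ) : ℝ × ℝ := (Real.exp (t / 2), √(1 - Real.exp (-t)))

theorem one_sub_exp_neg_pos {t : ℝ} (ht : 0 < t) : 0 < 1 - Real.exp (-t) :=
  sub_pos.2 (Real.exp_lt_one_iff.2 (neg_lt_zero.2 ht))

theorem semigroupParams_snd_pos {t : ℝ} (ht : 0 < t) : 0 < (semigroupParams t).2 :=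
  Real.sqrt_pos.2 (one_sub_exp_neg_pos ht)

theorem semigroupParams_mem {s t : ℝ} (ht : 0 ≤ t) (hts : 0 < t ∨ s = 0) :
    semigroupParams t ∈ convParams s :=
  ⟨Real.one_le_exp (by positivity), Real.sqrt_nonneg _,
    Real.sqrt_le_one.2 (sub_le_self 1 (Real.exp_pos _).le), hts.imp_left semigroupParams_snd_pos⟩

theorem continuous_semigroupParams : Continuous semigroupParams := by
  unfold semigroupParams
  fun_prop

theorem kernelL_semigroupParams {t : ℝ} (ht : 0 < t) (ξ z : E N) :
    kernelL t ξ ((semigroupParams t).1 • (ξ - (semigroupParams t).2 • z)) =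
      ((semigroupParams t).2 ^ N)⁻¹ * gauss z := by
  have ha := one_sub_exp_neg_pos ht
  have hshift : ξ - Real.exp (-t / 2) • (semigroupParams t).1 • (ξ - (semigroupParams t).2 • z) =
      (semigroupParams t).2 • z := by
    rw [smul_smul, semigroupParams, ← Real.exp_add, ← add_div, neg_add_cancel, zero_div,
      Real.exp_zero, one_smul, sub_sub_cancel]
  have hexp : -((1 - Real.exp (-t)) * ‖z‖ ^ 2) / (4 * (1 - Real.exp (-t))) =
      -(1 / 4) * ‖z‖ ^ 2 := by field_simp
  have hpow : (1 - Real.exp (-t)) ^ (-(N : ℝ) / 2) = ((semigroupParams t).2 ^ N)⁻¹ := by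
    rw [semigroupParams, Real.sqrt_eq_rpow, ← Real.rpow_natCast, ← Real.rpow_mul ha.le,
      ← Real.rpow_neg ha.le, neg_div, one_div_mul_eq_div]
  rw [kernelL, hshift, norm_smul, mul_pow, Real.norm_of_nonneg (semigroupParams_snd_pos ht).le,
    ← hpow, semigroupParams, Real.sq_sqrt ha.le, hexp,
    Real.mul_rpow (mul_nonneg zero_le_four Real.pi_pos.le) ha.le, gauss]
  ring

theorem integral_comp_smul_sub_smul {b c : ℝ} (hb : 0 < b) (hc : 0 < c) (f : E N → ℝ) (ξ : E N) :
    ∫ z, f (b • (ξ - c • z)) = (b ^ N)⁻¹ * (c ^ N)⁻¹ * ∫ η, f η := by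
  have hdil := Measure.integral_comp_smul_of_nonneg (volume : Measure (E N))
    (fun y => f (b • (ξ - y))) c (hR := hc.le)
  have htrans := integral_sub_left_eq_self (fun y : E N => f (b • y)) volume ξ
  have hdil' := Measure.integral_comp_smul_of_nonneg (volume : Measure (E N)) f b (hR := hb.le)
  rw [hdil, htrans, hdil']
  simp only [finrank_euclideanSpace, Fintype.card_fin, smul_eq_mul]
  ring

theorem expL_eq_rescaledConv {t : ℝ} (ht : 0 ≤ t) (f : E N → ℝ) (ξ : E N) :
    expL t f ξ = Real.exp (t * N / 2) * rescaledConv (gaussKer N ℝ) (semigroupParams t).1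
      (semigroupParams t).2 f ξ := by
  rw [rescaledConv_gaussKer_real]
  rcases ht.eq_or_lt with rfl | ht
  · simp only [expL, le_refl, if_true, semigroupParams, zero_div, Real.exp_zero, neg_zero, sub_self,
      Real.sqrt_zero, zero_smul, sub_zero, one_smul, zero_mul, one_mul]
    rw [integral_mul_const, integral_gauss, one_mul]
  have hb : 0 < (semigroupParams t).1 := Real.exp_pos _
  have hc := semigroupParams_snd_pos ht
  have hchange := integral_comp_smul_sub_smul hb hc (fun η => kernelL t ξ η * f η) ξ
  simp only [kernelL_semigroupParams ht, mul_assoc, integral_const_mul] at hchange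
  have hexp : Real.exp (t * N / 2) = (semigroupParams t).1 ^ N := by
    rw [semigroupParams, ← Real.exp_nat_mul]
    congr 1
    ring
  rw [expL, if_neg ht.not_ge, hexp]
  field_simp at hchange ⊢
  exact hchange.symm

end ExpL

section OperatorsIntoH1m

variable {N : ℕ} {m : ℝ} {A : Type*} [NormedAddCommGroup A] [NormedSpace ℝ A]

/-- The operator `a ↦ (f a, g a)` into `H¹_m`. -/
def pairMap (f : A →L[ℝ] Lp ℝ 2 (weightMeasure N m)) (g : A →L[ℝ] Lp (E N) 2 (weightMeasure N m))
    (h : ∀ a, IsWeakGradient (f a) (g a)) : A →L[ℝ] H1m N m :=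
  ((WithLp.prodContinuousLinearEquiv 2 ℝ (Lp ℝ 2 (weightMeasure N m))
    (Lp (E N) 2 (weightMeasure N m))).symm.toContinuousLinearMap.comp (f.prod g)).codRestrict
    (H1m N m) h

theorem norm_H1m_sq (u : H1m N m) : ‖u‖ ^ 2 = ‖u.1.fst‖ ^ 2 + ‖u.1.snd‖ ^ 2 :=
  WithLp.prod_norm_sq_eq_of_L2 u.1

theorem norm_pairMap_le (f : A →L[ℝ] Lp ℝ 2 (weightMeasure N m))
    (g : A →L[ℝ] Lp (E N) 2 (weightMeasure N m)) (h : ∀ a, IsWeakGradient (f a) (g a)) :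
    ‖pairMap f g h‖ ≤ ‖f‖ + ‖g‖ := by
  refine ContinuousLinearMap.opNorm_le_bound _ (by positivity) fun a => ?_
  have hsq : ‖pairMap f g h a‖ ^ 2 = ‖f a‖ ^ 2 + ‖g a‖ ^ 2 := norm_H1m_sq _
  calc ‖pairMap f g h a‖ ≤ ‖f a‖ + ‖g a‖ :=
        abs_le_of_sq_le_sq' (by nlinarith [norm_nonneg (f a), norm_nonneg (g a)])
          (by positivity) |>.2
    _ ≤ (‖f‖ + ‖g‖) * ‖a‖ := by
        rw [add_mul]
        exact add_le_add (f.le_opNorm a) (g.le_opNorm a)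

theorem continuousOn_H1m {P : Type*} [TopologicalSpace P] {D : Set P} {u : P → H1m N m}
    (hfst : ContinuousOn (fun x => (u x).1.fst) D) (hsnd : ContinuousOn (fun x => (u x).1.snd) D) :
    ContinuousOn u D :=
  Topology.IsInducing.subtypeVal.continuousOn_iff.2
    ((WithLp.prod_continuous_toLp 2 (Lp ℝ 2 (weightMeasure N m))
      (Lp (E N) 2 (weightMeasure N m))).comp_continuousOn (hfst.prodMk hsnd))

theorem exists_family_into_H1m {D : Set ℝ} {U : ℝ → A →L[ℝ] Lp ℝ 2 (weightMeasure N m)}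
    {W : ℝ → A →L[ℝ] Lp (E N) 2 (weightMeasure N m)}
    (hUW : ∀ t ∈ D, ∀ y, IsWeakGradient (U t y) (W t y))
    (hU : ∀ y, ContinuousOn (fun t => U t y) D) (hW : ∀ y, ContinuousOn (fun t => W t y) D) :
    ∃ T : ℝ → A →L[ℝ] H1m N m, (∀ t ∈ D, ∀ y, (T t y).1.fst = U t y) ∧
      (∀ y, ContinuousOn (fun t => T t y) D) ∧ ∀ t ∈ D, ‖T t‖ ≤ ‖U t‖ + ‖W t‖ := by
  have hpair : ∀ t ∈ D, ∃ S : A →L[ℝ] H1m N m, (∀ y, (S y).1.fst = U t y) ∧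
      (∀ y, (S y).1.snd = W t y) ∧ ‖S‖ ≤ ‖U t‖ + ‖W t‖ := fun t ht =>
    ⟨pairMap (U t) (W t) (hUW t ht), fun _ => rfl, fun _ => rfl, norm_pairMap_le _ _ _⟩
  choose! T hfst hsnd hnorm using hpair
  exact ⟨T, hfst, fun y => continuousOn_H1m ((hU y).congr fun t ht => hfst t ht y)
    ((hW y).congr fun t ht => hsnd t ht y), hnorm⟩

end OperatorsIntoH1m

section Semigroup

variable {N : ℕ} {m : ℝ}

theorem norm_snd_le (u : H1m N m) : ‖u.1.snd‖ ≤ ‖u‖ :=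
  abs_le_of_sq_le_sq' (by nlinarith [norm_H1m_sq u, sq_nonneg ‖u.1.fst‖]) (norm_nonneg u) |>.2

/-- The function component `v ↦ v` as an operator `H¹_m → L²_m`. -/
def fstCLM (N : ℕ) (m : ℝ) : H1m N m →L[ℝ] Lp ℝ 2 (weightMeasure N m) :=
  (WithLp.fstL 2 ℝ _ _).comp (H1m N m).subtypeL

/-- The gradient `v ↦ ∇v` as an operator `H¹_m → L²_m`. -/
def gradCLM (N : ℕ) (m : ℝ) : H1m N m →L[ℝ] Lp (E N) 2 (weightMeasure N m) :=
  (WithLp.sndL 2 ℝ _ _).comp (H1m N m).subtypeL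

theorem norm_gradCLM_le : ‖gradCLM N m‖ ≤ 1 :=
  ContinuousLinearMap.opNorm_le_bound _ zero_le_one fun u => by
    rw [one_mul]
    exact norm_snd_le u

variable {V V' : Type*} [NormedAddCommGroup V] [NormedSpace ℝ V] [NormedAddCommGroup V']
  [NormedSpace ℝ V'] {Γ : E N → V →L[ℝ] V'} {p : ℝ≥0∞} [Fact (1 ≤ p)]

theorem ActsAsRescaledConv.smul_apply_ae {b c : ℝ}
    {T : Lp V p (weightMeasure N m) →L[ℝ] Lp V' 2 (weightMeasure N m)}
    (hT : ActsAsRescaledConv Γ b c T) (k : ℝ) (f : Lp V p (weightMeasure N m)) :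
    (k • T) f =ᵐ[volume] fun ξ => k • rescaledConv Γ b c f ξ := by
  filter_upwards [ae_volume_of_ae_weight (Lp.coeFn_smul k (T f)),
    ae_volume_of_ae_weight (hT f f .rfl)] with ξ hsmul hconv
  exact hsmul.trans (congrArg (k • ·) hconv)

theorem ActsAsRescaledConv.represents_expL {t : ℝ} (ht : 0 ≤ t)
    {T : Lp ℝ p (weightMeasure N m) →L[ℝ] Lp ℝ 2 (weightMeasure N m)}
    (hT : ActsAsRescaledConv (gaussKer N ℝ) (semigroupParams t).1 (semigroupParams t).2 T)
    {u : H1m N m} {f : Lp ℝ p (weightMeasure N m)}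
    (hu : u.1.fst = (Real.exp (t * N / 2) • T) f) : Represents u (expL t f) := by
  have hconv := hT.smul_apply_ae (Real.exp (t * N / 2)) f
  rw [← hu] at hconv
  exact hconv.mono fun ξ hξ => hξ.trans (expL_eq_rescaledConv ht f ξ).symm

theorem IsGaussianKernel.continuousOn_smul_operator_semigroupParams (hm : 0 < m) {A : ℝ}
    (hΓ : IsGaussianKernel Γ A) (hp : p ≠ ⊤) {s C : ℝ}
    {Op : ℝ × ℝ → Lp V p (weightMeasure N m) →L[ℝ] Lp V' 2 (weightMeasure N m)}
    (hOp : ∀ x ∈ convParams s, ‖Op x‖ ≤ C * x.2 ^ (-(N * s)) ∧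
      ActsAsRescaledConv Γ x.1 x.2 (Op x))
    {D : Set ℝ} (hD : MapsTo semigroupParams D (convParams s)) {k : ℝ → ℝ} (hk : ContinuousOn k D)
    (f : Lp V p (weightMeasure N m)) :
    ContinuousOn (fun t => (k t • Op (semigroupParams t)) f) D :=
  hk.smul ((hΓ.continuousOn_operator hm hp hOp f).comp continuous_semigroupParams.continuousOn hD)

theorem exists_semigroup (N : ℕ) (hm : 0 < m) :
    ∃ S : ℝ → H1m N m →L[ℝ] H1m N m, (∀ t, 0 ≤ t → ∀ u, Represents (S t u) (expL t (fn u))) ∧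
      ∀ u, ContinuousOn (fun t => S t u) (Ici 0) := by
  have htwo : (2 : ℝ≥0∞) = ENNReal.ofReal (1 / (1 / 2 + 0)) := by norm_num
  have hfn := isGaussianKernel_gaussKer (N := N) ℝ
  have hgrad := isGaussianKernel_gaussKer (N := N) (E N)
  obtain ⟨_, -, OpFn, hOpFn⟩ := hfn.exists_operator hm le_rfl one_half_pos.le htwo
  obtain ⟨_, -, OpGrad, hOpGrad⟩ := hgrad.exists_operator hm le_rfl one_half_pos.le htwo
  have hmem : MapsTo semigroupParams (Ici 0) (convParams 0) := fun t ht =>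
    semigroupParams_mem ht (Or.inr rfl)
  have hweak : ∀ t ∈ Ici (0 : ℝ), ∀ u : H1m N m, IsWeakGradient
      ((Real.exp (t * N / 2) • OpFn (semigroupParams t)) u.1.fst)
      ((Real.exp (t * N / 2) * (semigroupParams t).1) • OpGrad (semigroupParams t) <| u.1.snd) := by
    intro t ht u
    have hu : IsWeakGradient u.1.fst u.1.snd := u.2
    have hconv := (hu.rescaledConv_gaussKer (b := (semigroupParams t).1) (Real.exp_pos _)
      (Lp.stronglyMeasurable _) (Lp.stronglyMeasurable _)
      ((Lp.memLp _).mono_measure (volume_le_weightMeasure N m))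
      ((Lp.memLp _).mono_measure (volume_le_weightMeasure N m))
      (ae_volume_of_ae_weight (hgrad.ae_integrable hm le_rfl one_half_pos.le (hmem ht)
        (Lp.stronglyMeasurable _) (htwo ▸ Lp.memLp _)))).const_mul (Real.exp (t * N / 2))
    simp only [smul_smul] at hconv
    exact hconv.congr_ae ((hOpFn _ (hmem ht)).2.smul_apply_ae _ _).symm
      ((hOpGrad _ (hmem ht)).2.smul_apply_ae _ _).symm
  obtain ⟨S, hfst, hcont, -⟩ := exists_family_into_H1m
    (U := fun t => (Real.exp (t * N / 2) • OpFn (semigroupParams t)).comp (fstCLM N m))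
    (W := fun t => ((Real.exp (t * N / 2) * (semigroupParams t).1) •
      OpGrad (semigroupParams t)).comp (gradCLM N m)) hweak
    (fun u => hfn.continuousOn_smul_operator_semigroupParams hm ENNReal.ofNat_ne_top hOpFn hmem
      (by fun_prop) u.1.fst)
    (fun u => hgrad.continuousOn_smul_operator_semigroupParams hm ENNReal.ofNat_ne_top hOpGrad hmem
      (ContinuousOn.mul (by fun_prop) continuous_semigroupParams.fst.continuousOn) u.1.snd)
  exact ⟨S, fun t ht u => (hOpFn _ (hmem ht)).2.represents_expL ht (hfst t ht u), hcont⟩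

end Semigroup

section Smoothing

variable {N : ℕ} {m : ℝ}

theorem mul_exp_neg_le_one_sub_exp_neg {a t : ℝ} (ht : t ∈ Icc 0 a) :
    t * Real.exp (-a) ≤ 1 - Real.exp (-t) :=
  calc t * Real.exp (-a) ≤ (Real.exp t - 1) * Real.exp (-t) :=
        mul_le_mul (by linarith [Real.add_one_le_exp t])
          (Real.exp_le_exp.2 (neg_le_neg ht.2)) (Real.exp_pos _).le
          (sub_nonneg.2 (Real.one_le_exp ht.1))
    _ = 1 - Real.exp (-t) := by rw [sub_mul, ← Real.exp_add, add_neg_cancel, Real.exp_zero, one_mul]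

theorem semigroupParams_snd_rpow_le {a t κ : ℝ} (hκ : 0 ≤ κ) (ht : t ∈ Ioc 0 a) :
    (semigroupParams t).2 ^ (-κ) ≤ Real.exp (a * (κ / 2)) * t ^ (-(κ / 2)) := by
  have ht0 := ht.1
  calc (semigroupParams t).2 ^ (-κ) = (1 - Real.exp (-t)) ^ (-(κ / 2)) := by
        rw [semigroupParams, Real.sqrt_eq_rpow, ← Real.rpow_mul (one_sub_exp_neg_pos ht0).le,
          one_div_mul_eq_div, neg_div]
    _ ≤ (t * Real.exp (-a)) ^ (-(κ / 2)) :=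
        Real.rpow_le_rpow_of_nonpos (by positivity)
          (mul_exp_neg_le_one_sub_exp_neg (Ioc_subset_Icc_self ht))
          (neg_nonpos.2 (by positivity))
    _ = Real.exp (a * (κ / 2)) * t ^ (-(κ / 2)) := by
        rw [Real.mul_rpow ht0.le (Real.exp_pos _).le, ← Real.exp_mul, neg_mul_neg, mul_comm]

theorem exp_mul_add_inv_mul_le_rpow {a t κ C₁ C₂ : ℝ} (hκ : 0 ≤ κ) (ht : t ∈ Ioc 0 a)
    (hC₁ : 0 ≤ C₁) (hC₂ : 0 ≤ C₂) :
    Real.exp (t * N / 2) * (C₁ * (semigroupParams t).2 ^ (-κ)) +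
        Real.exp (t * N / 2) * (semigroupParams t).2⁻¹ * (C₂ * (semigroupParams t).2 ^ (-κ)) ≤
      Real.exp (a * N / 2) * (C₁ + C₂) * Real.exp (a * ((κ + 1) / 2)) * t ^ (-((κ + 1) / 2)) := by
  have hrpow := semigroupParams_snd_rpow_le (κ := κ + 1) (by positivity) ht
  have hc1 : (semigroupParams t).2 ≤ 1 := (semigroupParams_mem (s := 0) ht.1.le (.inr rfl)).2.2.1
  have hc := semigroupParams_snd_pos ht.1
  set c := (semigroupParams t).2
  have hinv : c⁻¹ * c ^ (-κ) = c ^ (-(κ + 1)) := by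
    rw [neg_add, Real.rpow_add hc, Real.rpow_neg_one, mul_comm]
  have hmono : c ^ (-κ) ≤ c ^ (-(κ + 1)) :=
    Real.rpow_le_rpow_of_exponent_ge hc hc1 (by linarith)
  calc Real.exp (t * N / 2) * (C₁ * c ^ (-κ)) + Real.exp (t * N / 2) * c⁻¹ * (C₂ * c ^ (-κ))
      = Real.exp (t * N / 2) * (C₁ * c ^ (-κ) + C₂ * (c⁻¹ * c ^ (-κ))) := by ring
    _ ≤ Real.exp (a * N / 2) * (C₁ * c ^ (-(κ + 1)) + C₂ * c ^ (-(κ + 1))) := by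
        rw [hinv]
        gcongr
        exact ht.2
    _ = Real.exp (a * N / 2) * (C₁ + C₂) * c ^ (-(κ + 1)) := by ring
    _ ≤ Real.exp (a * N / 2) * (C₁ + C₂) *
        (Real.exp (a * ((κ + 1) / 2)) * t ^ (-((κ + 1) / 2))) := by gcongr
    _ = _ := by ring

theorem exists_smoothing (hm : 0 < m) {s : ℝ} (hs : 0 ≤ s) (hs2 : s ≤ 1 / 2) {p : ℝ≥0∞}
    [Fact (1 ≤ p)] (hp : p = ENNReal.ofReal (1 / (1 / 2 + s))) :
    ∃ (T : ℝ → Lp ℝ p (weightMeasure N m) →L[ℝ] H1m N m) (M : ℝ → ℝ),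
      (∀ t, 0 < t → ∀ y, Represents (T t y) (expL t y)) ∧
      (∀ y, ContinuousOn (fun t => T t y) (Ioi 0)) ∧
      ∀ a, ∀ t ∈ Ioc 0 a, ‖T t‖ ≤ M a * t ^ (-((N * s + 1) / 2)) := by
  have hptop : p ≠ ⊤ := hp ▸ ENNReal.ofReal_ne_top
  have hfn := isGaussianKernel_gaussKer (N := N) ℝ
  have hgrad := isGaussianKernel_gaussGradKer (N := N)
  obtain ⟨C₁, hC₁, OpFn, hOpFn⟩ := hfn.exists_operator hm hs hs2 hp
  obtain ⟨C₂, hC₂, OpGrad, hOpGrad⟩ := hgrad.exists_operator hm hs hs2 hp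
  have hmem : MapsTo semigroupParams (Ioi 0) (convParams s) := fun t ht =>
    semigroupParams_mem (le_of_lt ht) (Or.inl ht)
  have hexp : Continuous fun t : ℝ => Real.exp (t * N / 2) := by fun_prop
  have hinv : ContinuousOn (fun t : ℝ => (semigroupParams t).2⁻¹) (Ioi 0) :=
    continuous_semigroupParams.snd.continuousOn.inv₀ fun t ht => (semigroupParams_snd_pos ht).ne'
  have hweak : ∀ t ∈ Ioi (0 : ℝ), ∀ y : Lp ℝ p (weightMeasure N m), IsWeakGradient
      ((Real.exp (t * N / 2) • OpFn (semigroupParams t)) y)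
      ((Real.exp (t * N / 2) * (semigroupParams t).2⁻¹) • OpGrad (semigroupParams t) <| y) := by
    intro t ht y
    have hconv := (isWeakGradient_rescaledConv (b := (semigroupParams t).1) Fact.out hptop
      (Real.exp_pos _) (semigroupParams_snd_pos ht).ne' (Lp.stronglyMeasurable y)
      ((Lp.memLp y).mono_measure (volume_le_weightMeasure N m))
      (ae_volume_of_ae_weight (hgrad.ae_integrable hm hs hs2 (hmem ht)
        (Lp.stronglyMeasurable y) (hp ▸ Lp.memLp y)))).const_mul (Real.exp (t * N / 2))
    simp only [smul_smul] at hconv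
    exact hconv.congr_ae ((hOpFn _ (hmem ht)).2.smul_apply_ae _ _).symm
      ((hOpGrad _ (hmem ht)).2.smul_apply_ae _ _).symm
  obtain ⟨T, hfst, hcont, hnorm⟩ := exists_family_into_H1m hweak
    (hfn.continuousOn_smul_operator_semigroupParams hm hptop hOpFn hmem hexp.continuousOn)
    (hgrad.continuousOn_smul_operator_semigroupParams hm hptop hOpGrad hmem
      (hexp.continuousOn.mul hinv))
  refine ⟨T, fun a => Real.exp (a * N / 2) * (C₁ + C₂) * Real.exp (a * ((N * s + 1) / 2)),
    fun t ht y => (hOpFn _ (hmem ht)).2.represents_expL ht.le (hfst t ht y), hcont,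
    fun a t ht => (hnorm t ht.1).trans (le_trans ?_
      (exp_mul_add_inv_mul_le_rpow (κ := N * s) (by positivity) ht hC₁ hC₂))⟩
  have hc := semigroupParams_snd_pos ht.1
  rw [norm_smul, norm_smul, norm_mul, norm_inv, Real.norm_of_nonneg (Real.exp_pos _).le,
    Real.norm_of_nonneg hc.le]
  gcongr
  exacts [(hOpFn _ (hmem ht.1)).1, (hOpGrad _ (hmem ht.1)).1]

end Smoothing

/-! ### The truncated equation -/

theorem continuousOn_Ici_of_forall_Icc {X : Type*} [TopologicalSpace X] {f : ℝ → X} {a : ℝ}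
    (hf : ∀ b, a ≤ b → ContinuousOn f (Icc a b)) : ContinuousOn f (Ici a) := by
  intro t ht
  have hat : a ≤ t + 1 := le_add_of_le_of_nonneg ht zero_le_one
  refine (hf (t + 1) hat t ⟨ht, by linarith⟩).mono_of_mem_nhdsWithin ?_
  rw [← Ici_inter_Iic]
  exact inter_mem_nhdsWithin _ (Iic_mem_nhds (by linarith))

section SingularKernels

variable {X Y : Type*} [NormedAddCommGroup X] [NormedSpace ℝ X] [NormedAddCommGroup Y]
  [NormedSpace ℝ Y] {S : ℝ → X →L[ℝ] X} {T : ℝ → Y →L[ℝ] X} {F : X → Y} {a : ℝ} {x : X}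
  {v : ℝ → X}

theorem isSingularKernel_rpow {M θ : ℝ} (ha : 0 ≤ a) (hθ : θ < 1)
    (hcont : ∀ y, ContinuousOn (fun t => T t y) (Ioi 0))
    (hbound : ∀ t ∈ Ioc 0 a, ‖T t‖ ≤ M * t ^ (-θ)) :
    IsSingularKernel T a (fun t => M * t ^ (-θ)) where
  cont y := (hcont y).mono Ioc_subset_Ioi_self
  bound := hbound
  contBound t ht := (continuousAt_const.mul
    (Real.continuousAt_rpow_const t (-θ) (Or.inl ht.1.ne'))).continuousWithinAt
  integrable := (intervalIntegrable_iff_integrableOn_Ioc_of_le ha).1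
    ((intervalIntegral.intervalIntegrable_rpow' (neg_lt_neg hθ)).const_mul M)

theorem IsMildSolution.intervalIntegrable {β : ℝ → ℝ} (h : IsMildSolution S T F a x v)
    (hF : Continuous F) (hT : IsSingularKernel T a β) {τ : ℝ} (hτ : τ ∈ Icc 0 a) :
    IntervalIntegrable (fun s => T (τ - s) (F (v s))) volume 0 τ := by
  have ha : 0 ≤ a := hτ.1.trans hτ.2
  let u : C(Icc 0 a, Y) := ⟨fun s => F (v s), hF.comp h.continuousOn.domRestrict⟩
  refine (hT.intervalIntegrable (u.continuous.Icc_extend' (h := ha)) (B := ‖u‖)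
    (fun s => u.norm_coe_le_norm _) hτ).congr fun s hs => ?_
  rw [uIoc_of_le hτ.1] at hs
  have hs' : s ∈ Icc 0 a := ⟨hs.1.le, hs.2.trans hτ.2⟩
  simp only [IccExtend_of_mem ha _ hs']
  rfl

end SingularKernels

section GlobalSolutions

variable {N : ℕ} {m : ℝ}

theorem expL_congr_ae {t : ℝ} (ht : 0 < t) {f g : E N → ℝ} (h : f =ᵐ[volume] g) :
    expL t f = expL t g := by
  ext ξ
  rw [expL, expL, if_neg ht.not_ge, if_neg ht.not_ge]
  exact integral_congr_ae (h.mono fun η hη => by simp only [hη])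

variable {χ : ℝ → ℝ} {ϱ : ℝ} {p : ℝ≥0∞} [Fact (1 ≤ p)] {S : ℝ → H1m N m →L[ℝ] H1m N m}
  {T : ℝ → Lp ℝ p (weightMeasure N m) →L[ℝ] H1m N m}
  {F : H1m N m → Lp ℝ p (weightMeasure N m)} {v₀ : H1m N m} {v : ℝ → H1m N m}

theorem represents_expL_truncF (hF : ∀ v, F v =ᵐ[volume] truncF χ ϱ v)
    (hT : ∀ t, 0 < t → ∀ y, Represents (T t y) (expL t y)) {t : ℝ} (ht : 0 < t) (u : H1m N m) :
    Represents (T t (F u)) (expL t (truncF χ ϱ u)) := by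
  rw [← expL_congr_ae ht (hF u)]
  exact hT t ht (F u)

theorem IsGlobalSolution.isMildSolution (h : IsGlobalSolution χ ϱ v₀ v)
    (hF : ∀ v, F v =ᵐ[volume] truncF χ ϱ v)
    (hS : ∀ t, 0 ≤ t → ∀ u, Represents (S t u) (expL t (fn u)))
    (hT : ∀ t, 0 < t → ∀ y, Represents (T t y) (expL t y)) (a : ℝ) :
    IsMildSolution S T F a v₀ v := by
  refine ⟨h.continuousOn.mono Icc_subset_Ici_self, fun τ hτ => ?_⟩
  obtain ⟨w, g, hw, hg, -, hduhamel⟩ := h.duhamel τ hτ.1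
  have hintegral : ∫ s in (0 : ℝ)..τ, g s = volterra T (fun s => F (v s)) τ :=
    intervalIntegral.integral_congr_Ioo_of_le hτ.1 fun s hs =>
      (hg s ⟨hs.1.le, hs.2⟩).unique (represents_expL_truncF hF hT (sub_pos.2 hs.2) _)
  rw [hduhamel, hw.unique (hS τ hτ.1 v₀), hintegral]

theorem isGlobalSolution_of_forall_isMildSolution {β : ℝ → ℝ → ℝ} (hFcont : Continuous F)
    (hF : ∀ v, F v =ᵐ[volume] truncF χ ϱ v)
    (hS : ∀ t, 0 ≤ t → ∀ u, Represents (S t u) (expL t (fn u)))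
    (hT : ∀ t, 0 < t → ∀ y, Represents (T t y) (expL t y))
    (hsing : ∀ a, 0 ≤ a → IsSingularKernel T a (β a))
    (h : ∀ a, 0 ≤ a → IsMildSolution S T F a v₀ v) : IsGlobalSolution χ ϱ v₀ v where
  continuousOn := continuousOn_Ici_of_forall_Icc fun a ha => (h a ha).continuousOn
  duhamel τ hτ := ⟨S τ v₀, fun s => T (τ - s) (F (v s)), hS τ hτ v₀,
    fun _ hs => represents_expL_truncF hF hT (sub_pos.2 hs.2) _,
    (h τ hτ).intervalIntegrable hFcont (hsing τ hτ) ⟨hτ, le_rfl⟩, (h τ hτ).eq τ ⟨hτ, le_rfl⟩⟩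

theorem isSemiflow_of_isMildSolution_iff {β : ℝ → ℝ → ℝ} (hFcont : Continuous F)
    (hF : ∀ v, F v =ᵐ[volume] truncF χ ϱ v)
    (hS : ∀ t, 0 ≤ t → ∀ u, Represents (S t u) (expL t (fn u)))
    (hT : ∀ t, 0 < t → ∀ y, Represents (T t y) (expL t y))
    (hsing : ∀ a, 0 ≤ a → IsSingularKernel T a (β a)) {φ : ℝ → H1m N m → H1m N m}
    (hφ : ∀ a, 0 ≤ a → ∀ v₀ v, IsMildSolution S T F a v₀ v ↔ ∀ τ ∈ Icc 0 a, v τ = φ τ v₀) :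
    IsSemiflow χ ϱ φ := fun v₀ =>
  ⟨isGlobalSolution_of_forall_isMildSolution hFcont hF hS hT hsing fun a ha =>
      (hφ a ha v₀ _).2 fun _ _ => rfl,
    fun v hv τ hτ => (hφ τ hτ v₀ v).1 (hv.isMildSolution hF hS hT τ) τ ⟨hτ, le_rfl⟩⟩

end GlobalSolutions

section Nonlinearity

variable {N : ℕ} {m : ℝ}

theorem qStar_sub_one (N : ℕ) : qStar N - 1 = 1 / (N + 1) := by
  rw [qStar, div_sub_one (by positivity)]
  ring

theorem one_lt_qStar (N : ℕ) : 1 < qStar N := by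
  rw [← sub_pos, qStar_sub_one]
  positivity

theorem qStar_le_two (N : ℕ) : qStar N ≤ 2 := by
  have hle : 1 / ((N : ℝ) + 1) ≤ 1 := (div_le_one (by positivity)).2 (by simp)
  linarith [qStar_sub_one N]

theorem exists_nonlinearity (m : ℝ) {χ : ℝ → ℝ} (hχ : IsCutoff χ)
    [Fact (1 ≤ ENNReal.ofReal (2 / qStar N))] :
    ∃ C : ℝ, 0 < C ∧ ∀ ϱ : ℝ, 0 < ϱ →
      ∃ F : C(H1m N m, Lp ℝ (ENNReal.ofReal (2 / qStar N)) (weightMeasure N m)),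
        (∀ v, F v =ᵐ[volume] truncF χ ϱ v) ∧
        LipschitzWith (C * ϱ ^ (qStar N - 1)).toNNReal F ∧
        ContDiff ℝ 1 F ∧ F 0 = 0 ∧ fderiv ℝ F 0 = 0 := by
  have hq := one_lt_qStar N
  have hq0 : 0 < qStar N := one_pos.trans hq
  let G : H1m N m → Lp ℝ (ENNReal.ofReal (2 / qStar N)) (weightMeasure N m) := fun v =>
    normPowLp hq0 (gradCLM N m v)
  have hpow := contDiff_normPowLp (V := E N) (μ := weightMeasure N m) hq (qStar_le_two N)
  have hG : ContDiff ℝ 1 G := hpow.comp (gradCLM N m).contDiff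
  have hGv : ∀ v, ‖G v‖ ≤ ‖v‖ ^ qStar N := fun v =>
    (norm_normPowLp_le hq0 _).trans (by gcongr; exact norm_snd_le v)
  have hG' : ∀ v, ‖fderiv ℝ G v‖ ≤ qStar N * ‖v‖ ^ (qStar N - 1) := fun v => by
    have hchain := (hpow.differentiable (by simp) _).hasFDerivAt.comp v (gradCLM N m).hasFDerivAt
    rw [show fderiv ℝ G v = _ from hchain.fderiv]
    refine (ContinuousLinearMap.opNorm_comp_le _ _).trans
      ((mul_le_of_le_one_right (norm_nonneg _) norm_gradCLM_le).trans
        ((norm_fderiv_normPowLp_le hq (qStar_le_two N) _).trans ?_))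
    gcongr
    exact norm_snd_le v
  have hG0 : G 0 = 0 := norm_le_zero_iff.1 ((hGv 0).trans_eq (by simp [hq0.ne']))
  have hG0' : HasFDerivAt G (0 : H1m N m →L[ℝ] _) 0 :=
    hasFDerivAt_of_norm_sub_sub_le_rpow (c := 1) hq fun h => by simpa [hG0] using hGv h
  obtain ⟨C, hC, hlip⟩ := hχ.exists_lipschitzWith_truncate hq hG hG' hGv
  refine ⟨C, hC, fun ϱ hϱ => ⟨⟨truncate χ ϱ G, (hlip ϱ hϱ).continuous⟩, fun v => ?_, hlip ϱ hϱ,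
    hχ.contDiff_truncate ϱ hG, by simp [truncate, hG0], hχ.fderiv_truncate_zero ϱ hG0' hG0⟩⟩
  filter_upwards [ae_volume_of_ae_weight (Lp.coeFn_smul (χ (‖v‖ ^ 2 / ϱ ^ 2)) (G v)),
    ae_volume_of_ae_weight (coeFn_normPowLp hq0 (gradCLM N m v))] with ξ hsmul hpow
  exact hsmul.trans (congrArg (χ (‖v‖ ^ 2 / ϱ ^ 2) * ·) hpow)

theorem exists_critical_smoothing {m : ℝ} (N : ℕ) (hm : 0 < m)
    [Fact (1 ≤ ENNReal.ofReal (2 / qStar N))] :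
    ∃ (T : ℝ → Lp ℝ (ENNReal.ofReal (2 / qStar N)) (weightMeasure N m) →L[ℝ] H1m N m)
      (β : ℝ → ℝ → ℝ), (∀ t, 0 < t → ∀ y, Represents (T t y) (expL t y)) ∧
      ∀ a, 0 ≤ a → IsSingularKernel T a (β a) := by
  have hs : 0 ≤ (qStar N - 1) / 2 := by linarith [one_lt_qStar N]
  have hexponent : ENNReal.ofReal (2 / qStar N) =
      ENNReal.ofReal (1 / (1 / 2 + (qStar N - 1) / 2)) := by
    rw [← add_div, add_sub_cancel, one_div_div]
  have hintegrable : (N * ((qStar N - 1) / 2) + 1) / 2 < 1 := by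
    have hlt : (N : ℝ) * (1 / (N + 1)) < 1 := by
      rw [mul_one_div, div_lt_one (by positivity)]
      linarith
    rw [qStar_sub_one]
    linarith
  obtain ⟨T, M, hT, hcont, hbound⟩ := exists_smoothing (N := N) hm hs
    (by linarith [qStar_le_two N]) hexponent
  exact ⟨T, _, hT, fun a ha => isSingularKernel_rpow ha hintegrable hcont (hbound a)⟩

end Nonlinearity

theorem mainTheorem5_general (N : ℕ) {m : ℝ} (hm : 0 < m) {χ : ℝ → ℝ} (hχ : IsCutoff χ) :
    ∃ S : H1m N m →L[ℝ] H1m N m,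
      (∀ w, Represents (S w) (expL 1 (fn w))) ∧
      ∃ C : ℝ, 0 < C ∧ ∀ ϱ : ℝ, 0 < ϱ → ϱ < 1 →
        ∃ φ : ℝ → H1m N m → H1m N m,
          IsSemiflow χ ϱ φ ∧
          ∃ R : H1m N m → H1m N m,
            (∀ w, R w = φ 1 w - S w) ∧
            ContDiff ℝ 1 R ∧
            R 0 = 0 ∧
            fderiv ℝ R 0 = 0 ∧
            LipschitzWith (C * ϱ ^ (qStar N - 1)).toNNReal R := by
  have hq := one_lt_qStar N
  have := fact_one_le_ofReal_two_div (one_pos.trans hq) (qStar_le_two N)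
  obtain ⟨S, hS, hScont⟩ := exists_semigroup N hm
  obtain ⟨T, β, hT, hsing⟩ := exists_critical_smoothing N hm
  obtain ⟨C₁, hC₁, hnonlin⟩ := exists_nonlinearity (N := N) m hχ
  obtain ⟨C₂, hflow⟩ := exists_semiflow hScont hsing zero_le_one C₁.toNNReal
  refine ⟨S 1, hS 1 zero_le_one, (C₂ + 1 : ℝ≥0) * C₁, by positivity, fun ϱ hϱ hϱ1 => ?_⟩
  obtain ⟨F, hF, hFlip, hFC, hF0, hF0'⟩ := hnonlin ϱ hϱ
  have hlip_le : (C₁ * ϱ ^ (qStar N - 1)).toNNReal ≤ C₁.toNNReal :=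
    Real.toNNReal_le_toNNReal
      (mul_le_of_le_one_right hC₁.le (Real.rpow_le_one hϱ.le hϱ1.le (sub_pos.2 hq).le))
  obtain ⟨φ, hφ, hRC, hR0, hR0', hRlip⟩ := hflow F _ hlip_le hFlip hFC hF0 hF0'
  refine ⟨φ, isSemiflow_of_isMildSolution_iff F.continuous hF hS hT hsing hφ,
    fun w => φ 1 w - S 1 w, fun _ => rfl, hRC, hR0, hR0', hRlip.weaken ?_⟩
  calc C₂ * (C₁ * ϱ ^ (qStar N - 1)).toNNReal
      ≤ (C₂ + 1) * (C₁ * ϱ ^ (qStar N - 1)).toNNReal := by gcongr; exact le_self_add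
    _ = _ := by rw [mul_assoc, Real.toNNReal_mul NNReal.zero_le_coe, Real.toNNReal_coe]

end ViscousHJ

end

theorem mainTheorem5 (N : ℕ) (hN : 1 ≤ N) (m : ℝ) (hm : (N : ℝ) / 2 < m)
    (χ : ℝ → ℝ) (hχ : ViscousHJ.IsCutoff χ) :
    ∃ S : ViscousHJ.H1m N m →L[ℝ] ViscousHJ.H1m N m,
      (∀ w, ViscousHJ.Represents (S w) (ViscousHJ.expL 1 (ViscousHJ.fn w))) ∧
      ∃ C : ℝ, 0 < C ∧ ∀ ϱ : ℝ, 0 < ϱ → ϱ < 1 →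
        ∃ φ : ℝ → ViscousHJ.H1m N m → ViscousHJ.H1m N m,
          ViscousHJ.IsSemiflow χ ϱ φ ∧
          ∃ R : ViscousHJ.H1m N m → ViscousHJ.H1m N m,
            (∀ w, R w = φ 1 w - S w) ∧
            ContDiff ℝ 1 R ∧
            R 0 = 0 ∧
            fderiv ℝ R 0 = 0 ∧
            LipschitzWith (Real.toNNReal (C * ϱ ^ (ViscousHJ.qStar N - 1))) R :=
  ViscousHJ.mainTheorem5_general N (lt_of_le_of_lt (by positivity) hm) hχ
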